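/- Let $p$ be an odd prime and let $\mathcal{G} = H \rtimes \Gamma$ be a one-dimensional $p$-adic Lie group, i.e. $\mathcal{G}$ is a profinite group, $H$ is a finite normal subgroup of $\mathcal{G}$, and $\Gamma \le \mathcal{G}$ is a subgroup that is topologically isomorphic to $\mathbb{Z}_p$ and satisfies $H \cap \Gamma = 1$ and $H\Gamma = \mathcal{G}$. Let $\Gamma_0 \le \Gamma$ be an open subgroup of $\Gamma$ that is central in $\mathcal{G}$, and let $N$ be a finite normal subgroup of $\mathcal{G}$. Let $\Lambda(\mathcal{G}) = \mathbb{Z}_p[[\mathcal{G}]] = \varprojlim \mathbb{Z}_p[\mathcal{G}/\mathcal{N}]$ (the inverse limit over all open normal subgroups $\mathcal{N}$ of $\mathcal{G}$) be the Iwasawa algebra, let $\mathcal{Q}(\mathcal{G})$ be its total ring of fractions, obtained from $\Lambda(\mathcal{G})$ by adjoining inverses of all central regular elements, and let $e_N = |N|^{-1}\sum_{\sigma\in N}\sigma$. For an integral domain $R$ with field of fractions $K$, an $R$-order in a $K$-algebra $B$ is a subring of $B$ (with the same identity) that is a finitely generated $R$-submodule of $B$ and spans $B$ over $K$; it is maximal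 if it is not properly contained in another $R$-order in $B$. The Iwasawa algebra $\Lambda(\mathcal{G})$ is called $N$-hybrid if (i) $e_N \in \Lambda(\mathcal{G})$ and (ii) $\Lambda(\mathcal{G})(1-e_N)$ is a maximal $\mathbb{Z}_p[[\Gamma_0]]$-order in $\mathcal{Q}(\mathcal{G})(1-e_N)$. For a finite group $G$ with a normal subgroup $N$, the group ring $\mathbb{Z}_p[G]$ is called $N$-hybrid if (i) $e_N \in \mathbb{Z}_p[G]$ and (ii) $\mathbb{Z}_p[G](1-e_N)$ is a maximal $\mathbb{Z}_p$-order in $\mathbb{Q}_p[G](1-e_N)$. Then $N$ is contained in $H$, and is a normal subgroup of $H$. Moreover, $\Lambda(\mathcal{G})$ is $N$-hybrid if and only if $\mathbb{Z}_p[H]$ is $N$-hybrid. -/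

import Mathlib

noncomputable section

/-! ### Orders and maximal orders -/

section Orders

variable (R : Type*) [CommRing R] {A : Type*} [Ring A] [Algebra R A]

/-- Let `f` be a central idempotent of the `R`-algebra `A`, so that `A f = f A f` is a ring with
identity element `f`. The submodule `O` is an `R`-order in `A f`: it is a subring of `A f` with the
same identity element `f`, it is finitely generated as an `R`-module, and it spans `A f` over the
field of fractions of `R`, that is, every element of `A f` has a nonzero multiple in `O`.
For `f = 1` this is the usual notion of an `R`-order in `A`. -/
structure IsOrderIn (f : A) (O : Submodule R A) : Prop where
  le_corner : ∀ x ∈ O, f * x = x ∧ x * f = x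
  one_mem : f ∈ O
  mul_mem : ∀ x ∈ O, ∀ y ∈ O, x * y ∈ O
  fg : O.FG
  full : ∀ a : A, ∃ r ∈ nonZeroDivisors R, r • (f * a * f) ∈ O

/-- `O` is a maximal `R`-order in `A f`: it is an `R`-order in `A f` that is not properly contained
in any other `R`-order in `A f`. -/
def IsMaximalOrderIn (f : A) (O : Submodule R A) : Prop :=
  Maximal (IsOrderIn R f) O

/-- The `R`-submodule `L f = {x f | x ∈ L}` of `A`, for a subalgebra `L` of `A`. -/
def cornerOf (L : Subalgebra R A) (f : A) : Submodule R A :=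
  (Subalgebra.toSubmodule L).map (LinearMap.mulRight R f)

end Orders

/-! ### The `p`-adic group ring of a finite group -/

section GroupRing

variable (p : ℕ) [Fact p.Prime] (G : Type*) [Group G]

/-- `ℤ_p[G]` as a `ℤ_p`-subalgebra of `ℚ_p[G]`. -/
def padicGroupRing : Subalgebra ℤ_[p] (MonoidAlgebra ℚ_[p] G) :=
  (MonoidAlgebra.mapAlgHom G (Algebra.ofId ℤ_[p] ℚ_[p])).range

variable {G}

/-- The trace idempotent `e_N = |N|⁻¹ ∑_{σ ∈ N} σ` in `ℚ_p[G]`. -/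
def groupRingTraceIdempotent (N : Subgroup G) [Finite N] : MonoidAlgebra ℚ_[p] G :=
  letI := Fintype.ofFinite N
  (Nat.card N : ℚ_[p])⁻¹ • ∑ σ : N, MonoidAlgebra.of ℚ_[p] G σ

/-- For a normal subgroup `N` of the finite group `G`, the group ring `ℤ_p[G]` is `N`-hybrid:
`e_N ∈ ℤ_p[G]`, and `ℤ_p[G](1 - e_N)` is a maximal `ℤ_p`-order in `ℚ_p[G](1 - e_N)`. -/
def GroupRingIsHybrid [Finite G] (N : Subgroup G) [N.Normal] : Prop :=
  groupRingTraceIdempotent p N ∈ padicGroupRing p G ∧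
    IsMaximalOrderIn ℤ_[p] (1 - groupRingTraceIdempotent p N)
      (cornerOf ℤ_[p] (padicGroupRing p G) (1 - groupRingTraceIdempotent p N))

end GroupRing

/-! ### The total ring of fractions -/

section TotalFractions

variable (A : Type*) [Ring A]

/-- The central regular elements of a ring. -/
def centralRegular : Submonoid A := Submonoid.center A ⊓ nonZeroDivisors A

variable {A}

theorem centralRegular_comm (s : centralRegular A) (a : A) : a * s = s * a :=
  Submonoid.mem_center_iff.1 s.2.1 a

instance : OreLocalization.OreSet (centralRegular A) where
  ore_right_cancel r₁ r₂ s h := ⟨s, by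
    rw [← centralRegular_comm, ← centralRegular_comm, h]⟩
  oreNum r _ := r
  oreDenom _ s := s
  ore_eq r s := (centralRegular_comm s r).symm

variable (A)

/-- The total ring of fractions of a ring, obtained by adjoining inverses of all central regular
elements. -/
abbrev TotalFractions : Type _ := OreLocalization (centralRegular A) A

/-- The canonical map from `A` to its total ring of fractions. -/
def toTotalFractions (R : Type*) [CommRing R] [Algebra R A] : A →ₐ[R] TotalFractions A where
  __ := (OreLocalization.numeratorRingHom : A →+* TotalFractions A)
  commutes' _ := rfl

end TotalFractions

/-! ### Iwasawa algebras -/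

section Iwasawa

variable (p : ℕ) [Fact p.Prime] (G : Type*) [Group G] [TopologicalSpace G]

variable {G} in
/-- The projection `G/U → G/V` for open normal subgroups `U ≤ V` of `G`. -/
def quotientTransition {U V : OpenNormalSubgroup G} (h : U.toSubgroup ≤ V.toSubgroup) :
    G ⧸ U.toSubgroup →* G ⧸ V.toSubgroup :=
  QuotientGroup.map U.toSubgroup V.toSubgroup (MonoidHom.id G) (h.trans_eq (Subgroup.comap_id _).symm)

/-- The inverse limit of the group rings `ℤ_p[G/U]` over all open normal subgroups `U` of `G`,
inside their product: the families that are compatible with the projections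
`ℤ_p[G/U] → ℤ_p[G/V]` for `U ≤ V`. -/
def iwasawaSubalgebra : Subalgebra ℤ_[p]
    ((U : OpenNormalSubgroup G) → MonoidAlgebra ℤ_[p] (G ⧸ U.toSubgroup)) where
  carrier := {x | ∀ (U V : OpenNormalSubgroup G) (h : U.toSubgroup ≤ V.toSubgroup),
    MonoidAlgebra.mapDomainAlgHom ℤ_[p] ℤ_[p] (quotientTransition h) (x U) = x V}
  mul_mem' {x y} hx hy U V h := by
    rw [Pi.mul_apply, map_mul, hx U V h, hy U V h, Pi.mul_apply]
  add_mem' {x y} hx hy U V h := by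
    rw [Pi.add_apply, map_add, hx U V h, hy U V h, Pi.add_apply]
  algebraMap_mem' r U V h := by
    rw [Pi.algebraMap_apply, AlgHom.commutes, Pi.algebraMap_apply]

/-- The Iwasawa algebra `Λ(G) = ℤ_p[[G]]` of a profinite group `G`. -/
def IwasawaAlgebra : Type _ := iwasawaSubalgebra p G

namespace IwasawaAlgebra

instance : Ring (IwasawaAlgebra p G) := inferInstanceAs (Ring (iwasawaSubalgebra p G))

instance : Algebra ℤ_[p] (IwasawaAlgebra p G) :=
  inferInstanceAs (Algebra ℤ_[p] (iwasawaSubalgebra p G))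

variable {p G}

/-- The component of an element of `Λ(G)` in `ℤ_p[G/U]`. -/
def proj (U : OpenNormalSubgroup G) :
    IwasawaAlgebra p G →ₐ[ℤ_[p]] MonoidAlgebra ℤ_[p] (G ⧸ U.toSubgroup) :=
  (Pi.evalAlgHom ℤ_[p] _ U).comp (iwasawaSubalgebra p G).val

@[ext]
theorem ext {x y : IwasawaAlgebra p G} (h : ∀ U, proj U x = proj U y) : x = y :=
  Subtype.ext (funext h)

theorem proj_compat (x : IwasawaAlgebra p G) {U V : OpenNormalSubgroup G}
    (h : U.toSubgroup ≤ V.toSubgroup) :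
    MonoidAlgebra.mapDomainAlgHom ℤ_[p] ℤ_[p] (quotientTransition h) (proj U x) = proj V x :=
  x.2 U V h

variable (p) in
/-- The canonical map `G → Λ(G)`. -/
def of : G →* IwasawaAlgebra p G :=
  (MonoidHom.pi fun U : OpenNormalSubgroup G =>
    (MonoidAlgebra.of ℤ_[p] (G ⧸ U.toSubgroup)).comp (QuotientGroup.mk' U.toSubgroup)).codRestrict
    (iwasawaSubalgebra p G) (by
      intro g U V h
      simp [quotientTransition, MonoidHom.pi_apply])

theorem proj_of (U : OpenNormalSubgroup G) (g : G) :
    proj U (of p g) = MonoidAlgebra.of ℤ_[p] _ (QuotientGroup.mk' U.toSubgroup g) := rfl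

section Functoriality

variable {G' : Type*} [Group G'] [TopologicalSpace G']

/-- The preimage of an open normal subgroup under a continuous homomorphism. -/
def comapOpenNormal (φ : G →ₜ* G') (U : OpenNormalSubgroup G') : OpenNormalSubgroup G where
  toOpenSubgroup := U.toOpenSubgroup.comap φ.toMonoidHom φ.continuous_toFun
  isNormal' := by
    rw [OpenSubgroup.toSubgroup_comap]
    infer_instance

/-- The homomorphism `G/φ⁻¹(U) → G'/U` induced by `φ`. -/
def quotientMap (φ : G →ₜ* G') (U : OpenNormalSubgroup G') :
    G ⧸ (comapOpenNormal φ U).toSubgroup →* G' ⧸ U.toSubgroup :=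
  QuotientGroup.map _ _ φ.toMonoidHom le_rfl

/-- The homomorphism `Λ(G) → Λ(G')` induced by a continuous homomorphism `φ : G → G'`. -/
def map (φ : G →ₜ* G') : IwasawaAlgebra p G →ₐ[ℤ_[p]] IwasawaAlgebra p G' :=
  AlgHom.codRestrict
    (AlgHom.pi fun U : OpenNormalSubgroup G' =>
      (MonoidAlgebra.mapDomainAlgHom ℤ_[p] ℤ_[p] (quotientMap φ U)).comp
        (proj (comapOpenNormal φ U)))
    (iwasawaSubalgebra p G') (by
      intro x U V h
      have h' : (comapOpenNormal φ U).toSubgroup ≤ (comapOpenNormal φ V).toSubgroup :=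
        fun _ hg => h hg
      simp only [AlgHom.pi_apply, AlgHom.comp_apply]
      rw [← proj_compat x h']
      have e : (quotientTransition h).comp (quotientMap φ U) =
          (quotientMap φ V).comp (quotientTransition h') := QuotientGroup.monoidHom_ext _ rfl
      have := congrArg (fun f => MonoidAlgebra.mapDomainAlgHom ℤ_[p] ℤ_[p] f
        (proj (comapOpenNormal φ U) x)) e
      simpa only [MonoidAlgebra.mapDomainAlgHom_comp, AlgHom.comp_apply] using this)

theorem proj_map (φ : G →ₜ* G') (U : OpenNormalSubgroup G') (x : IwasawaAlgebra p G) :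
    proj U (map φ x) = MonoidAlgebra.mapDomainAlgHom ℤ_[p] ℤ_[p] (quotientMap φ U)
      (proj (comapOpenNormal φ U) x) := rfl

theorem map_of (φ : G →ₜ* G') (g : G) : map φ (of p g) = of p (φ g) := by
  apply ext
  intro U
  rw [proj_map, proj_of, proj_of]
  simp [quotientMap]

theorem mapDomain_commute {M M' : Type*} [Monoid M] [Monoid M'] (f : M →* M')
    (hf : ∀ m n, Commute (f m) n) (x : MonoidAlgebra ℤ_[p] M) (y : MonoidAlgebra ℤ_[p] M') :
    Commute (MonoidAlgebra.mapDomainAlgHom ℤ_[p] ℤ_[p] f x) y := by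
  induction x using MonoidAlgebra.induction_linear with
  | zero => rw [map_zero]; exact Commute.zero_left _
  | add a b ha hb => rw [map_add]; exact ha.add_left hb
  | single m r =>
    induction y using MonoidAlgebra.induction_linear with
    | zero => exact Commute.zero_right _
    | add a b ha hb => exact ha.add_right hb
    | single n s =>
      rw [MonoidAlgebra.mapDomainAlgHom_apply, MonoidAlgebra.mapDomain_single]
      rw [Commute, SemiconjBy, MonoidAlgebra.single_mul_single, MonoidAlgebra.single_mul_single,
        (hf m n).eq, mul_comm r s]

theorem map_commute (φ : G →ₜ* G') (hφ : ∀ a b, Commute (φ a) b) (x : IwasawaAlgebra p G)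
    (y : IwasawaAlgebra p G') : Commute (map φ x) y := by
  apply ext
  intro U
  rw [map_mul, map_mul, proj_map]
  refine mapDomain_commute _ (fun m n => ?_) _ _
  induction m using QuotientGroup.induction_on with | H a =>
  induction n using QuotientGroup.induction_on with | H b =>
  exact congrArg (QuotientGroup.mk' U.toSubgroup) (hφ a b).eq

theorem map_id (x : IwasawaAlgebra p G) : map (ContinuousMonoidHom.id G) x = x := by
  apply ext
  intro U
  rw [proj_map]
  exact proj_compat x (U := comapOpenNormal (ContinuousMonoidHom.id G) U) (V := U) le_rfl

end Functoriality

instance [IsMulCommutative G] : CommRing (IwasawaAlgebra p G) where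
  mul_comm x y := by
    have := map_commute (ContinuousMonoidHom.id G) (fun a b => mul_comm' a b) x y
    rwa [map_id] at this

/-- The inclusion of a subgroup as a continuous homomorphism. -/
def inclusionHom (G₀ : Subgroup G) : G₀ →ₜ* G where
  toMonoidHom := G₀.subtype
  continuous_toFun := continuous_subtype_val

instance (G₀ : Subgroup G) [h : Fact (G₀ ≤ Subgroup.center G)] : IsMulCommutative G₀ :=
  ⟨⟨fun a b => Subtype.ext (Subgroup.mem_center_iff.1 (h.1 b.2) a)⟩⟩

/-- For a central subgroup `G₀` of `G`, the ring `Λ(G)` is a `Λ(G₀)`-algebra through the ring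
homomorphism induced by the inclusion of `G₀` in `G`. -/
instance (G₀ : Subgroup G) [h : Fact (G₀ ≤ Subgroup.center G)] :
    Algebra (IwasawaAlgebra p G₀) (IwasawaAlgebra p G) :=
  (map (inclusionHom G₀)).toRingHom.toAlgebra' fun x y =>
    map_commute (inclusionHom G₀) (fun a b => (Subgroup.mem_center_iff.1 (h.1 a.2) b).symm) x y

theorem natCast_mem_centralRegular {n : ℕ} (hn : n ≠ 0) :
    (n : IwasawaAlgebra p G) ∈ centralRegular (IwasawaAlgebra p G) := by
  have key : ∀ y : IwasawaAlgebra p G, (n : IwasawaAlgebra p G) * y = 0 → y = 0 := by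
    intro y hy
    apply ext
    intro U
    have h := congrArg (proj U) hy
    rw [← nsmul_eq_mul, map_nsmul, map_zero] at h
    rw [map_zero]
    ext g
    have h2 : n • (proj U y).coeff g = 0 := by
      rw [← Finsupp.smul_apply, ← MonoidAlgebra.coeff_smul, h]
      rfl
    exact (smul_eq_zero.1 h2).resolve_left hn
  refine ⟨Submonoid.mem_center_iff.2 fun g => (Nat.cast_commute n g).symm.eq, ?_⟩
  exact ⟨key, fun y hy => key y (by rw [← hy]; exact (Nat.cast_commute n y).eq)⟩

variable (p)

/-- The trace idempotent `e_N = |N|⁻¹ ∑_{σ ∈ N} σ` in the total ring of fractions of `Λ(G)`. -/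
def traceIdempotent (N : Subgroup G) [Finite N] : TotalFractions (IwasawaAlgebra p G) :=
  letI := Fintype.ofFinite N
  (∑ σ : N, of p (σ : G)) /ₒ
    (⟨(Nat.card N : IwasawaAlgebra p G), natCast_mem_centralRegular Nat.card_pos.ne'⟩ :
      centralRegular (IwasawaAlgebra p G))

/-- For a finite normal subgroup `N` and a central subgroup `G₀` of `G`, the Iwasawa algebra `Λ(G)`
is `N`-hybrid (with respect to `G₀`): with `Q(G)` the total ring of fractions of `Λ(G)`, one has
`e_N ∈ Λ(G)`, and `Λ(G)(1 - e_N)` is a maximal `ℤ_p[[G₀]]`-order in `Q(G)(1 - e_N)`. -/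
def IsHybrid (G₀ : Subgroup G) [Fact (G₀ ≤ Subgroup.center G)] (N : Subgroup G) [Finite N]
    [N.Normal] : Prop :=
  traceIdempotent p N ∈ (toTotalFractions (IwasawaAlgebra p G) (IwasawaAlgebra p G₀)).range ∧
    IsMaximalOrderIn (IwasawaAlgebra p G₀) (1 - traceIdempotent p N)
      (cornerOf (IwasawaAlgebra p G₀)
        (toTotalFractions (IwasawaAlgebra p G) (IwasawaAlgebra p G₀)).range
        (1 - traceIdempotent p N))

end IwasawaAlgebra

end Iwasawa

end

/-!
Write `A = ℤ_p[H]`, `F = 𝔽_p[H]`, `Λ = Λ(G)`, `S = Λ(Γ₀)` and `ε = 1 - e_N`. A finite normal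
subgroup lies in `H` because `G/H ≅ ℤ_p` is torsion-free. Either hybrid condition forces `|N|` to be
a unit of `ℤ_p`, so `ε` is a central idempotent of `A` that is fixed under conjugation by `G`. It
remains to see that `Aε` is a maximal `ℤ_p`-order if and only if `Λε` is a maximal `S`-order. Both
conditions are shown to be equivalent to the following one: the sum `σ` of the elements of
`p`-power order of `H` is invertible in `Fε`, that is, `p ∣ σ w - ε` for some `w ∈ A`.

*From maximality to `σ`.* Let `J` be the preimage in `Aε` of the Jacobson radical of `F`
(`radicalLattice`). If `Aε` is maximal, the right order of `J` is `Aε`. The same holds if `Λε` is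
maximal: that right order is stable under conjugation by `G`, hence generates over `S` an order
containing `Λε`; see `IwasawaAlgebra.dvd_of_mem_rightOrder_of_isMaximalOrderIn`. Since `A` is a
symmetric algebra, duality shows that a `J` with right order `Aε` is invertible
(`natCast_mul_mem_dualProduct`), so the first cohomology of a Sylow `p`-subgroup with values in `J`
vanishes, and every fixed vector of `Aε / J` is a norm. This makes `Aε / J` free over the Sylow
subgroup, hence projective over `F`, and so `Fε` is semisimple (`redModP_mul_eq_zero_of_order`).
For a semisimple `Fε`, multiplication by `σ` is injective on the center: the trace form
`b ↦ (d b)₁` is determined by its values on `p ^ n`-th powers, and modulo `p` the coefficient at `1`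
of `y ^ p ^ n` is the `p ^ n`-th power of the sum of the coefficients of `y` at the `p`-elements,
which is the coefficient at `1` of `σ y` (`MonoidAlgebra.coeff_one_pow`,
`exists_pElementSum_mul_eq`).

*From `σ` to maximality.* Let `O'` be an order containing `O = Aε` or `O = Λε`. Some power of `p`
multiplies `O'` into `O`. For `Aε` this is clear; for `Λε` it holds because `S ≅ ℤ_p[[T]]` is
integrally closed (`IwasawaAlgebra.isIntegrallyClosed_of_padic`), so that the traces over `S` of
elements of `O'` lie in `S`, and these traces are the coefficients up to the factor `[G : Γ₀]`
(`IwasawaAlgebra.card_mul_mem_cornerOf`). The right ideal `O ∩ p O'` is then nil modulo `p`. By the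
formula for the coefficients of a `p`-power, every element `x` of such a right ideal satisfies
`p ∣ x σ`, and then `p ∣ x σ w`, so `p ∣ x ε = x` (`dvd_of_right_nil` and
`IwasawaAlgebra.dvd_of_right_nil`). Hence `O ∩ p O' ⊆ p O`, and `O' = O` follows
(`isMaximalOrderIn_of_nil`).
-/

noncomputable section

/-! ### The Frobenius map on the modular group algebra of a finite group -/

section Frobenius

open Finset

/-- A sum over `X`, invariant under a permutation of `p`-power order, is modulo `p` the sum over
the fixed points: all other cycles have length divisible by `p`. -/
theorem sum_eq_sum_fixedPoints {X R : Type*} [Fintype X] [DecidableEq X] [CommRing R] (p : ℕ)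
    [Fact p.Prime] [CharP R p] {n : ℕ} (σ : Equiv.Perm X) (hσ : σ ^ p ^ n = 1) (f : X → R)
    (hf : ∀ x, f (σ x) = f x) : ∑ x, f x = ∑ x with σ x = x, f x := by
  classical
  have key : ∀ r : R, ((#{x | f x = r} : ℕ) : R) =
      (#{x ∈ ({x | σ x = x} : Finset X) | f x = r} : ℕ) := by
    intro r
    rw [CharP.cast_eq_iff_mod_eq R p]
    let τ : Equiv.Perm {x // f x = r} := σ.subtypePerm (fun x => by rw [hf])
    have hτ : τ ^ p ^ n = 1 := by
      rw [Equiv.Perm.subtypePerm_pow]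
      ext x
      simp [hσ]
    have h := Equiv.Perm.card_compl_support_modEq hτ
    rw [Fintype.card_subtype] at h
    refine h.symm.trans ?_
    have : #τ.supportᶜ = #{x ∈ ({x | σ x = x} : Finset X) | f x = r} := by
      refine card_bij (fun x _ => x.1) ?_ ?_ ?_
      · intro x hx
        have hx' : τ x = x := by simpa using hx
        have h2 : σ x.1 = x.1 := congrArg Subtype.val hx'
        simpa [x.2] using h2
      · intro x _ y _ h
        exact Subtype.ext h
      · intro x hx
        simp only [mem_filter, mem_univ, true_and] at hx
        exact ⟨⟨x, hx.2⟩, by simpa [τ, Subtype.ext_iff] using hx.1, rfl⟩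
    rw [this]
  have h1 : ∀ s : Finset X, ∑ x ∈ s, f x =
      ∑ r ∈ univ.image f, ((#{x ∈ s | f x = r} : ℕ) : R) * r := by
    intro s
    rw [← sum_fiberwise_of_maps_to (t := univ.image f) (g := f)
      (fun x _ => mem_image_of_mem f (mem_univ x))]
    refine sum_congr rfl fun r _ => ?_
    rw [← nsmul_eq_mul, ← sum_const]
    exact sum_congr rfl fun x hx => (mem_filter.1 hx).2
  rw [h1, h1]
  exact sum_congr rfl fun r _ => by rw [key]

variable {R K : Type*} [CommRing R] [Group K] [Fintype K]

theorem MonoidAlgebra.sum_single_coeff {R K : Type*} [CommRing R] [Fintype K]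
    (y : MonoidAlgebra R K) :
    ∑ g, MonoidAlgebra.single g (y.coeff g) = y := by
  ext h
  simp [MonoidAlgebra.coeff_sum]

theorem MonoidAlgebra.pow_eq_sum_vector (y : MonoidAlgebra R K) (n : ℕ) :
    y ^ n = ∑ v : List.Vector K n,
      MonoidAlgebra.single v.toList.prod (v.toList.map y.coeff).prod := by
  induction n with
  | zero =>
    rw [Fintype.sum_eq_single (List.Vector.nil : List.Vector K 0)
      (fun v hv => absurd v.eq_nil hv)]
    simp [MonoidAlgebra.one_def]
  | succ n ih =>
    rw [pow_succ', ih]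
    nth_rewrite 1 [← MonoidAlgebra.sum_single_coeff y]
    rw [sum_mul_sum, ← sum_product']
    refine Finset.sum_bij' (fun x _ => x.1 ::ᵥ x.2) (fun v _ => (v.head, v.tail)) ?_ ?_ ?_ ?_ ?_
    · simp
    · simp
    · simp
    · simp
    · intro x _
      rw [MonoidAlgebra.single_mul_single]
      simp

/-- In characteristic `p`, raising to a `p`-power is additive modulo commutators; the coefficient
at `1`, a trace form, therefore only sees the elements of `p`-power order. -/
theorem MonoidAlgebra.coeff_one_pow (p : ℕ) [Fact p.Prime] [CharP R p] (y : MonoidAlgebra R K)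
    (n : ℕ) [DecidableEq K] :
    (y ^ p ^ n).coeff 1 = ∑ g with g ^ p ^ n = 1, y.coeff g ^ p ^ n := by
  classical
  set Q := p ^ n with hQ
  have hQ0 : 0 < Q := pow_pos (Fact.out (p := p.Prime)).pos _
  have : NeZero Q := ⟨hQ0.ne'⟩
  -- The coefficient is a sum over the `Q`-tuples with product `1`; the cyclic rotation `σ` permutes
  -- these tuples, and its fixed points are the constant tuples.
  let X := Equiv.Perm.vectorsProdEqOne K Q
  let F : X → R := fun v => (v.1.toList.map y.coeff).prod
  have h1 : (y ^ Q).coeff 1 = ∑ v : X, F v := by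
    rw [MonoidAlgebra.pow_eq_sum_vector, MonoidAlgebra.coeff_sum, Finsupp.finsetSum_apply]
    simp only [MonoidAlgebra.coeff_single, Finsupp.single_apply]
    rw [← sum_filter]
    refine (sum_subtype _ (fun v => ?_) _)
    simp [Equiv.Perm.VectorsProdEqOne.mem_iff]
  let rot : ℕ → X → X := fun k v => Equiv.Perm.VectorsProdEqOne.rotate v k
  have hf1 : ∀ v, rot 0 v = v := Equiv.Perm.VectorsProdEqOne.rotate_zero
  have hf2 : ∀ j k v, rot k (rot j v) = rot (j + k) v := fun j k v =>
    Equiv.Perm.VectorsProdEqOne.rotate_rotate v j k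
  have hf3 : ∀ v, rot Q v = v := Equiv.Perm.VectorsProdEqOne.rotate_length
  let σ : Equiv.Perm X :=
    Equiv.mk (rot 1) (rot (Q - 1))
      (fun s => by rw [hf2, add_tsub_cancel_of_le (Nat.succ_le_of_lt hQ0), hf3])
      fun s => by rw [hf2, tsub_add_cancel_of_le (Nat.succ_le_of_lt hQ0), hf3]
  have hσ : ∀ k v, (σ ^ k) v = rot k v := fun k =>
    Nat.rec (fun v => (hf1 v).symm) (fun k hk v => by
      rw [pow_succ, Equiv.Perm.mul_apply, hk (σ v), Nat.succ_eq_one_add, ← hf2 1 k]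
      simp only [σ, Equiv.coe_fn_mk]) k
  have hσ' : σ ^ p ^ n = 1 := Equiv.ext fun v => by
    rw [← hQ, hσ, hf3, Equiv.Perm.one_apply]
  rw [h1, sum_eq_sum_fixedPoints p σ hσ' F]
  · symm
    have hmem : ∀ g : K, g ^ Q = 1 → List.Vector.replicate Q g ∈ X := by
      intro g hg
      rw [Equiv.Perm.VectorsProdEqOne.mem_iff]
      simpa [List.Vector.replicate] using hg
    refine Finset.sum_bij (fun g hg => ⟨List.Vector.replicate Q g, hmem g (by simpa using hg)⟩)
      ?_ ?_ ?_ ?_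
    · intro g _
      simp only [mem_filter, mem_univ, true_and]
      exact Subtype.ext (Subtype.ext (List.rotate_replicate g Q 1))
    · intro g _ g' _ h
      have h2 : List.replicate Q g = List.replicate Q g' :=
        congrArg (fun v : X => v.1.toList) h
      exact (List.replicate_right_inj hQ0.ne').1 h2
    · intro v hv
      have hv' : σ v = v := by simpa using hv
      have h2 : v.1.toList.rotate 1 = v.1.toList := congrArg (fun v : X => v.1.toList) hv'
      obtain ⟨g, hg⟩ := List.rotate_one_eq_self_iff_eq_replicate.1 h2
      rw [List.Vector.toList_length] at hg
      have h3 : g ^ Q = 1 := by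
        have := (Equiv.Perm.VectorsProdEqOne.mem_iff K v.1).1 v.2
        rwa [hg, List.prod_replicate] at this
      exact ⟨g, by simpa using h3, Subtype.ext (Subtype.ext hg.symm)⟩
    · intro g _
      simp [F, List.Vector.replicate]
  · intro v
    exact ((v.1.toList.rotate_perm 1).map _).prod_eq

end Frobenius

/-! ### The sum of the `p`-elements and semisimple blocks -/

section Semisimple

/-- In a finite semisimple ring of characteristic `p`, every element is a sum of `p`-power powers
and commutators: an additive trace form vanishing on all `p ^ n`-th powers is zero. -/
theorem traceForm_eq_zero_of_pow {A M : Type*} [Ring A] [Finite A] [IsSemisimpleRing A]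
    [AddCommGroup M] (p : ℕ) [Fact p.Prime] (hpA : (p : A) = 0) (n : ℕ) (f : A →+ M)
    (hf : ∀ x y, f (x * y) = f (y * x)) (hpow : ∀ x, f (x ^ p ^ n) = 0) : f = 0 := by
  classical
  obtain ⟨m, D, d, hD, hd, ⟨e⟩⟩ := IsSemisimpleRing.exists_ringEquiv_pi_matrix_divisionRing A
  let E : ∀ i : Fin m, Fin (d i) → Fin (d i) → D i →
      ∀ i : Fin m, Matrix (Fin (d i)) (Fin (d i)) (D i) :=
    fun i a b c => Pi.single i (Matrix.single a b c)
  have hEmul : ∀ i a b b' c x y, E i a b x * E i b' c y =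
      if b = b' then E i a c (x * y) else 0 := by
    intro i a b b' c x y
    simp only [E, ← Pi.single_mul]
    split_ifs with h
    · subst h; simp
    · rw [Matrix.single_mul_single_of_ne _ _ _ _ h, Pi.single_zero]
  have key : ∀ i a b c, f (e.symm (E i a b c)) = 0 := by
    intro i a b c
    by_cases hab : a = b
    -- The division ring `D i` is a finite field by Wedderburn, so its Frobenius map is surjective and
    -- a diagonal matrix unit is a `p ^ n`-th power.
    · subst hab
      have hfin : Finite (D i) := Finite.of_surjective (fun x : A => e x i a a)
        (fun c => ⟨e.symm (E i a a c), by simp [E]⟩)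
      have hcomm : ∀ x y : D i, x * y = y * x := (littleWedderburn (D i)).mul_comm
      have hp0 : (p : D i) = 0 := by
        have : e (p : A) = 0 := by rw [hpA, map_zero]
        rw [map_natCast] at this
        have := congrFun (congrFun (congrFun this i) a) a
        rw [← Nat.cast_zero (R := D i)]
        simpa [Matrix.natCast_apply] using this
      have : CharP (D i) p := by
        have h := CharP.exists (D i)
        obtain ⟨q, hq⟩ := h
        have hdvd := (CharP.cast_eq_zero_iff (D i) q p).1 hp0
        rcases (Nat.dvd_prime (Fact.out (p := p.Prime))).1 hdvd with h | h
        · subst h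
          exact absurd (CharP.cast_eq_zero (D i) 1) (by rw [Nat.cast_one]; exact one_ne_zero)
        · exact h ▸ hq
      have hinj : Function.Injective (fun x : D i => x ^ p ^ n) := by
        intro x y hxy
        have h : (x - y) ^ p ^ n = 0 := by
          rw [sub_pow_char_pow_of_commute _ _ (hcomm x y)]
          exact sub_eq_zero.2 hxy
        have hpn : p ^ n ≠ 0 := pow_ne_zero _ (Fact.out (p := p.Prime)).ne_zero
        exact sub_eq_zero.1 ((pow_eq_zero_iff hpn).1 h)
      obtain ⟨r, hr⟩ := Finite.surjective_of_injective hinj c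
      have hEpow : ∀ k, (E i a a r) ^ (k + 1) = E i a a (r ^ (k + 1)) := by
        intro k
        induction k with
        | zero => simp
        | succ k ih => rw [pow_succ, ih, hEmul, if_pos rfl, ← pow_succ]
      obtain ⟨k, hk⟩ := Nat.exists_eq_succ_of_ne_zero
        (pow_ne_zero n (Fact.out (p := p.Prime)).ne_zero)
      have := hpow (e.symm (E i a a r))
      rw [← map_pow, hk, hEpow, ← Nat.succ_eq_add_one, ← hk] at this
      rw [← this, ← hr]
    -- An off-diagonal matrix unit is a commutator.
    · have h1 : E i a b c = E i a a 1 * E i a b c := by rw [hEmul, if_pos rfl, one_mul]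
      have h2 : E i a b c * E i a a 1 = 0 := by rw [hEmul, if_neg (Ne.symm hab)]
      rw [h1, map_mul, hf, ← map_mul, h2, map_zero, map_zero]
  ext x
  have hx : e x = ∑ i, ∑ a, ∑ b, E i a b (e x i a b) := by
    conv_lhs => rw [← Finset.univ_sum_single (e x)]
    refine Finset.sum_congr rfl fun i _ => ?_
    conv_lhs => rw [Matrix.matrix_eq_sum_single (e x i)]
    simp only [E, ← LinearMap.coe_single (R := ℕ), map_sum]
  rw [← e.symm_apply_apply x, hx]
  simp only [map_sum, key, Finset.sum_const_zero, AddMonoidHom.zero_apply]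

end Semisimple

section PElements

variable (p : ℕ) {R K : Type*} [CommRing R] [Group K] [Fintype K]

open scoped Classical in
variable (R K) in
/-- The sum of all elements of `p`-power order of a finite group, in its group ring. -/
def pElementSum : MonoidAlgebra R K :=
  ∑ g with ∃ k, g ^ p ^ k = (1 : K), MonoidAlgebra.single g 1

theorem pow_card_eq_one_iff [Fact p.Prime] {g : K} {n : ℕ} (hn : Nat.card K ≤ n) :
    g ^ p ^ n = 1 ↔ ∃ k, g ^ p ^ k = 1 := by
  refine ⟨fun h => ⟨n, h⟩, fun ⟨k, hk⟩ => ?_⟩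
  obtain ⟨j, -, hj⟩ := (Nat.dvd_prime_pow (Fact.out (p := p.Prime))).1
    (orderOf_dvd_of_pow_eq_one hk)
  have h1 : p ^ j ≤ Nat.card K := hj ▸ orderOf_le_card
  have h2 : j < p ^ j := Nat.lt_pow_self (Fact.out (p := p.Prime)).one_lt
  exact orderOf_dvd_iff_pow_eq_one.1 (hj ▸ pow_dvd_pow p (by omega))

open scoped Classical in
theorem coeff_one_mul_pElementSum (y : MonoidAlgebra R K) :
    (y * pElementSum p R K).coeff 1 = ∑ g with ∃ k, g ^ p ^ k = (1 : K), y.coeff g := by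
  rw [pElementSum, Finset.mul_sum, MonoidAlgebra.coeff_sum, Finsupp.finsetSum_apply]
  refine Finset.sum_nbij' (fun g => g⁻¹) (fun g => g⁻¹) ?_ ?_ ?_ ?_ ?_
  · intro g; simp
  · intro g; simp
  · simp
  · simp
  · intro g _
    simp

theorem pElementSum_commute (y : MonoidAlgebra R K) : Commute (pElementSum p R K) y := by
  classical
  induction y using MonoidAlgebra.induction_linear with
  | zero => exact Commute.zero_right _
  | add a b ha hb => exact ha.add_right hb
  | single m r =>
    rw [Commute, SemiconjBy, pElementSum, Finset.sum_mul, Finset.mul_sum]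
    refine Finset.sum_nbij' (fun g => m⁻¹ * g * m) (fun g => m * g * m⁻¹) ?_ ?_ ?_ ?_ ?_
    · rintro g hg
      simp only [Finset.mem_filter, Finset.mem_univ, true_and] at hg ⊢
      obtain ⟨k, hk⟩ := hg
      refine ⟨k, ?_⟩
      have := conj_pow (i := p ^ k) (a := m⁻¹) (b := g)
      rw [inv_inv] at this
      rw [this, hk]; simp
    · rintro g hg
      simp only [Finset.mem_filter, Finset.mem_univ, true_and] at hg ⊢
      obtain ⟨k, hk⟩ := hg
      exact ⟨k, by rw [conj_pow, hk]; simp⟩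
    · intro g _; group
    · intro g _; group
    · intro g _
      rw [MonoidAlgebra.single_mul_single, MonoidAlgebra.single_mul_single, mul_comm]
      congr 1; group

end PElements

section ModularGroupAlgebra

variable (p : ℕ) [Fact p.Prime] {K : Type*} [Group K] [Fintype K]

instance MonoidAlgebra.finite_of_finite {R K : Type*} [CommRing R] [Finite R] [Finite K] :
    Finite (MonoidAlgebra R K) := by
  have := Finite.of_injective (fun f : K →₀ R => (f : K → R)) DFunLike.coe_injective
  exact Finite.of_equiv (K →₀ R) MonoidAlgebra.coeffEquiv.symm

theorem MonoidAlgebra.coeff_one_mul_comm {R K : Type*} [CommRing R] [Group K]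
    (x y : MonoidAlgebra R K) : (x * y).coeff 1 = (y * x).coeff 1 := by
  induction x using MonoidAlgebra.induction_linear with
  | zero => simp
  | add a b ha hb => simp [add_mul, mul_add, ha, hb]
  | single m r => simp [MonoidAlgebra.coeff_single_mul_apply, MonoidAlgebra.coeff_mul_single_apply,
      mul_comm]

theorem MonoidAlgebra.eq_zero_of_coeff_one_mul {R K : Type*} [CommRing R] [Group K]
    (x : MonoidAlgebra R K) (h : ∀ y, (x * y).coeff 1 = 0) : x = 0 := by
  ext g
  have := h (single g⁻¹ 1)
  simpa [MonoidAlgebra.coeff_mul_single_apply] using this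

/-- Central nilpotent elements lie in the Jacobson radical. -/
theorem mem_jacobson_of_pow_eq_zero {A : Type*} [Ring A] {x : A} (hx : ∀ y, Commute x y)
    (hn : IsNilpotent x) : x ∈ Ring.jacobson A := by
  rw [← Ideal.jacobson_bot, Ideal.mem_jacobson_iff]
  intro y
  have h : IsNilpotent (y * x) := (hx y).symm.isNilpotent_mul_left hn
  obtain ⟨u, hu⟩ := h.isUnit_one_add
  refine ⟨(↑u⁻¹ : A), ?_⟩
  have : (↑u⁻¹ : A) * (1 + y * x) = 1 := by rw [← hu]; simp
  rw [Ideal.mem_bot, mul_assoc, sub_eq_zero, ← this]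
  noncomm_ring

/-- If a central idempotent `ε` of `𝔽_p[K]` annihilates the Jacobson radical, then the sum of the
`p`-elements of `K` is invertible in `𝔽_p[K]ε`. -/
theorem exists_pElementSum_mul_eq (ε : MonoidAlgebra (ZMod p) K) (hc : ∀ x, Commute ε x)
    (hid : ε * ε = ε) (hR : ∀ x ∈ Ring.jacobson (MonoidAlgebra (ZMod p) K), ε * x = 0) :
    ∃ w, pElementSum p (ZMod p) K * w = ε := by
  classical
  set σ := pElementSum p (ZMod p) K
  have hσ : ∀ x, Commute σ x := pElementSum_commute p
  -- Multiplication by `σ` is injective on the center of `𝔽_p[K]ε`: if `σ d = 0`, then the trace form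
  -- `b ↦ (d ^ p ^ n * b)₁` vanishes on the radical and on all `p ^ n`-th powers, so it is zero.
  have claim : ∀ d : MonoidAlgebra (ZMod p) K, (∀ x, Commute d x) →
      ε * d = d → σ * d = 0 → d = 0 := by
    intro d hd hεd hσd
    set n := Nat.card K
    have hQ : p ^ n ≠ 0 := pow_ne_zero _ (Fact.out (p := p.Prime)).ne_zero
    have hεQ : d ^ p ^ n * ε = d ^ p ^ n := by
      obtain ⟨k, hk⟩ := Nat.exists_eq_succ_of_ne_zero hQ
      rw [hk, pow_succ, mul_assoc, ← (hc d).eq, hεd]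
    let f : MonoidAlgebra (ZMod p) K →+ ZMod p :=
      { toFun := fun b => (d ^ p ^ n * b).coeff 1
        map_zero' := by simp
        map_add' := fun x y => by rw [mul_add]; rfl }
    have hfR : ∀ r ∈ (Ring.jacobson (MonoidAlgebra (ZMod p) K)), f r = 0 := by
      intro r hr
      change (d ^ p ^ n * r).coeff 1 = 0
      rw [← hεQ, mul_assoc, hR r hr]
      simp
    let fb : MonoidAlgebra (ZMod p) K ⧸ Ring.jacobson (MonoidAlgebra (ZMod p) K) →+ ZMod p :=
      QuotientAddGroup.lift (Ring.jacobson (MonoidAlgebra (ZMod p) K)).toAddSubgroup f hfR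
    have hfb : ∀ x, fb (Ideal.Quotient.mk _ x) = f x := fun x => rfl
    have hfinq : Finite (MonoidAlgebra (ZMod p) K ⧸ Ring.jacobson (MonoidAlgebra (ZMod p) K)) :=
      Finite.of_surjective _ Ideal.Quotient.mk_surjective
    have hfbz : fb = 0 := by
      refine traceForm_eq_zero_of_pow p ?_ n fb ?_ ?_
      · have h0 : (p : MonoidAlgebra (ZMod p) K) = 0 := by
          rw [← map_natCast (algebraMap (ZMod p) (MonoidAlgebra (ZMod p) K)) p,
            CharP.cast_eq_zero, map_zero]
        rw [← map_natCast (Ideal.Quotient.mk (Ring.jacobson (MonoidAlgebra (ZMod p) K))) p,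
          h0, map_zero]
      · intro x y
        obtain ⟨x, rfl⟩ := Ideal.Quotient.mk_surjective x
        obtain ⟨y, rfl⟩ := Ideal.Quotient.mk_surjective y
        rw [← map_mul, ← map_mul, hfb, hfb]
        change (d ^ p ^ n * (x * y)).coeff 1 = (d ^ p ^ n * (y * x)).coeff 1
        rw [← mul_assoc, MonoidAlgebra.coeff_one_mul_comm, ← mul_assoc,
          ← ((hd y).pow_left _).eq, mul_assoc]
      · intro x
        obtain ⟨x, rfl⟩ := Ideal.Quotient.mk_surjective x
        rw [← map_pow, hfb]
        change (d ^ p ^ n * x ^ p ^ n).coeff 1 = 0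
        rw [← (hd x).mul_pow, MonoidAlgebra.coeff_one_pow]
        simp only [ZMod.pow_card_pow, pow_card_eq_one_iff p (le_refl (Nat.card K)), n]
        have h2 := coeff_one_mul_pElementSum p (d * x)
        rw [← (hσ _).eq, ← mul_assoc, hσd] at h2
        simpa using h2.symm
    have hdQ : d ^ p ^ n = 0 := by
      refine MonoidAlgebra.eq_zero_of_coeff_one_mul _ fun y => ?_
      change f y = 0
      rw [← hfb, hfbz]; rfl
    rw [← hεd]
    exact hR d (mem_jacobson_of_pow_eq_zero hd ⟨_, hdQ⟩)
  let Z := {z : MonoidAlgebra (ZMod p) K // (∀ x, Commute z x) ∧ ε * z = z}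
  let φ : Z → Z := fun z => ⟨σ * z.1, fun x => (hσ x).mul_left (z.2.1 x), by
    rw [← mul_assoc, (hc σ).eq, mul_assoc, z.2.2]⟩
  have hφ : Function.Injective φ := by
    intro z z' h
    have h1 : σ * z.1 = σ * z'.1 := congrArg Subtype.val h
    refine Subtype.ext (sub_eq_zero.1 (claim _ (fun x => (z.2.1 x).sub_left (z'.2.1 x)) ?_ ?_))
    · rw [mul_sub, z.2.2, z'.2.2]
    · rw [mul_sub, h1, sub_self]
  obtain ⟨w, hw⟩ := Finite.surjective_of_injective hφ ⟨ε, hc, hid⟩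
  exact ⟨w.1, congrArg Subtype.val hw⟩

end ModularGroupAlgebra

/-! ### Modules that are free over a Sylow subgroup -/

section Sylow

/-- A nonzero finite module of exponent `p` over a `p`-group has a nonzero fixed vector. -/
theorem AddSubgroup.eq_bot_of_isPGroup {p : ℕ} [Fact p.Prime] {P X : Type*} [Group P]
    (hP : IsPGroup p P) [AddCommGroup X] [Finite X] (hX : ∀ x : X, p • x = 0)
    (ρ : P →* AddMonoid.End X) (L : AddSubgroup X) (hL : ∀ g, ∀ x ∈ L, ρ g x ∈ L)
    (hfix : ∀ x ∈ L, (∀ g, ρ g x = x) → x = 0) : L = ⊥ := by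
  by_contra hne
  obtain ⟨x, hx, hx0⟩ := (AddSubgroup.ne_bot_iff_exists_ne_zero (H := L)).1 hne |>.elim
    fun x hx => (⟨x.1, x.2, fun h => hx (Subtype.ext h)⟩ : ∃ x, x ∈ L ∧ x ≠ 0)
  let _ : MulAction P L :=
    { smul := fun g x => ⟨ρ g x.1, hL g x.1 x.2⟩
      one_smul := fun x => Subtype.ext (by change ρ 1 x.1 = x.1; rw [map_one]; rfl)
      mul_smul := fun g h x => Subtype.ext (by
        change ρ (g * h) x.1 = ρ g (ρ h x.1); rw [map_mul]; rfl) }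
  have hdvd : p ∣ Nat.card L := by
    have h1 : addOrderOf (⟨x, hx⟩ : L) = p :=
      addOrderOf_eq_prime (Subtype.ext (hX x)) (fun h => hx0 (congrArg Subtype.val h))
    exact h1 ▸ _root_.addOrderOf_dvd_natCard _
  obtain ⟨b, hb, hb0⟩ := hP.exists_fixed_point_of_prime_dvd_card_of_fixed_point L hdvd
    (a := 0) (fun g => Subtype.ext (map_zero (ρ g)))
  exact hb0 (Subtype.ext (hfix b.1 b.2 fun g => congrArg Subtype.val (hb g)).symm)

variable {p : ℕ} [Fact p.Prime] {H : Type*} [Group H] [Fintype H]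

/-- Let `V` be a finite `𝔽_p[H]`-module and `P` a `p`-subgroup such that every `P`-fixed
vector is a norm from `P`. Then `V` is relatively projective: some additive `α` has
`∑_{h ∈ H} h α h⁻¹ = [H : P]`. -/
theorem exists_sum_conj_eq_index (P : Subgroup H) [Fintype P] (hP : IsPGroup p P)
    {V : Type*} [AddCommGroup V] [Module (ZMod p) V]
    [Finite V] (ρ : H →* Module.End (ZMod p) V)
    (hV : ∀ v : V, (∀ g : P, ρ g v = v) → ∃ u, ∑ g : P, ρ g u = v) :
    ∃ α : V →+ V, ∀ v, ∑ h, ρ h (α (ρ h⁻¹ v)) = P.index • v := by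
  classical
  have hpV : ∀ v : V, p • v = 0 := fun v => by
    rw [← Nat.cast_smul_eq_nsmul (ZMod p), CharP.cast_eq_zero, zero_smul]
  let I : Submodule (ZMod p) V :=
    { carrier := {v | ∀ g : P, ρ g v = v}
      add_mem' := fun {a b} ha hb g => by rw [map_add, ha, hb]
      zero_mem' := fun g => map_zero _
      smul_mem' := fun c x hx g => by rw [map_smul, hx] }
  obtain ⟨r, hr⟩ := LinearMap.exists_leftInverse_of_injective I.subtype (Submodule.ker_subtype I)
  have hr' : ∀ v : I, r v = v := fun v => LinearMap.congr_fun hr v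
  have hmul : ∀ g h v, ρ g (ρ h v) = ρ (g * h) v := fun g h v => by rw [map_mul]; rfl
  have hone : ∀ v, ρ 1 v = v := fun v => by rw [map_one]; rfl
  let N : V →ₗ[ZMod p] I := LinearMap.codRestrict I (∑ g : P, ρ g) (fun v k => by
    simp only [LinearMap.sum_apply, map_sum, hmul]
    exact Fintype.sum_equiv (Equiv.mulLeft k) _ _ (fun g => rfl))
  have hNv : ∀ v, (N v : V) = ∑ g : P, ρ g v := fun v => by simp [N]
  have hNs : Function.Surjective N := fun v => by
    obtain ⟨u, hu⟩ := hV v.1 v.2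
    exact ⟨u, Subtype.ext ((hNv u).trans hu)⟩
  obtain ⟨s, hs⟩ := LinearMap.exists_rightInverse_of_surjective N (LinearMap.range_eq_top.2 hNs)
  have hs' : ∀ v : I, ∑ g : P, ρ g (s v) = v := fun v => by
    rw [← hNv]; exact congrArg Subtype.val (LinearMap.congr_fun hs v)
  have : Finite I := Finite.of_injective _ Subtype.val_injective
  -- `Φ` and `Ψ` are equivariant maps between `V` and the coinduced module `P → I`, injective on
  -- `P`-fixed vectors, hence injective. By counting, `Φ` is an isomorphism, so `V` is free over `P`.
  let Φ : V →+ (P → I) :=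
    { toFun := fun v k => r (ρ k v)
      map_zero' := by ext; simp
      map_add' := fun a b => by ext; simp }
  let Ψ : (P → I) →+ V :=
    { toFun := fun f => ∑ g : P, ρ (g : H)⁻¹ (s (f g))
      map_zero' := by simp
      map_add' := fun a b => by simp [Finset.sum_add_distrib] }
  let ρV : P →* AddMonoid.End V :=
    { toFun := fun g => (ρ g).toAddMonoidHom
      map_one' := AddMonoidHom.ext fun v => hone v
      map_mul' := fun g h => AddMonoidHom.ext fun v => (hmul g h v).symm }
  let ρW : P →* AddMonoid.End (P → I) :=
    { toFun := fun g =>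
        { toFun := fun f k => f (k * g)
          map_zero' := rfl
          map_add' := fun _ _ => rfl }
      map_one' := AddMonoidHom.ext fun f => funext fun k => congrArg f (mul_one k)
      map_mul' := fun g h => AddMonoidHom.ext fun f => funext fun k =>
        congrArg f (mul_assoc k g h).symm }
  have hΦ : Function.Injective Φ := by
    rw [← AddMonoidHom.ker_eq_bot_iff]
    refine AddSubgroup.eq_bot_of_isPGroup hP hpV ρV _ ?_ ?_
    · intro g v hv
      rw [AddMonoidHom.mem_ker] at hv ⊢
      funext k
      change r (ρ k (ρ g v)) = 0
      rw [hmul]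
      exact congrFun hv (k * g)
    · intro v hv hfix
      have h1 : r (ρ (1 : P) v) = 0 := congrFun ((AddMonoidHom.mem_ker).1 hv) 1
      have h2 := hr' ⟨v, hfix⟩
      rw [show (((1 : P) : H)) = 1 from rfl, hone] at h1
      exact congrArg Subtype.val (h2.symm.trans h1)
  have hΨ : Function.Injective Ψ := by
    rw [← AddMonoidHom.ker_eq_bot_iff]
    refine AddSubgroup.eq_bot_of_isPGroup hP (fun f => ?_) ρW _ ?_ ?_
    · funext k
      exact Subtype.ext (hpV (f k))
    · intro g f hf
      rw [AddMonoidHom.mem_ker] at hf ⊢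
      have h : Ψ (ρW g f) = ρ g (Ψ f) := by
        change ∑ k : P, ρ (k : H)⁻¹ (s (f (k * g))) = ρ g (∑ k : P, ρ (k : H)⁻¹ (s (f k)))
        rw [map_sum]
        refine Fintype.sum_equiv (Equiv.mulRight g) _ _ (fun k => ?_)
        rw [hmul]
        simp
      rw [h, hf, map_zero]
    · intro f hf hfix
      have hconst : ∀ k, f k = f 1 := fun k => by
        have := congrFun (hfix k) 1
        rw [← this]
        change f k = f (1 * k)
        rw [one_mul]
      have h1 : ∑ k : P, ρ (k : H)⁻¹ (s (f k)) = 0 := hf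
      simp only [hconst] at h1
      have h2 : ∑ k : P, ρ (k : H)⁻¹ (s (f 1)) = ∑ k : P, ρ (k : H) (s (f 1)) :=
        Fintype.sum_equiv (Equiv.inv P) _ _ (fun k => rfl)
      rw [h2, hs'] at h1
      funext k
      rw [hconst]
      exact Subtype.ext h1
  have hΦb : Function.Bijective Φ :=
    hΦ.bijective_of_nat_card_le (Nat.card_le_card_of_injective Ψ hΨ)
  let e : V ≃+ (P → I) := AddEquiv.ofBijective Φ hΦb
  -- `α` is the projection to the component at `1 ∈ P`.
  let α : V →+ V :=
    { toFun := fun v => e.symm (Pi.single 1 (r v))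
      map_zero' := by simp
      map_add' := fun a b => by rw [map_add, Pi.single_add, map_add] }
  have hΦα : ∀ v, Φ (α v) = Pi.single 1 (r v) := fun v => e.apply_symm_apply _
  have hα : ∀ v, ∑ g : P, ρ g (α (ρ (g : H)⁻¹ v)) = v := by
    intro v
    apply hΦ
    funext k
    rw [map_sum, Finset.sum_apply]
    have h1 : ∀ g : P, Φ (ρ g (α (ρ (g : H)⁻¹ v))) k =
        (Pi.single 1 (r (ρ (g : H)⁻¹ v)) : P → I) (k * g) := fun g => by
      rw [← hΦα]
      change r (ρ k (ρ g _)) = r (ρ (k * g : P) _)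
      rw [hmul]; rfl
    simp only [h1]
    refine (Finset.sum_eq_single (k⁻¹ : P) (fun g _ hg => ?_) (by simp)).trans ?_
    · refine Pi.single_eq_of_ne (fun h => hg ?_) _
      exact eq_inv_of_mul_eq_one_right h
    · simp [Φ]
  refine ⟨α, fun v => ?_⟩
  have h2 : ∑ h, ρ h (α (ρ h⁻¹ v)) = ∑ x : (H ⧸ P) × P,
      ρ (x.1.out * x.2) (α (ρ (x.1.out * x.2)⁻¹ v)) := by
    refine Finset.sum_bij' (fun h _ => ((h : H ⧸ P), (⟨(h : H ⧸ P).out⁻¹ * h,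
      QuotientGroup.eq.1 (QuotientGroup.out_eq' _)⟩ : P))) (fun x _ => x.1.out * x.2)
      (by simp) (by simp) (by simp) (fun x _ => ?_) (by simp)
    have h0 : ((x.1.out * x.2 : H) : H ⧸ P) = x.1 := by
      rw [QuotientGroup.mk_mul_of_mem _ x.2.2, QuotientGroup.out_eq']
    refine Prod.ext h0 (Subtype.ext ?_)
    change ((x.1.out * x.2 : H) : H ⧸ P).out⁻¹ * (x.1.out * x.2) = x.2
    rw [h0, inv_mul_cancel_left]
  rw [h2, Fintype.sum_prod_type]
  have h3 : ∀ x : H ⧸ P, ∑ g : P, ρ (x.out * g) (α (ρ (x.out * g)⁻¹ v)) = v := by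
    intro x
    have h4 : ∀ g : P, ρ (x.out * g) (α (ρ (x.out * g)⁻¹ v)) =
        ρ x.out (ρ g (α (ρ (g : H)⁻¹ (ρ x.out⁻¹ v)))) := fun g => by
      rw [hmul, hmul, mul_inv_rev]
    simp only [h4]
    rw [← map_sum, hα, hmul]
    simp
  simp only [h3]
  rw [Finset.sum_const, Finset.card_univ, Subgroup.index, Nat.card_eq_fintype_card]

/-- If every `P`-fixed vector of `𝔽_p[H] / I` is a norm, for a `p`-subgroup `P` of index
prime to `p`, then `𝔽_p[H] / I` is projective; the splitting is right multiplication by an element `w`. -/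
theorem exists_splitting_of_norm (P : Subgroup H) [Fintype P] (hP : IsPGroup p P)
    (hPi : ¬ p ∣ P.index) (I : Ideal (MonoidAlgebra (ZMod p) H))
    (hI : ∀ x : MonoidAlgebra (ZMod p) H, (∀ g : P, MonoidAlgebra.single (g : H) 1 * x - x ∈ I) →
      ∃ y, (∑ g : P, MonoidAlgebra.single (g : H) 1) * y - x ∈ I) :
    ∃ w, (∀ x ∈ I, x * w = 0) ∧ ∃ c : (ZMod p)ˣ, w - algebraMap _ _ (c : ZMod p) ∈ I := by
  classical
  let V := MonoidAlgebra (ZMod p) H ⧸ I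
  let q : MonoidAlgebra (ZMod p) H →ₗ[ZMod p] V := I.mkQ.restrictScalars (ZMod p)
  have hq0 : ∀ x, q x = 0 ↔ x ∈ I := fun x => Submodule.Quotient.mk_eq_zero I
  have hqs : Function.Surjective q := Submodule.mkQ_surjective I
  have hqm : ∀ x y, q (x * y) = x • q y := fun x y => map_smul I.mkQ x y
  have : Finite V := Finite.of_surjective q hqs
  let ρ : H →* Module.End (ZMod p) V :=
    (Algebra.lsmul (ZMod p) (ZMod p) V : MonoidAlgebra (ZMod p) H →ₐ[ZMod p] _).toMonoidHom.comp
      (MonoidAlgebra.of (ZMod p) H)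
  have hρ : ∀ h v, ρ h v = (MonoidAlgebra.single h 1 : MonoidAlgebra (ZMod p) H) • v :=
    fun h v => rfl
  obtain ⟨α, hα⟩ := exists_sum_conj_eq_index P hP ρ (fun v hv => by
    obtain ⟨x, rfl⟩ := hqs v
    obtain ⟨y, hy⟩ := hI x (fun g => by
      rw [← hq0, map_sub, hqm, ← hρ, hv, sub_self])
    refine ⟨q y, ?_⟩
    rw [← hq0, map_sub, hqm, sub_eq_zero, Finset.sum_smul] at hy
    exact hy)
  obtain ⟨t, ht⟩ := LinearMap.exists_rightInverse_of_surjective q (LinearMap.range_eq_top.2 hqs)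
  have ht' : ∀ v, q (t v) = v := fun v => LinearMap.congr_fun ht v
  let s : V →+ MonoidAlgebra (ZMod p) H :=
    ∑ h : H, (AddMonoidHom.mulLeft (MonoidAlgebra.single h 1)).comp
      (t.toAddMonoidHom.comp (α.comp (ρ h⁻¹).toAddMonoidHom))
  have hs : ∀ v, s v = ∑ h : H, MonoidAlgebra.single h 1 * t (α (ρ h⁻¹ v)) := fun v => by
    simp [s]
  have hsk : ∀ k v, s (ρ k v) = MonoidAlgebra.single k 1 * s v := by
    intro k v
    rw [hs, hs, Finset.mul_sum]
    refine Fintype.sum_equiv (Equiv.mulLeft k⁻¹) _ _ fun h => ?_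
    rw [← mul_assoc, MonoidAlgebra.single_mul_single]
    have : ρ h⁻¹ (ρ k v) = ρ (k⁻¹ * h)⁻¹ v := by
      rw [mul_inv_rev, inv_inv, map_mul]; rfl
    rw [this]
    simp
  have hsx : ∀ x v, s (x • v) = x * s v := by
    intro x v
    induction x using MonoidAlgebra.induction_linear with
    | zero => simp
    | add a b ha hb => rw [add_smul, map_add, ha, hb, add_mul]
    | single m r =>
      have h1 : (MonoidAlgebra.single m r : MonoidAlgebra (ZMod p) H) =
          (ZMod.cast r : ℤ) • MonoidAlgebra.single m 1 := by
        rw [← Int.cast_smul_eq_zsmul (ZMod p), MonoidAlgebra.smul_single', mul_one,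
          ZMod.intCast_cast, ZMod.cast_id]
      rw [h1, smul_assoc, map_zsmul, ← hρ, hsk, smul_mul_assoc]
  refine ⟨s (q 1), fun x hx => ?_, ?_⟩
  · rw [← hsx, ← hqm, mul_one, (hq0 x).2 hx, map_zero]
  · have hidx : (P.index : ZMod p) ≠ 0 := by
      rw [Ne, ZMod.natCast_eq_zero_iff]
      exact hPi
    refine ⟨Units.mk0 _ hidx, ?_⟩
    rw [← hq0, map_sub, sub_eq_zero, hs, map_sum]
    simp only [hqm, ht', ← hρ, hα]
    rw [Units.val_mk0, map_natCast, ← nsmul_one, map_nsmul]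

end Sylow

/-! ### Lattices over group rings and the radical modulo `p` -/

section Cohomology

variable {R H : Type*} [CommRing R] [Group H] [Fintype H]

theorem MonoidAlgebra.coeff_one_mul_single {R H : Type*} [CommRing R] [Group H]
    (x : MonoidAlgebra R H) (g : H) : (x * single g 1).coeff 1 = x.coeff g⁻¹ := by
  simp [MonoidAlgebra.coeff_mul_single_apply]

/-- As a left `P`-set, `H` is free: it maps equivariantly to `P`. -/
theorem Subgroup.exists_equivariant_retraction {H : Type*} [Group H] (P : Subgroup H) :
    ∃ γ : H → P, ∀ (g : P) (k : H), γ (g * k) = g * γ k := by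
  refine ⟨fun k => ⟨k * ((k⁻¹ : H) : H ⧸ P).out, ?_⟩, fun g k => Subtype.ext ?_⟩
  · have h := QuotientGroup.eq.1 (QuotientGroup.out_eq' ((k⁻¹ : H) : H ⧸ P))
    have h2 := P.inv_mem h
    rwa [mul_inv_rev, inv_inv, inv_inv] at h2
  · have : (((g * k : H)⁻¹ : H) : H ⧸ P) = ((k⁻¹ : H) : H ⧸ P) := by
      rw [mul_inv_rev]
      exact QuotientGroup.mk_mul_of_mem _ (P.inv_mem g.2)
    change g * k * (((g * k : H)⁻¹ : H) : H ⧸ P).out = g * (k * _)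
    rw [this, mul_assoc]

/-- `H¹(P, R[H]) = 0`. -/
theorem MonoidAlgebra.exists_eq_single_mul_sub (P : Subgroup H) (a : P → MonoidAlgebra R H)
    (ha : ∀ g h : P, a (g * h) = a g + single (g : H) 1 * a h) :
    ∃ v, ∀ g : P, a g = single (g : H) 1 * v - v := by
  obtain ⟨γ, hγ⟩ := P.exists_equivariant_retraction
  refine ⟨ofCoeff (Finsupp.equivFunOnFinite.symm fun k => -(a (γ k)).coeff k), fun g => ?_⟩
  ext k
  have h1 : γ ((g : H)⁻¹ * k) = g⁻¹ * γ k := by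
    have := hγ g⁻¹ k
    simpa using this
  have h2 := congrArg (fun x : MonoidAlgebra R H => x.coeff k) (ha g (g⁻¹ * γ k))
  rw [mul_inv_cancel_left] at h2
  simp only [coeff_add, Finsupp.add_apply, coeff_single_mul_apply, one_mul] at h2
  simp [coeff_single_mul_apply, h1, h2]

/-- The elements of `R[H]` fixed by `P` are norms: `Ĥ⁰(P, R[H]) = 0`. -/
theorem MonoidAlgebra.exists_sum_single_mul_eq (P : Subgroup H) [Fintype P] (x : MonoidAlgebra R H)
    (hx : ∀ g : P, single (g : H) 1 * x = x) :
    ∃ y, (∑ g : P, single (g : H) 1) * y = x := by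
  classical
  obtain ⟨γ, hγ⟩ := P.exists_equivariant_retraction
  refine ⟨ofCoeff (Finsupp.equivFunOnFinite.symm fun k => if γ k = 1 then x.coeff k else 0), ?_⟩
  ext k
  rw [Finset.sum_mul, coeff_sum, Finsupp.finsetSum_apply]
  have h1 : ∀ g : P, γ ((g : H)⁻¹ * k) = g⁻¹ * γ k := fun g => by
    have := hγ g⁻¹ k
    simpa using this
  simp only [coeff_single_mul_apply, one_mul, Finsupp.equivFunOnFinite_symm_apply_apply, h1]
  rw [Finset.sum_eq_single (γ k)]
  · have h2 := congrArg (fun x : MonoidAlgebra R H => x.coeff k) (hx (γ k))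
    simp only [coeff_single_mul_apply, one_mul] at h2
    simp [h2]
  · intro g _ hg
    rw [if_neg]
    intro h
    exact hg (inv_mul_eq_one.1 h)
  · simp

end Cohomology

section Reduction

variable {p : ℕ} [Fact p.Prime] {H : Type*} [Group H]

variable (p H) in
/-- Reduction modulo `p` of the `p`-adic group ring. -/
abbrev redModP : MonoidAlgebra ℤ_[p] H →+* MonoidAlgebra (ZMod p) H :=
  MonoidAlgebra.mapRingHom H PadicInt.toZMod

theorem coeff_redModP (x : MonoidAlgebra ℤ_[p] H) (h : H) :
    (redModP p H x).coeff h = PadicInt.toZMod (x.coeff h) := by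
  simp [redModP]

theorem toZMod_eq_zero_iff (x : ℤ_[p]) : PadicInt.toZMod x = 0 ↔ (p : ℤ_[p]) ∣ x := by
  rw [← RingHom.mem_ker, PadicInt.ker_toZMod, PadicInt.maximalIdeal_eq_span_p,
    Ideal.mem_span_singleton]

theorem toZMod_surjective : Function.Surjective (PadicInt.toZMod : ℤ_[p] →+* ZMod p) :=
  ZMod.ringHom_surjective _

theorem MonoidAlgebra.natCast_mul_coeff {R K : Type*} [CommRing R] [Monoid K] (n : ℕ)
    (x : MonoidAlgebra R K) (k : K) : ((n : MonoidAlgebra R K) * x).coeff k = n * x.coeff k := by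
  rw [← nsmul_eq_mul, coeff_smul_apply, nsmul_eq_mul]

variable [Fintype H]

theorem dvd_iff_forall_coeff {n : ℕ} (x : MonoidAlgebra ℤ_[p] H) :
    (n : MonoidAlgebra ℤ_[p] H) ∣ x ↔ ∀ h, (n : ℤ_[p]) ∣ x.coeff h := by
  refine ⟨fun ⟨y, hy⟩ h => ⟨y.coeff h, by rw [hy, MonoidAlgebra.natCast_mul_coeff]⟩, fun h => ?_⟩
  choose c hc using h
  refine ⟨.ofCoeff (Finsupp.equivFunOnFinite.symm c), ?_⟩
  ext h
  rw [MonoidAlgebra.natCast_mul_coeff, hc h]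
  rfl

theorem redModP_eq_zero_iff (x : MonoidAlgebra ℤ_[p] H) :
    redModP p H x = 0 ↔ (p : MonoidAlgebra ℤ_[p] H) ∣ x := by
  rw [dvd_iff_forall_coeff]
  constructor
  · intro h k
    rw [← toZMod_eq_zero_iff, ← coeff_redModP, h]; rfl
  · intro h
    ext k
    rw [coeff_redModP, (toZMod_eq_zero_iff _).2 (h k)]; rfl

theorem redModP_surjective : Function.Surjective (redModP p H) := by
  intro y
  choose s hs using toZMod_surjective (p := p)
  refine ⟨.ofCoeff (Finsupp.equivFunOnFinite.symm fun h => s (y.coeff h)), ?_⟩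
  ext h
  rw [coeff_redModP]
  exact hs _

theorem dvd_of_forall_coeff_one_mul {n : ℕ} (x : MonoidAlgebra ℤ_[p] H)
    (h : ∀ y, (n : ℤ_[p]) ∣ (x * y).coeff 1) : (n : MonoidAlgebra ℤ_[p] H) ∣ x := by
  rw [dvd_iff_forall_coeff]
  intro k
  have := h (.single k⁻¹ 1)
  rwa [MonoidAlgebra.coeff_one_mul_single, inv_inv] at this

theorem natCast_mul_cancel {R K : Type*} [CommRing R] [IsDomain R] [CharZero R] [Group K] {n : ℕ}
    (hn : n ≠ 0) {x y : MonoidAlgebra R K}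
    (h : (n : MonoidAlgebra R K) * x = n * y) : x = y := by
  ext k
  have := congrArg (fun x : MonoidAlgebra R K => x.coeff k) h
  simp only [MonoidAlgebra.natCast_mul_coeff] at this
  exact mul_left_cancel₀ (Nat.cast_ne_zero.2 hn) this

end Reduction

section Duality

/-- A subspace of the group algebra of a finite group equals its double orthogonal with respect
to the trace form `(b, u) ↦ (b u)₁`. -/
theorem mem_of_forall_coeff_one {k H : Type*} [Field k] [Group H] [Fintype H]
    (W : Submodule k (MonoidAlgebra k H)) (x : MonoidAlgebra k H)
    (h : ∀ b : MonoidAlgebra k H, (∀ u ∈ W, (b * u).coeff 1 = 0) → (b * x).coeff 1 = 0) :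
    x ∈ W := by
  classical
  by_contra hx
  obtain ⟨f, hf, hW⟩ := Submodule.exists_le_ker_of_notMem hx
  let b : MonoidAlgebra k H := ∑ g : H, .single g⁻¹ (f (.single g 1))
  have hb : ∀ u, (b * u).coeff 1 = f u := by
    intro u
    induction u using MonoidAlgebra.induction_linear with
    | zero => simp
    | add a c ha hc => rw [mul_add, map_add, ← ha, ← hc]; rfl
    | single m r =>
      rw [Finset.sum_mul, MonoidAlgebra.coeff_sum, Finsupp.finsetSum_apply,
        Finset.sum_eq_single m]
      · have : (MonoidAlgebra.single m r : MonoidAlgebra k H) = r • .single m 1 := by simp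
        rw [this, map_smul]
        simp [mul_comm]
      · intro g _ hg
        rw [MonoidAlgebra.single_mul_single, MonoidAlgebra.coeff_single,
          Finsupp.single_eq_of_ne]
        intro h
        exact hg (inv_mul_eq_one.1 h.symm)
      · simp
  exact hf (by rw [← hb]; exact h b fun u hu => by rw [hb]; exact hW hu)

end Duality

/-! ### The right order of the radical lattice -/

section RadicalLattice

open MonoidAlgebra

variable {p : ℕ} [Fact p.Prime] {H : Type*} [Group H]

/-- For a central idempotent `ε` of `ℤ_p[H]`, the preimage in `ℤ_p[H]ε` of the Jacobson radical of
`𝔽_p[H]`. -/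
def radicalLattice (ε : MonoidAlgebra ℤ_[p] H) : AddSubgroup (MonoidAlgebra ℤ_[p] H) where
  carrier := {x | ε * x = x ∧ redModP p H x ∈ Ring.jacobson (MonoidAlgebra (ZMod p) H)}
  add_mem' := fun {a b} ha hb => ⟨by rw [mul_add, ha.1, hb.1], by
    rw [map_add]; exact add_mem ha.2 hb.2⟩
  zero_mem' := ⟨mul_zero _, by rw [map_zero]; exact zero_mem _⟩
  neg_mem' := fun {a} ha => ⟨by rw [mul_neg, ha.1], by rw [map_neg]; exact neg_mem ha.2⟩

theorem mul_mem_radicalLattice_left {ε : MonoidAlgebra ℤ_[p] H} (hc : ∀ x, Commute ε x)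
    (a : MonoidAlgebra ℤ_[p] H) {x} (hx : x ∈ radicalLattice ε) : a * x ∈ radicalLattice ε := by
  refine ⟨?_, ?_⟩
  · rw [← mul_assoc, (hc a).eq, mul_assoc, hx.1]
  · rw [map_mul]
    exact Ideal.mul_mem_left _ _ hx.2

theorem mul_mem_radicalLattice_right {ε : MonoidAlgebra ℤ_[p] H}
    (a : MonoidAlgebra ℤ_[p] H) {x} (hx : x ∈ radicalLattice ε) : x * a ∈ radicalLattice ε := by
  refine ⟨?_, ?_⟩
  · rw [← mul_assoc, hx.1]
  · rw [map_mul]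
    exact Ideal.mul_mem_right _ _ hx.2

/-- The elements `l` of `ℤ_p[H]ε` with `J l ⊆ p ℤ_p[H]`, where `J` is the radical lattice: this is
`p` times the dual lattice of `J`. -/
def dualRadical (ε : MonoidAlgebra ℤ_[p] H) : Set (MonoidAlgebra ℤ_[p] H) :=
  {l | ε * l = l ∧ ∀ j ∈ radicalLattice ε, (p : MonoidAlgebra ℤ_[p] H) ∣ j * l}

/-- The additive group generated by the products of the dual lattice and the radical lattice. -/
def dualProduct (ε : MonoidAlgebra ℤ_[p] H) : AddSubgroup (MonoidAlgebra ℤ_[p] H) :=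
  AddSubgroup.closure {y | ∃ l ∈ dualRadical ε, ∃ j ∈ radicalLattice ε, l * j = y}

theorem natCast_mul_mem_dualRadical {ε : MonoidAlgebra ℤ_[p] H}
    {x : MonoidAlgebra ℤ_[p] H} (hx : ε * x = x) :
    (p : MonoidAlgebra ℤ_[p] H) * x ∈ dualRadical ε :=
  ⟨by rw [← mul_assoc, ← Nat.cast_comm, mul_assoc, hx], fun j _ => ⟨j * x, by
    rw [← mul_assoc, ← Nat.cast_comm, mul_assoc]⟩⟩

theorem mul_mem_dualRadical {ε l : MonoidAlgebra ℤ_[p] H} (hl : l ∈ dualRadical ε)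
    (a : MonoidAlgebra ℤ_[p] H) : l * a ∈ dualRadical ε :=
  ⟨by rw [← mul_assoc, hl.1], fun j hj => by rw [← mul_assoc]; exact (hl.2 j hj).mul_right a⟩

variable [Fintype H]

theorem redModP_mem_of_dvd {x : MonoidAlgebra ℤ_[p] H} (h : (p : MonoidAlgebra ℤ_[p] H) ∣ x)
    (I : Ideal (MonoidAlgebra (ZMod p) H)) : redModP p H x ∈ I := by
  rw [(redModP_eq_zero_iff x).2 h]
  exact zero_mem _

theorem mul_natCast_mem_radicalLattice {ε : MonoidAlgebra ℤ_[p] H} {x} (hx : ε * x = x) :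
    p * x ∈ radicalLattice ε :=
  ⟨by rw [← mul_assoc, ← Nat.cast_comm, mul_assoc, hx], redModP_mem_of_dvd (dvd_mul_right _ _) _⟩

theorem dvd_dualRadical_mul {ε l j : MonoidAlgebra ℤ_[p] H} (hl : l ∈ dualRadical ε)
    (hj : j ∈ radicalLattice ε) : (p : MonoidAlgebra ℤ_[p] H) ∣ l * j := by
  refine dvd_of_forall_coeff_one_mul _ fun c => ?_
  rw [mul_assoc, MonoidAlgebra.coeff_one_mul_comm]
  exact (dvd_iff_forall_coeff _).1 (hl.2 _ (mul_mem_radicalLattice_right c hj)) 1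

/-- Double annihilator property: `{y | y L ⊆ p ℤ_p[H]}` is the radical lattice, for `L` the lattice
`dualRadical ε`. -/
theorem mem_radicalLattice_of_dualRadical {ε : MonoidAlgebra ℤ_[p] H} (hc : ∀ x, Commute ε x)
    (hid : ε * ε = ε) {y : MonoidAlgebra ℤ_[p] H} (hy : ε * y = y)
    (h : ∀ l ∈ dualRadical ε, (p : MonoidAlgebra ℤ_[p] H) ∣ y * l) : y ∈ radicalLattice ε := by
  refine ⟨hy, ?_⟩
  refine mem_of_forall_coeff_one
    ((Ring.jacobson (MonoidAlgebra (ZMod p) H)).restrictScalars (ZMod p)) _ fun b hb => ?_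
  have hann : ∀ r ∈ Ring.jacobson (MonoidAlgebra (ZMod p) H), r * b = 0 := by
    intro r hr
    refine eq_zero_of_coeff_one_mul _ fun c => ?_
    rw [mul_assoc, coeff_one_mul_comm, mul_assoc]
    exact hb _ (Ideal.mul_mem_left _ _ hr)
  obtain ⟨l, rfl⟩ := redModP_surjective b
  have hl : ε * l ∈ dualRadical ε := by
    refine ⟨by rw [← mul_assoc, hid], fun j hj => ?_⟩
    rw [← redModP_eq_zero_iff, ← mul_assoc, ← (hc j).eq, hj.1, map_mul]
    exact hann _ hj.2
  have h1 := (redModP_eq_zero_iff _).2 (h _ hl)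
  rw [← mul_assoc, ← (hc y).eq, hy, map_mul] at h1
  rw [coeff_one_mul_comm, h1]; rfl

/-- If the right order of the radical lattice `J` is `ℤ_p[H]ε`, then `J` is invertible:
`pε` is a sum of products of the dual lattice with `J`. -/
theorem natCast_mul_mem_dualProduct {ε : MonoidAlgebra ℤ_[p] H} (hc : ∀ x, Commute ε x)
    (hid : ε * ε = ε)
    (hord : ∀ b : MonoidAlgebra ℤ_[p] H, ε * b = b →
      (∀ x ∈ radicalLattice ε, ∃ y ∈ radicalLattice ε, x * b = p * y) →
      (p : MonoidAlgebra ℤ_[p] H) ∣ b) :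
    (p : MonoidAlgebra ℤ_[p] H) * ε ∈ dualProduct ε := by
  have hp0 : p ≠ 0 := (Fact.out (p := p.Prime)).ne_zero
  have hπc : ∀ x, Commute (redModP p H ε) x := fun x => by
    obtain ⟨x, rfl⟩ := redModP_surjective x
    exact (hc x).map _
  -- Modulo `p`, the ideal `p⁻¹ L J` together with `𝔽_p[H](1 - ε)` is everything: an element `b` of its
  -- orthogonal would give `J p⁻¹b ⊆ J`, so `p` would divide `b`.
  let W : Submodule (ZMod p) (MonoidAlgebra (ZMod p) H) := Submodule.span _
    {u | (∃ l ∈ dualRadical ε, ∃ j ∈ radicalLattice ε, ∃ a : MonoidAlgebra ℤ_[p] H,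
      l * j = p * a ∧ redModP p H a = u) ∨ redModP p H ε * u = 0}
  have hW : (1 : MonoidAlgebra (ZMod p) H) ∈ W := by
    refine mem_of_forall_coeff_one W _ fun b hb => ?_
    have hbε : b = b * redModP p H ε := by
      rw [← sub_eq_zero]
      refine eq_zero_of_coeff_one_mul _ fun c => ?_
      have h1 : b - b * redModP p H ε = b * (1 - redModP p H ε) := by rw [mul_sub, mul_one]
      rw [h1, mul_assoc]
      refine hb _ (Submodule.subset_span (Or.inr ?_))
      rw [← mul_assoc, mul_sub, ← map_mul, hid, mul_one, sub_self, zero_mul]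
    obtain ⟨b, rfl⟩ := redModP_surjective b
    have hb' : ∀ a l j, l ∈ dualRadical ε → j ∈ radicalLattice ε → l * j = p * a →
        (p : ℤ_[p]) ∣ (ε * b * a).coeff 1 := by
      intro a l j hl hj h
      rw [← toZMod_eq_zero_iff, ← coeff_redModP, map_mul, map_mul, (hπc _).eq, ← hbε]
      exact hb _ (Submodule.subset_span (Or.inl ⟨l, hl, j, hj, a, h, rfl⟩))
    have hdvd : (p : MonoidAlgebra ℤ_[p] H) ∣ ε * b := by
      refine hord _ (by rw [← mul_assoc, hid]) fun x hx => ?_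
      have key : ∀ l ∈ dualRadical ε, ((p * p : ℕ) : MonoidAlgebra ℤ_[p] H) ∣ x * (ε * b) * l := by
        intro l hl
        refine dvd_of_forall_coeff_one_mul _ fun c => ?_
        obtain ⟨a, ha⟩ := dvd_dualRadical_mul (mul_mem_dualRadical hl c) hx
        have h2 := hb' a _ _ (mul_mem_dualRadical hl c) hx ha
        have h3 : (x * (ε * b) * l * c).coeff 1 = p * (ε * b * a).coeff 1 := by
          rw [← natCast_mul_coeff, (Nat.cast_commute p (ε * b)).left_comm a, ← ha,
            mul_assoc x, mul_assoc x, coeff_one_mul_comm, mul_assoc (ε * b), mul_assoc (ε * b)]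
        rw [h3, Nat.cast_mul]
        exact mul_dvd_mul_left _ h2
      have hpε := natCast_mul_mem_dualRadical hid
      obtain ⟨y, hy⟩ := key _ hpε
      have h4 : x * (ε * b) = p * y := by
        have h5 : x * (ε * b) * (p * ε) = p * (x * (ε * b)) := by
          rw [← mul_assoc, ← Nat.cast_comm, mul_assoc]
          congr 1
          rw [mul_assoc, ← (hc (ε * b)).eq, ← mul_assoc ε, hid]
        rw [h5, Nat.cast_mul, mul_assoc] at hy
        exact natCast_mul_cancel hp0 hy
      have hεy : ε * y = y := by
        refine natCast_mul_cancel hp0 ?_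
        rw [← mul_assoc, Nat.cast_comm, mul_assoc, ← h4, ← mul_assoc, hx.1]
      refine ⟨y, mem_radicalLattice_of_dualRadical hc hid hεy fun l hl => ?_, h4⟩
      obtain ⟨z, hz⟩ := key l hl
      refine ⟨z, natCast_mul_cancel hp0 ?_⟩
      rw [← mul_assoc, ← h4, hz, Nat.cast_mul, mul_assoc]
    rw [hbε, ← (hπc _).eq, ← map_mul, (redModP_eq_zero_iff _).2 hdvd]
    simp
  have hεL : ∀ y ∈ dualProduct ε, ε * y = y := by
    intro y hy
    induction hy using AddSubgroup.closure_induction with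
    | mem y hy => obtain ⟨l, hl, j, -, rfl⟩ := hy; rw [← mul_assoc, hl.1]
    | zero => exact mul_zero _
    | add a b _ _ ha hb => rw [mul_add, ha, hb]
    | neg a _ ha => rw [mul_neg, ha]
  have hspan : ∀ u ∈ W, ∃ a, redModP p H a = redModP p H ε * u ∧ p * a ∈ dualProduct ε := by
    intro u hu
    induction hu using Submodule.span_induction with
    | mem u hu =>
      rcases hu with ⟨l, hl, j, hj, a, ha, rfl⟩ | hu
      · refine ⟨ε * a, map_mul _ _ _, AddSubgroup.subset_closure ⟨l, hl, j, hj, ?_⟩⟩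
        rw [← mul_assoc, Nat.cast_comm, mul_assoc, ← ha, ← mul_assoc, hl.1]
      · exact ⟨0, by rw [hu, map_zero], by rw [mul_zero]; exact zero_mem _⟩
    | zero => exact ⟨0, by simp, by rw [mul_zero]; exact zero_mem _⟩
    | add x y _ _ hx hy =>
      obtain ⟨a, ha, ha'⟩ := hx
      obtain ⟨b, hb, hb'⟩ := hy
      exact ⟨a + b, by rw [map_add, ha, hb, mul_add], by rw [mul_add]; exact add_mem ha' hb'⟩
    | smul c x _ hx =>
      obtain ⟨a, ha, ha'⟩ := hx
      refine ⟨c.val • a, ?_, by rw [mul_smul_comm]; exact nsmul_mem ha' _⟩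
      rw [map_nsmul, ha, ← Nat.cast_smul_eq_nsmul (ZMod p), ZMod.natCast_zmod_val, mul_smul_comm]
  obtain ⟨a, ha, ha'⟩ := hspan 1 hW
  rw [mul_one, ← sub_eq_zero, ← map_sub, redModP_eq_zero_iff] at ha
  obtain ⟨c, hcc⟩ := ha
  -- The congruence modulo `p` lifts, because `pε` lies in both `L` and `J`.
  have h1 : (p : MonoidAlgebra ℤ_[p] H) * ε = p * a - p * ε * (p * (ε * c)) := by
    have h2 : (p : MonoidAlgebra ℤ_[p] H) * ε = ε * (p * a) - ε * (p * (a - ε)) := by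
      rw [mul_sub, mul_sub, sub_sub_cancel, ← (Nat.cast_commute p ε).left_comm, hid]
    have h3 : ε * (p * (p * c)) = p * ε * (p * (ε * c)) := by
      rw [← (Nat.cast_commute p ε).left_comm, ← (Nat.cast_commute p ε).left_comm, mul_assoc,
        ← (Nat.cast_commute p ε).left_comm, ← mul_assoc ε, hid]
    conv_lhs => rw [h2, hεL _ ha', hcc, h3]
  rw [h1]
  refine sub_mem ha' (AddSubgroup.subset_closure ⟨_, natCast_mul_mem_dualRadical hid, _,
    mul_natCast_mem_radicalLattice ?_, rfl⟩)
  rw [← mul_assoc, hid]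

/-- If the right order of the radical lattice is `ℤ_p[H]ε`, then the radical lattice is projective
and `𝔽_p[H]ε` is semisimple. -/
theorem redModP_mul_eq_zero_of_order {ε : MonoidAlgebra ℤ_[p] H} (hc : ∀ x, Commute ε x)
    (hid : ε * ε = ε)
    (hord : ∀ b : MonoidAlgebra ℤ_[p] H, ε * b = b →
      (∀ x ∈ radicalLattice ε, ∃ y ∈ radicalLattice ε, x * b = p * y) →
      (p : MonoidAlgebra ℤ_[p] H) ∣ b) :
    ∀ x ∈ Ring.jacobson (MonoidAlgebra (ZMod p) H), redModP p H ε * x = 0 := by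
  classical
  have hp0 : p ≠ 0 := (Fact.out (p := p.Prime)).ne_zero
  have hπc : ∀ x, Commute (redModP p H ε) x := fun x => by
    obtain ⟨x, rfl⟩ := redModP_surjective x
    exact (hc x).map _
  have hπid : redModP p H ε * redModP p H ε = redModP p H ε := by rw [← map_mul, hid]
  obtain ⟨P⟩ : Nonempty (Sylow p H) := inferInstance
  -- A cocycle with values in `J` is a coboundary of `J`, because `J` is projective.
  have hcob : ∀ c : P → MonoidAlgebra ℤ_[p] H, (∀ g, c g ∈ radicalLattice ε) →
      (∀ g h : P, c (g * h) = c g + single (g : H) 1 * c h) →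
      ∃ j ∈ radicalLattice ε, ∀ g : P, c g = single (g : H) 1 * j - j := by
    intro c hcJ hcc
    have key : ∀ y ∈ dualProduct ε, ∃ j ∈ radicalLattice ε,
        ∀ g : P, c g * y = (p : MonoidAlgebra ℤ_[p] H) * (single (g : H) 1 * j - j) := by
      intro y hy
      induction hy using AddSubgroup.closure_induction with
      | mem y hy =>
        obtain ⟨l, hl, j, hj, rfl⟩ := hy
        choose a ha using fun g => hl.2 (c g) (hcJ g)
        obtain ⟨v, hv⟩ := exists_eq_single_mul_sub (P : Subgroup H) a (fun g h => by
          refine natCast_mul_cancel hp0 ?_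
          rw [← ha, hcc, add_mul, mul_add, ← ha, mul_assoc, ha h, ← mul_assoc, ← Nat.cast_comm,
            mul_assoc])
        refine ⟨v * j, mul_mem_radicalLattice_left hc v hj, fun g => ?_⟩
        rw [← mul_assoc, ha, hv, mul_assoc, sub_mul, mul_assoc]
      | zero => exact ⟨0, zero_mem _, by simp⟩
      | add y z _ _ hy hz =>
        obtain ⟨j, hj, h⟩ := hy
        obtain ⟨k, hk, h'⟩ := hz
        refine ⟨j + k, add_mem hj hk, fun g => ?_⟩
        rw [mul_add, h, h', ← mul_add]
        congr 1
        rw [mul_add]; abel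
      | neg y _ hy =>
        obtain ⟨j, hj, h⟩ := hy
        refine ⟨-j, neg_mem hj, fun g => ?_⟩
        rw [mul_neg, h, ← mul_neg]
        congr 1
        rw [mul_neg]; abel
    obtain ⟨j, hj, h⟩ := key _ (natCast_mul_mem_dualProduct hc hid hord)
    refine ⟨j, hj, fun g => natCast_mul_cancel hp0 ?_⟩
    rw [← h, ← mul_assoc, ← Nat.cast_comm, mul_assoc, ← (hc _).eq, (hcJ g).1]
  -- `I` is the kernel of the map from `𝔽_p[H]` to the semisimple quotient of `𝔽_p[H]ε`.
  let I : Ideal (MonoidAlgebra (ZMod p) H) :=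
    { carrier := {x | redModP p H ε * x ∈ Ring.jacobson (MonoidAlgebra (ZMod p) H)}
      add_mem' := fun {a b} ha hb => by
        change redModP p H ε * (a + b) ∈ Ring.jacobson (MonoidAlgebra (ZMod p) H)
        rw [mul_add]; exact add_mem ha hb
      zero_mem' := by
        change redModP p H ε * 0 ∈ Ring.jacobson (MonoidAlgebra (ZMod p) H)
        rw [mul_zero]; exact zero_mem _
      smul_mem' := fun c x hx => by
        change redModP p H ε * (c * x) ∈ Ring.jacobson (MonoidAlgebra (ZMod p) H)
        rw [← mul_assoc, (hπc c).eq, mul_assoc]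
        exact Ideal.mul_mem_left _ _ hx }
  have hI : ∀ x, x ∈ I ↔ redModP p H ε * x ∈ Ring.jacobson (MonoidAlgebra (ZMod p) H) :=
    fun x => Iff.rfl
  have hsingle : ∀ g : H, redModP p H (single g 1) = single g 1 := fun g => by
    ext k
    rw [coeff_redModP, coeff_single, coeff_single]
    by_cases h : k = g
    · subst h; simp
    · rw [Finsupp.single_eq_of_ne h, Finsupp.single_eq_of_ne h, map_zero]
  -- A vector of `𝔽_p[H] / I` fixed by `P` lifts to a fixed vector by the vanishing of the cohomology
  -- of `J`, and a fixed vector of `ℤ_p[H]` is a norm.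
  obtain ⟨w, hw, u, hu⟩ := exists_splitting_of_norm (P : Subgroup H) P.isPGroup' P.not_dvd_index I
    (fun x hx => by
      obtain ⟨x, rfl⟩ := redModP_surjective x
      let c : P → MonoidAlgebra ℤ_[p] H := fun g => single (g : H) 1 * (ε * x) - ε * x
      have hcg : ∀ g, c g = ε * (single (g : H) 1 * x - x) := fun g => by
        rw [mul_sub, ← mul_assoc ε, (hc _).eq, mul_assoc]
      obtain ⟨j, hj, hj'⟩ := hcob c (fun g => by
          rw [hcg]
          refine ⟨by rw [← mul_assoc, hid], ?_⟩
          have := hx g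
          rwa [hI, ← hsingle, ← map_mul, ← map_sub, ← map_mul] at this)
        (fun g h => by
          simp only [c, mul_sub]
          rw [← mul_assoc (single (g : H) 1) (single (h : H) 1), single_mul_single, mul_one]
          change single ((g : H) * h) 1 * (ε * x) - ε * x = _
          abel)
      obtain ⟨y, hy⟩ := exists_sum_single_mul_eq (P : Subgroup H) (ε * x - j) (fun g => by
        have := hj' g
        simp only [c] at this
        rw [mul_sub, ← sub_eq_zero]
        rw [← sub_eq_zero] at this
        rw [← this]; abel)
      refine ⟨redModP p H y, ?_⟩
      have h2 : (∑ g : P, single (g : H) (1 : ZMod p)) =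
          redModP p H (∑ g : P, single (g : H) 1) := by
        rw [map_sum]
        exact Finset.sum_congr rfl fun g _ => (hsingle g).symm
      rw [h2, ← map_mul, hy, hI, ← map_sub, ← map_mul]
      have h3 : ε * (ε * x - j - x) = -j := by
        rw [mul_sub, mul_sub, ← mul_assoc, hid, hj.1]; abel
      rw [h3]
      exact (neg_mem hj).2)
  -- The splitting annihilates the radical, but modulo the radical it is a unit on `𝔽_p[H]ε`.
  intro r hr
  set x := redModP p H ε * r with hx
  have hxI : x ∈ I := by
    rw [hI, hx, ← mul_assoc, hπid]
    exact Ideal.mul_mem_left _ _ hr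
  have h1 := hw x hxI
  set y := w - algebraMap _ _ (u : ZMod p) with hy
  have hwy : w = algebraMap _ _ (u : ZMod p) + y := by rw [hy]; abel
  obtain ⟨n, hn⟩ := IsArtinianRing.isNilpotent_jacobson_bot (R := MonoidAlgebra (ZMod p) H)
  have hnil : IsNilpotent (redModP p H ε * y) := by
    refine ⟨n, ?_⟩
    have := Ideal.pow_mem_pow ((hI y).1 hu) n
    rw [← Ideal.jacobson_bot, hn] at this
    simpa using this
  have hunit : IsUnit (algebraMap (ZMod p) (MonoidAlgebra (ZMod p) H) u + redModP p H ε * y) := by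
    have h := hnil.isUnit_add_left_of_commute
      (u := algebraMap (ZMod p) (MonoidAlgebra (ZMod p) H) u)
      (u.isUnit.map _) (Algebra.commutes _ _).symm
    exact h
  have hxε : x * redModP p H ε = x := by rw [hx, (hπc r).eq, mul_assoc, hπid]
  have h2 : x * (algebraMap (ZMod p) (MonoidAlgebra (ZMod p) H) u + redModP p H ε * y) = 0 := by
    rw [mul_add, ← mul_assoc, hxε, ← mul_add, ← hwy, h1]
  exact hunit.mul_left_eq_zero.1 h2

end RadicalLattice

/-! ### Criteria for maximality of orders -/

section MaximalOrders

variable {R L A : Type*} [CommRing R] [Ring L] [Algebra R L] [Ring A] [Algebra R A]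

theorem mem_cornerOf_range {φ : L →ₐ[R] A} {ε : L} (hid : ε * ε = ε) {x : A} :
    x ∈ cornerOf R φ.range (φ ε) ↔ ∃ a, a * ε = a ∧ φ a = x := by
  constructor
  · rintro ⟨_, ⟨a, rfl⟩, rfl⟩
    exact ⟨a * ε, by rw [mul_assoc, hid], map_mul _ _ _⟩
  · rintro ⟨a, ha, rfl⟩
    refine ⟨φ a, ⟨a, rfl⟩, ?_⟩
    change φ a * φ ε = φ a
    rw [← map_mul, ha]

theorem IsOrderIn.exists_smul_mem {f : A} {O O' : Submodule R A} (h : IsOrderIn R f O)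
    (h' : IsOrderIn R f O') : ∃ r ∈ nonZeroDivisors R, ∀ x ∈ O', r • x ∈ O := by
  have key : ∀ N : Submodule R A, N.FG → N ≤ O' → ∃ r ∈ nonZeroDivisors R, ∀ x ∈ N, r • x ∈ O := by
    intro N hN
    induction N, hN using Submodule.fg_induction with
    | singleton x =>
      intro hx
      have hx := hx (Submodule.mem_span_singleton_self x)
      obtain ⟨r, hr, hrx⟩ := h.full x
      rw [(h'.le_corner x hx).1, (h'.le_corner x hx).2] at hrx
      refine ⟨r, hr, fun y hy => ?_⟩
      obtain ⟨c, rfl⟩ := Submodule.mem_span_singleton.1 hy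
      rw [smul_comm]
      exact O.smul_mem _ hrx
    | sup N₁ N₂ _ _ h₁ h₂ =>
      intro hN
      obtain ⟨r₁, hr₁, h₁⟩ := h₁ (le_sup_left.trans hN)
      obtain ⟨r₂, hr₂, h₂⟩ := h₂ (le_sup_right.trans hN)
      refine ⟨r₁ * r₂, Submonoid.mul_mem _ hr₁ hr₂, fun x hx => ?_⟩
      obtain ⟨y, hy, z, hz, rfl⟩ := Submodule.mem_sup.1 hx
      rw [smul_add]
      refine add_mem ?_ ?_
      · rw [mul_comm, mul_smul]; exact O.smul_mem _ (h₁ y hy)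
      · rw [mul_smul]; exact O.smul_mem _ (h₂ z hz)
  exact key O' h'.fg le_rfl

/-- An order `O` is maximal if every larger order is contained in `p⁻ᵏ O` for some `k`, and every
right ideal of `O` that is nil modulo `p` is contained in `p O`. -/
theorem isMaximalOrderIn_of_nil (φ : L →ₐ[R] A) (hφ : Function.Injective φ) {ε : L}
    (hc : ∀ x, Commute ε x) (hid : ε * ε = ε) (p : ℕ) (hp : ∀ x : A, p * x = 0 → x = 0)
    (hO : IsOrderIn R (φ ε) (cornerOf R φ.range (φ ε)))
    (hpow : ∀ O', IsOrderIn R (φ ε) O' → cornerOf R φ.range (φ ε) ≤ O' →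
      ∃ k : ℕ, ∀ x ∈ O', (p : A) ^ k * x ∈ cornerOf R φ.range (φ ε))
    (hnil : ∀ J : Set L, (∀ x ∈ J, x * ε = x) → (∀ x ∈ J, ∀ y, x * y ∈ J) →
      (∃ m, ∀ x ∈ J, (p : L) ∣ x ^ m) → ∀ x ∈ J, (p : L) ∣ x) :
    IsMaximalOrderIn R (φ ε) (cornerOf R φ.range (φ ε)) := by
  refine ⟨hO, fun O' hO' hle => ?_⟩
  obtain ⟨k, hk⟩ := hpow O' hO' hle
  -- `J` is the right ideal `L ∩ pO'`; its elements have divisible powers because `pᵏ O' ⊆ O`.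
  let J : Set L := {a | a * ε = a ∧ ∃ x ∈ O', φ a = p * x}
  have hJ : ∀ a ∈ J, (p : L) ∣ a := by
    refine hnil J (fun x hx => hx.1) ?_ ⟨k + 1, ?_⟩
    · rintro a ⟨ha, x, hx, hax⟩ y
      refine ⟨by rw [mul_assoc, ← (hc y).eq, ← mul_assoc, ha], x * φ (ε * y), ?_, ?_⟩
      · refine hO'.mul_mem _ hx _ (hle ?_)
        exact (mem_cornerOf_range hid).2 ⟨ε * y, by rw [(hc y).eq, mul_assoc, hid], rfl⟩
      · conv_lhs => rw [← ha]
        rw [mul_assoc, map_mul, hax, mul_assoc]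
    · rintro a ⟨ha, x, hx, hax⟩
      have hxn : ∀ n : ℕ, x ^ (n + 1) ∈ O' := by
        intro n
        induction n with
        | zero => simpa using hx
        | succ n ih => rw [pow_succ]; exact hO'.mul_mem _ ih _ hx
      obtain ⟨b, hb, hb'⟩ := (mem_cornerOf_range hid).1 (hk _ (hxn k))
      refine ⟨b, hφ ?_⟩
      rw [map_pow, hax, map_mul, map_natCast, hb', (Nat.cast_commute p x).mul_pow, pow_succ',
        mul_assoc]
  have key : ∀ n : ℕ, ∀ x ∈ O', (p : A) ^ n * x ∈ cornerOf R φ.range (φ ε) →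
      x ∈ cornerOf R φ.range (φ ε) := by
    intro n
    induction n with
    | zero => intro x _ h; simpa using h
    | succ n ih =>
      intro x hx h
      refine ih x hx ?_
      obtain ⟨a, ha, hax⟩ := (mem_cornerOf_range hid).1 h
      have hpn : (p : A) ^ n * x ∈ O' := by
        rw [← Nat.cast_pow, ← nsmul_eq_mul]
        exact nsmul_mem hx _
      have h1 : φ a = p * (p ^ n * x) := by rw [hax, pow_succ', mul_assoc]
      obtain ⟨b, rfl⟩ := hJ a ⟨ha, _, hpn, h1⟩
      have h2 : φ b = p ^ n * x := by
        rw [← sub_eq_zero]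
        refine hp _ ?_
        rw [mul_sub, ← h1, map_mul, map_natCast, sub_self]
      refine (mem_cornerOf_range hid).2 ⟨b, hφ ?_, h2⟩
      rw [← sub_eq_zero, ← map_sub]
      refine hp _ ?_
      rw [← map_natCast φ, ← map_mul, mul_sub, ← mul_assoc, ha, sub_self, map_zero]
  exact fun x hx => key k x hx (hk x hx)

/-- If `φ(L)ε` is a maximal order and `p⁻¹ M` is a finitely generated ring containing it, then
`M` is contained in `p L`. -/
theorem dvd_of_isMaximalOrderIn (φ : L →ₐ[R] A) (hφ : Function.Injective φ) {ε : L}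
    (hc : ∀ x, Commute ε x) (hid : ε * ε = ε) (p : ℕ) (hp : IsUnit (p : A))
    (hO : IsMaximalOrderIn R (φ ε) (cornerOf R φ.range (φ ε)))
    (M : Submodule R L) (hfg : M.FG) (hM : ∀ x ∈ M, x * ε = x) (hpM : ∀ x, x * ε = x → p * x ∈ M)
    (hmul : ∀ x ∈ M, ∀ y ∈ M, ∃ z ∈ M, x * y = p * z) : ∀ x ∈ M, (p : L) ∣ x := by
  obtain ⟨u, hu⟩ := hp
  have huc : ∀ x : A, (↑u⁻¹ : A) * x = x * ↑u⁻¹ := fun x => by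
    have h : Commute (u : A) x := by rw [hu]; exact Nat.cast_commute p x
    exact h.units_inv_left.eq
  let N : Submodule R A := M.map (((LinearMap.mulLeft R (↑u⁻¹ : A))) ∘ₗ φ.toLinearMap)
  have hN : ∀ x, x ∈ N ↔ ∃ m ∈ M, (↑u⁻¹ : A) * φ m = x := fun x => Iff.rfl
  have hle : cornerOf R φ.range (φ ε) ≤ N := by
    intro x hx
    obtain ⟨a, ha, rfl⟩ := (mem_cornerOf_range hid).1 hx
    refine (hN _).2 ⟨p * a, hpM a ha, ?_⟩
    rw [map_mul, map_natCast, ← hu, ← mul_assoc, Units.inv_mul, one_mul]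
  have hNO : IsOrderIn R (φ ε) N := by
    refine ⟨?_, hle hO.1.one_mem, ?_, hfg.map _, ?_⟩
    · rintro x hx
      obtain ⟨m, hm, rfl⟩ := (hN _).1 hx
      have h1 : (↑u⁻¹ : A) * φ m * φ ε = ↑u⁻¹ * φ m := by rw [mul_assoc, ← map_mul, hM m hm]
      refine ⟨?_, h1⟩
      conv_rhs => rw [← h1]
      rw [← mul_assoc, ← huc, mul_assoc, ← map_mul, (hc m).eq, map_mul, mul_assoc]
    · intro x hx y hy
      obtain ⟨m, hm, rfl⟩ := (hN _).1 hx
      obtain ⟨n, hn, rfl⟩ := (hN _).1 hy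
      obtain ⟨z, hz, hmn⟩ := hmul m hm n hn
      refine (hN _).2 ⟨z, hz, ?_⟩
      rw [mul_assoc, ← mul_assoc (φ m), ← huc, mul_assoc, ← map_mul, hmn, map_mul, map_natCast,
        ← hu, Units.inv_mul_cancel_left]
    · intro a
      obtain ⟨r, hr, h⟩ := hO.1.full a
      exact ⟨r, hr, hle h⟩
  intro x hx
  obtain ⟨a, -, ha⟩ := (mem_cornerOf_range hid).1 (hO.2 hNO hle ((hN _).2 ⟨x, hx, rfl⟩))
  refine ⟨a, hφ ?_⟩
  rw [map_mul, ha, map_natCast, ← hu, Units.mul_inv_cancel_left]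

/-- The corner of a module-finite algebra is an order, provided it is full. -/
theorem isOrderIn_cornerOf [Module.Finite R L] (φ : L →ₐ[R] A) {ε : L}
    (hc : ∀ x, Commute ε x) (hid : ε * ε = ε)
    (hfull : ∀ a : A, ∃ r ∈ nonZeroDivisors R, ∃ x, φ x = r • a) :
    IsOrderIn R (φ ε) (cornerOf R φ.range (φ ε)) := by
  refine ⟨?_, (mem_cornerOf_range hid).2 ⟨ε, hid, rfl⟩, ?_, ?_, ?_⟩
  · intro x hx
    obtain ⟨a, ha, rfl⟩ := (mem_cornerOf_range hid).1 hx
    refine ⟨?_, by rw [← map_mul, ha]⟩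
    rw [← map_mul, (hc a).eq, ha]
  · intro x hx y hy
    obtain ⟨a, ha, rfl⟩ := (mem_cornerOf_range hid).1 hx
    obtain ⟨b, hb, rfl⟩ := (mem_cornerOf_range hid).1 hy
    exact (mem_cornerOf_range hid).2 ⟨a * b, by rw [mul_assoc, hb], map_mul _ _ _⟩
  · refine Submodule.FG.map _ ?_
    have h : Subalgebra.toSubmodule φ.range = (⊤ : Submodule R L).map φ.toLinearMap := by
      rw [← LinearMap.range_eq_map]; rfl
    rw [h]
    exact Module.Finite.fg_top.map _
  · intro a
    obtain ⟨r, hr, x, hx⟩ := hfull a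
    refine ⟨r, hr, (mem_cornerOf_range hid).2 ⟨ε * x * ε, by rw [mul_assoc, hid], ?_⟩⟩
    rw [map_mul, map_mul, hx]
    simp

end MaximalOrders

/-! ### The group ring of a finite group -/

section FiniteGroup

variable {p : ℕ} [Fact p.Prime] {H : Type*} [Group H] [Fintype H]

open scoped Classical in
/-- If a power of `y` is divisible by `p`, then the sum of the coefficients of `y` at the
elements of order dividing `p ^ n` is divisible by `p`, for large `n`. -/
theorem dvd_sum_coeff_of_dvd_pow {y : MonoidAlgebra ℤ_[p] H} {m n : ℕ}
    (h : (p : MonoidAlgebra ℤ_[p] H) ∣ y ^ m) (hmn : m ≤ p ^ n) :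
    (p : ℤ_[p]) ∣ ∑ g with g ^ p ^ n = 1, y.coeff g := by
  have h1 : redModP p H y ^ p ^ n = 0 := by
    rw [← map_pow, redModP_eq_zero_iff, ← Nat.add_sub_cancel' hmn, pow_add]
    exact h.mul_right _
  have h2 := MonoidAlgebra.coeff_one_pow p (redModP p H y) n
  rw [h1] at h2
  rw [← toZMod_eq_zero_iff, map_sum]
  simpa [ZMod.pow_card_pow, coeff_redModP] using h2.symm

/-- A right ideal of `ℤ_p[H]ε` that is nil modulo `p` is contained in `p ℤ_p[H]`, provided the sum
of the `p`-elements of `H` is invertible in `𝔽_p[H]ε`. -/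
theorem dvd_of_right_nil {ε w : MonoidAlgebra ℤ_[p] H}
    (hw : (p : MonoidAlgebra ℤ_[p] H) ∣ pElementSum p ℤ_[p] H * w - ε)
    (J : Set (MonoidAlgebra ℤ_[p] H)) (hJε : ∀ x ∈ J, x * ε = x) (hJ : ∀ x ∈ J, ∀ y, x * y ∈ J)
    (hm : ∃ m, ∀ x ∈ J, (p : MonoidAlgebra ℤ_[p] H) ∣ x ^ m) :
    ∀ x ∈ J, (p : MonoidAlgebra ℤ_[p] H) ∣ x := by
  classical
  obtain ⟨m, hm⟩ := hm
  intro x hx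
  have hσ : (p : MonoidAlgebra ℤ_[p] H) ∣ x * pElementSum p ℤ_[p] H := by
    rw [dvd_iff_forall_coeff]
    intro g
    have h1 := hm _ (hJ x hx (.single g⁻¹ 1))
    have h2 := dvd_sum_coeff_of_dvd_pow (n := max m (Nat.card H)) h1
      ((le_max_left _ _).trans (Nat.lt_pow_self (Fact.out (p := p.Prime)).one_lt).le)
    simp only [pow_card_eq_one_iff p (le_max_right m (Nat.card H))] at h2
    rw [← coeff_one_mul_pElementSum, mul_assoc, ← (pElementSum_commute p _).eq, ← mul_assoc,
      MonoidAlgebra.coeff_one_mul_single, inv_inv] at h2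
    exact h2
  have h3 : x = x * pElementSum p ℤ_[p] H * w - x * (pElementSum p ℤ_[p] H * w - ε) := by
    rw [mul_sub, hJε x hx, mul_assoc]; abel
  rw [h3]
  refine dvd_sub (hσ.mul_right _) ?_
  obtain ⟨c, hc⟩ := hw
  exact ⟨x * c, by rw [hc, ← (Nat.cast_commute p x).left_comm]⟩

theorem redModP_pElementSum : redModP p H (pElementSum p ℤ_[p] H) = pElementSum p (ZMod p) H := by
  classical
  rw [pElementSum, pElementSum, map_sum]
  refine Finset.sum_congr rfl fun g _ => ?_
  simp [redModP]

theorem natCast_isUnit_padicAlgebra {A : Type*} [Ring A] [Algebra ℚ_[p] A] {n : ℕ} (hn : n ≠ 0) :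
    IsUnit (n : A) := by
  rw [← map_natCast (algebraMap ℚ_[p] A)]
  exact (IsUnit.mk0 _ (Nat.cast_ne_zero.2 hn)).map _

variable (p H) in
/-- The inclusion `ℤ_p[H] → ℚ_p[H]`. -/
abbrev padicInclusion : MonoidAlgebra ℤ_[p] H →ₐ[ℤ_[p]] MonoidAlgebra ℚ_[p] H :=
  MonoidAlgebra.mapAlgHom H (Algebra.ofId ℤ_[p] ℚ_[p])

omit [Fintype H] in
theorem coeff_padicInclusion (x : MonoidAlgebra ℤ_[p] H) (h : H) :
    (padicInclusion p H x).coeff h = (x.coeff h : ℚ_[p]) := by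
  simp [padicInclusion, Algebra.ofId_apply]

omit [Fintype H] in
theorem padicInclusion_injective : Function.Injective (padicInclusion p H) := by
  intro x y hxy
  ext h
  have := congrArg (fun z : MonoidAlgebra ℚ_[p] H => z.coeff h) hxy
  simp only [coeff_padicInclusion] at this
  exact Subtype.ext this

theorem exists_padicInclusion_eq_smul (a : MonoidAlgebra ℚ_[p] H) :
    ∃ r ∈ nonZeroDivisors ℤ_[p], ∃ x, padicInclusion p H x = r • a := by
  obtain ⟨b, hb⟩ := IsLocalization.exist_integer_multiples (nonZeroDivisors ℤ_[p]) Finset.univ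
    (fun h => a.coeff h)
  choose c hc using fun h => hb h (Finset.mem_univ h)
  refine ⟨b, b.2, .ofCoeff (Finsupp.equivFunOnFinite.symm c), ?_⟩
  ext h
  rw [coeff_padicInclusion]
  exact hc h

instance : Module.Finite ℤ_[p] (MonoidAlgebra ℤ_[p] H) := by
  classical
  refine ⟨⟨Finset.univ.image fun h => .single h 1, ?_⟩⟩
  rw [eq_top_iff]
  intro x _
  rw [← MonoidAlgebra.sum_single_coeff x]
  refine sum_mem fun h _ => ?_
  have : (MonoidAlgebra.single h (x.coeff h) : MonoidAlgebra ℤ_[p] H) =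
      x.coeff h • .single h 1 := by simp
  rw [this]
  exact Submodule.smul_mem _ _ (Submodule.subset_span (by simp))

/-- The elements `b` of `ℤ_p[H]ε` with `J b ⊆ p J`, where `J` is the radical lattice: this is `p`
times the right order of `J`. -/
def rightOrder (ε : MonoidAlgebra ℤ_[p] H) : Submodule ℤ_[p] (MonoidAlgebra ℤ_[p] H) where
  carrier := {b | ε * b = b ∧ ∀ x ∈ radicalLattice ε, ∃ y ∈ radicalLattice ε, x * b = p * y}
  add_mem' := fun {a b} ha hb => by
    refine ⟨by rw [mul_add, ha.1, hb.1], fun x hx => ?_⟩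
    obtain ⟨y, hy, h⟩ := ha.2 x hx
    obtain ⟨z, hz, h'⟩ := hb.2 x hx
    exact ⟨y + z, add_mem hy hz, by rw [mul_add, h, h', mul_add]⟩
  zero_mem' := ⟨mul_zero _, fun x _ => ⟨0, zero_mem _, by simp⟩⟩
  smul_mem' := fun c b hb => by
    refine ⟨by rw [mul_smul_comm, hb.1], fun x hx => ?_⟩
    obtain ⟨y, hy, h⟩ := hb.2 x hx
    refine ⟨c • y, ?_, by rw [mul_smul_comm, h, mul_smul_comm]⟩
    have : c • y = y * algebraMap _ _ c := by rw [← Algebra.commutes, Algebra.smul_def]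
    rw [this]
    exact mul_mem_radicalLattice_right _ hy

omit [Fintype H] in
theorem natCast_mul_mem_rightOrder {ε x : MonoidAlgebra ℤ_[p] H} (hx : ε * x = x) :
    p * x ∈ rightOrder ε := by
  refine ⟨by rw [← (Nat.cast_commute p ε).left_comm, hx], fun y hy => ⟨y * x,
    mul_mem_radicalLattice_right _ hy, ?_⟩⟩
  rw [← (Nat.cast_commute p y).left_comm]

theorem rightOrder_mul {ε : MonoidAlgebra ℤ_[p] H} (hid : ε * ε = ε)
    {b c : MonoidAlgebra ℤ_[p] H} (hb : b ∈ rightOrder ε) (hc : c ∈ rightOrder ε) :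
    ∃ z ∈ rightOrder ε, b * c = p * z := by
  have hp0 : p ≠ 0 := (Fact.out (p := p.Prime)).ne_zero
  have hbJ : b ∈ radicalLattice ε := by
    obtain ⟨y, hy, h⟩ := hb.2 _ (mul_natCast_mem_radicalLattice hid)
    rw [mul_assoc, hb.1] at h
    rwa [natCast_mul_cancel hp0 h]
  obtain ⟨z, hz, h⟩ := hc.2 b hbJ
  refine ⟨z, ⟨hz.1, fun x hx => ?_⟩, h⟩
  obtain ⟨y, hy, h'⟩ := hb.2 x hx
  obtain ⟨y', hy', h''⟩ := hc.2 y hy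
  refine ⟨y', hy', natCast_mul_cancel hp0 ?_⟩
  rw [(Nat.cast_commute p x).left_comm, ← h, ← mul_assoc, h', mul_assoc, h'']

theorem dvd_of_mem_rightOrder_of_isMaximalOrderIn {ε : MonoidAlgebra ℤ_[p] H}
    (hc : ∀ x, Commute ε x) (hid : ε * ε = ε)
    (hmax : IsMaximalOrderIn ℤ_[p] (padicInclusion p H ε)
      (cornerOf ℤ_[p] (padicGroupRing p H) (padicInclusion p H ε))) :
    ∀ b ∈ rightOrder ε, (p : MonoidAlgebra ℤ_[p] H) ∣ b :=
  dvd_of_isMaximalOrderIn (padicInclusion p H) padicInclusion_injective hc hid p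
    (natCast_isUnit_padicAlgebra (p := p) (Fact.out (p := p.Prime)).ne_zero) hmax (rightOrder ε)
    (IsNoetherian.noetherian _) (fun x hx => by rw [← (hc x).eq, hx.1])
    (fun x hx => natCast_mul_mem_rightOrder (by rw [(hc x).eq, hx]))
    (fun x hx y hy => rightOrder_mul hid hx hy)

/-- The semisimplicity criterion: if `ℤ_p[H]ε` is the right order of its radical lattice, then the
sum of the `p`-elements is invertible in `𝔽_p[H]ε`. -/
theorem exists_dvd_pElementSum_mul_sub {ε : MonoidAlgebra ℤ_[p] H}
    (hc : ∀ x, Commute ε x) (hid : ε * ε = ε)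
    (h : ∀ b ∈ rightOrder ε, (p : MonoidAlgebra ℤ_[p] H) ∣ b) :
    ∃ w, (p : MonoidAlgebra ℤ_[p] H) ∣ pElementSum p ℤ_[p] H * w - ε := by
  have hR := redModP_mul_eq_zero_of_order hc hid (fun b hb hb' => h b ⟨hb, hb'⟩)
  obtain ⟨w, hw⟩ := exists_pElementSum_mul_eq p (redModP p H ε) (fun x => by
    obtain ⟨x, rfl⟩ := redModP_surjective x
    exact (hc x).map _) (by rw [← map_mul, hid]) hR
  obtain ⟨w, rfl⟩ := redModP_surjective w
  refine ⟨w, ?_⟩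
  rw [← redModP_eq_zero_iff, map_sub, map_mul, redModP_pElementSum, hw, sub_self]

theorem isMaximalOrderIn_padicGroupRing {ε w : MonoidAlgebra ℤ_[p] H}
    (hc : ∀ x, Commute ε x) (hid : ε * ε = ε)
    (hw : (p : MonoidAlgebra ℤ_[p] H) ∣ pElementSum p ℤ_[p] H * w - ε) :
    IsMaximalOrderIn ℤ_[p] (padicInclusion p H ε)
      (cornerOf ℤ_[p] (padicGroupRing p H) (padicInclusion p H ε)) := by
  have hp0 : p ≠ 0 := (Fact.out (p := p.Prime)).ne_zero
  have hO := isOrderIn_cornerOf (padicInclusion p H) hc hid exists_padicInclusion_eq_smul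
  refine isMaximalOrderIn_of_nil (padicInclusion p H) padicInclusion_injective hc hid p
    (fun x hx => ?_) hO (fun O' hO' _ => ?_) (dvd_of_right_nil hw)
  · exact (natCast_isUnit_padicAlgebra (p := p) hp0).mul_right_eq_zero.1 hx
  · obtain ⟨r, hr, h⟩ := hO.exists_smul_mem hO'
    have hr0 : r ≠ 0 := nonZeroDivisors.ne_zero hr
    refine ⟨r.valuation, fun x hx => ?_⟩
    have h1 := Submodule.smul_mem _ ((PadicInt.unitCoeff hr0)⁻¹ : ℤ_[p]ˣ).1 (h x hx)
    have h2 := PadicInt.unitCoeff_spec hr0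
    rw [smul_smul] at h1
    nth_rewrite 2 [h2] at h1
    rw [Units.inv_mul_cancel_left] at h1
    have h3 : ((p : ℤ_[p]) ^ r.valuation) • x = (p : MonoidAlgebra ℚ_[p] H) ^ r.valuation * x := by
      rw [Algebra.smul_def, map_pow, map_natCast]
    rwa [h3] at h1

end FiniteGroup

/-! ### Coefficients of elements of the Iwasawa algebra -/

theorem MonoidAlgebra.coeff_mapDomain_eq_sum {R K K' : Type*} [CommRing R] [Group K] [Group K']
    [Fintype K] [DecidableEq K'] (f : K →* K') (y : MonoidAlgebra R K) (k' : K') :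
    (MonoidAlgebra.mapDomainAlgHom R R f y).coeff k' = ∑ k with f k = k', y.coeff k := by
  conv_lhs => rw [← MonoidAlgebra.sum_single_coeff y]
  rw [map_sum, MonoidAlgebra.coeff_sum, Finsupp.finsetSum_apply, Finset.sum_filter]
  refine Finset.sum_congr rfl fun k _ => ?_
  rw [MonoidAlgebra.mapDomainAlgHom_apply, MonoidAlgebra.mapDomain_single,
    MonoidAlgebra.coeff_single, Finsupp.single_apply]

instance OpenNormalSubgroup.finite_quotient {G : Type*} [Group G] [TopologicalSpace G]
    [IsTopologicalGroup G] [CompactSpace G] (U : OpenNormalSubgroup G) :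
    Finite (G ⧸ U.toSubgroup) :=
  Subgroup.quotient_finite_of_isOpen U.toSubgroup U.isOpen

namespace IwasawaAlgebra

variable {p : ℕ} [Fact p.Prime] {G : Type*} [Group G] [TopologicalSpace G]

theorem natCast_mul_cancel {n : ℕ} (hn : n ≠ 0) {x y : IwasawaAlgebra p G}
    (h : (n : IwasawaAlgebra p G) * x = n * y) : x = y := by
  apply ext
  intro U
  have h1 := congrArg (proj U) h
  rw [map_mul, map_mul, map_natCast] at h1
  exact _root_.natCast_mul_cancel hn h1

/-- The coefficient of an element of `Λ(G)` at a coset of an open normal subgroup. -/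
def coeff (U : OpenNormalSubgroup G) (x : IwasawaAlgebra p G) (g : G) : ℤ_[p] :=
  (proj U x).coeff (g : G ⧸ U.toSubgroup)

theorem coeff_add (U : OpenNormalSubgroup G) (x y : IwasawaAlgebra p G) (g : G) :
    coeff U (x + y) g = coeff U x g + coeff U y g := by
  rw [coeff, map_add]; rfl

theorem coeff_mul_of (U : OpenNormalSubgroup G) (x : IwasawaAlgebra p G) (g h : G) :
    coeff U (x * of p g) h = coeff U x (h * g⁻¹) := by
  rw [coeff, map_mul, proj_of, MonoidAlgebra.of_apply, MonoidAlgebra.coeff_mul_single_apply,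
    mul_one]
  rfl

theorem coeff_of_mul (U : OpenNormalSubgroup G) (x : IwasawaAlgebra p G) (g h : G) :
    coeff U (of p g * x) h = coeff U x (g⁻¹ * h) := by
  rw [coeff, map_mul, proj_of, MonoidAlgebra.of_apply, MonoidAlgebra.coeff_single_mul_apply,
    one_mul]
  rfl

theorem coeff_sum {ι : Type*} (s : Finset ι) (U : OpenNormalSubgroup G)
    (x : ι → IwasawaAlgebra p G) (g : G) : coeff U (∑ i ∈ s, x i) g = ∑ i ∈ s, coeff U (x i) g := by
  rw [coeff, map_sum, MonoidAlgebra.coeff_sum, Finsupp.finsetSum_apply]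
  rfl

theorem coeff_of (U : OpenNormalSubgroup G) (g h : G) [Decidable (g⁻¹ * h ∈ U.toSubgroup)] :
    coeff U (of p g) h = if g⁻¹ * h ∈ U.toSubgroup then 1 else 0 := by
  classical
  rw [coeff, proj_of, MonoidAlgebra.of_apply, MonoidAlgebra.coeff_single, Finsupp.single_apply]
  simp only [QuotientGroup.mk'_apply, QuotientGroup.eq]

theorem ext_coeff {x y : IwasawaAlgebra p G} (h : ∀ U g, coeff U x g = coeff U y g) : x = y := by
  apply ext
  intro U
  ext g
  induction g using QuotientGroup.induction_on with | H g => exact h U g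

theorem coeff_eq_sum {U V : OpenNormalSubgroup G} (h : U.toSubgroup ≤ V.toSubgroup)
    [Fintype (G ⧸ U.toSubgroup)] [DecidableEq (G ⧸ V.toSubgroup)]
    (x : IwasawaAlgebra p G) (g : G) :
    coeff V x g = ∑ k with quotientTransition h k = (g : G ⧸ V.toSubgroup), (proj U x).coeff k := by
  rw [coeff, ← proj_compat x h, MonoidAlgebra.coeff_mapDomain_eq_sum]

/-- A compatible family of elements of the group rings `ℤ_p[G/U]` defines an element of `Λ(G)`. -/
theorem exists_proj_eq (y : (U : OpenNormalSubgroup G) → MonoidAlgebra ℤ_[p] (G ⧸ U.toSubgroup))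
    (hy : ∀ (U V : OpenNormalSubgroup G) (h : U.toSubgroup ≤ V.toSubgroup),
      MonoidAlgebra.mapDomainAlgHom ℤ_[p] ℤ_[p] (quotientTransition h) (y U) = y V) :
    ∃ x : IwasawaAlgebra p G, ∀ U, proj U x = y U :=
  ⟨(⟨y, hy⟩ : iwasawaSubalgebra p G), fun _ => rfl⟩

variable [IsTopologicalGroup G] [CompactSpace G]

/-- An element is divisible by `n` if its coefficients are, at arbitrarily small open normal
subgroups. -/
theorem dvd_of_coeff {n : ℕ} (hn : n ≠ 0) (x : IwasawaAlgebra p G)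
    (h : ∀ V : OpenNormalSubgroup G, ∃ U : OpenNormalSubgroup G, U.toSubgroup ≤ V.toSubgroup ∧
      ∀ g, (n : ℤ_[p]) ∣ coeff U x g) : (n : IwasawaAlgebra p G) ∣ x := by
  classical
  have key : ∀ V : OpenNormalSubgroup G,
      (n : MonoidAlgebra ℤ_[p] (G ⧸ V.toSubgroup)) ∣ proj V x := by
    intro V
    have := Fintype.ofFinite (G ⧸ V.toSubgroup)
    rw [dvd_iff_forall_coeff]
    intro k
    induction k using QuotientGroup.induction_on with | H g =>
    obtain ⟨U, hUV, hU⟩ := h V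
    have := Fintype.ofFinite (G ⧸ U.toSubgroup)
    change (n : ℤ_[p]) ∣ coeff V x g
    rw [coeff_eq_sum hUV]
    refine Finset.dvd_sum fun k _ => ?_
    induction k using QuotientGroup.induction_on with | H g => exact hU g
  choose y hy using key
  obtain ⟨z, hz⟩ := exists_proj_eq y (fun U V h => by
    refine _root_.natCast_mul_cancel hn ?_
    rw [← hy, ← proj_compat x h, hy, map_mul, map_natCast])
  refine ⟨z, ext fun V => ?_⟩
  rw [map_mul, map_natCast, hy, hz]

end IwasawaAlgebra

/-! ### Subgroups isomorphic to `ℤ_p` and their levels -/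

section Levels

variable {p : ℕ} [Fact p.Prime] {G : Type*} [Group G] [TopologicalSpace G]
  {Γ : Subgroup G} (ψ : Γ ≃ₜ* Multiplicative ℤ_[p])

include ψ in
theorem Subgroup.mul_comm_of_padic (x y : Γ) : x * y = y * x :=
  ψ.injective (by rw [map_mul, map_mul, mul_comm])

/-- The subgroup `Γ^(p^a)` of a subgroup `Γ` isomorphic to `ℤ_p`. -/
def padicLevel (ψ : Γ ≃ₜ* Multiplicative ℤ_[p]) (a : ℕ) : Subgroup G where
  carrier := {g | ∃ γ : Γ, (γ : G) ^ p ^ a = g}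
  mul_mem' := by
    rintro _ _ ⟨x, rfl⟩ ⟨y, rfl⟩
    have h : Commute x y := Subgroup.mul_comm_of_padic ψ x y
    exact ⟨x * y, congrArg Subtype.val (h.mul_pow (p ^ a))⟩
  one_mem' := ⟨1, by simp⟩
  inv_mem' := by
    rintro _ ⟨x, rfl⟩
    exact ⟨x⁻¹, by simp⟩

theorem padicLevel_le (a : ℕ) : padicLevel ψ a ≤ Γ := by
  rintro _ ⟨x, rfl⟩
  exact Γ.pow_mem x.2 _

theorem mem_padicLevel_add {a b : ℕ} {g : G} :
    g ∈ padicLevel ψ (a + b) ↔ ∃ γ ∈ padicLevel ψ a, γ ^ p ^ b = g := by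
  constructor
  · rintro ⟨x, rfl⟩
    exact ⟨(x : G) ^ p ^ a, ⟨x, rfl⟩, by rw [← pow_mul, ← pow_add]⟩
  · rintro ⟨_, ⟨x, rfl⟩, rfl⟩
    exact ⟨x, by rw [← pow_mul, ← pow_add]⟩

theorem padicLevel_antitone {a b : ℕ} (h : a ≤ b) : padicLevel ψ b ≤ padicLevel ψ a := by
  obtain ⟨c, rfl⟩ := Nat.exists_eq_add_of_le h
  intro g hg
  obtain ⟨γ, hγ, rfl⟩ := (mem_padicLevel_add ψ).1 hg
  exact Subgroup.pow_mem _ hγ _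

theorem coe_mem_padicLevel_iff {a : ℕ} (γ : Γ) :
    (γ : G) ∈ padicLevel ψ a ↔ (p : ℤ_[p]) ^ a ∣ (ψ γ).toAdd := by
  have hpow : ∀ x : Γ, (ψ (x ^ p ^ a)).toAdd = (p : ℤ_[p]) ^ a * (ψ x).toAdd := by
    intro x
    rw [map_pow, toAdd_pow, nsmul_eq_mul, Nat.cast_pow]
  constructor
  · rintro ⟨x, hx⟩
    have : x ^ p ^ a = γ := Subtype.ext hx
    exact ⟨(ψ x).toAdd, by rw [← this, hpow]⟩
  · rintro ⟨c, hc⟩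
    refine ⟨ψ.symm (Multiplicative.ofAdd c), ?_⟩
    have : (ψ.symm (Multiplicative.ofAdd c)) ^ p ^ a = γ := by
      apply ψ.injective
      apply Multiplicative.toAdd.injective
      rw [hpow, hc]
      simp
    exact congrArg Subtype.val this

theorem padicInt_dvd_iff_norm_le (a : ℕ) (z : ℤ_[p]) :
    (p : ℤ_[p]) ^ a ∣ z ↔ ‖z‖ ≤ (p : ℝ) ^ (-(a : ℤ)) := by
  rw [PadicInt.norm_le_pow_iff_mem_span_pow, Ideal.mem_span_singleton]

include ψ in
theorem Subgroup.eq_one_of_pow_eq_one_of_padic {x : Γ} {n : ℕ} (hn : n ≠ 0) (hx : x ^ n = 1) :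
    x = 1 := by
  apply ψ.injective
  have := congrArg (fun y => (ψ y).toAdd) hx
  simp only [map_pow, toAdd_pow, map_one, toAdd_one, nsmul_eq_mul, mul_eq_zero,
    Nat.cast_eq_zero, hn, false_or] at this
  rw [map_one]
  exact Multiplicative.toAdd.injective this

theorem exists_padicLevel_le (V : Subgroup Γ) (hV : IsOpen (V : Set Γ)) :
    ∃ a, ∀ γ : Γ, (γ : G) ∈ padicLevel ψ a → γ ∈ V := by
  have h1 : IsOpen ((fun z : ℤ_[p] => ψ.symm (Multiplicative.ofAdd z)) ⁻¹' (V : Set Γ)) :=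
    hV.preimage (ψ.symm.continuous.comp continuous_ofAdd)
  obtain ⟨ε, hε, hball⟩ := Metric.isOpen_iff.1 h1 0 (by
    change ψ.symm (Multiplicative.ofAdd 0) ∈ V
    rw [ofAdd_zero, map_one]
    exact V.one_mem)
  obtain ⟨a, ha⟩ := PadicInt.exists_pow_neg_lt p hε
  refine ⟨a, fun γ hγ => ?_⟩
  rw [coe_mem_padicLevel_iff, padicInt_dvd_iff_norm_le] at hγ
  have := hball (show (ψ γ).toAdd ∈ Metric.ball 0 ε by
    rw [Metric.mem_ball, dist_zero_right]
    exact hγ.trans_lt ha)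
  simpa using this

theorem isOpen_padicLevel (hΓ : IsOpen (Γ : Set G)) (a : ℕ) :
    IsOpen (padicLevel ψ a : Set G) := by
  have h1 : IsOpen {γ : Γ | (γ : G) ∈ padicLevel ψ a} := by
    have h2 : {γ : Γ | (γ : G) ∈ padicLevel ψ a} =
        (fun γ => (ψ γ).toAdd) ⁻¹' Metric.closedBall 0 ((p : ℝ) ^ (-(a : ℤ))) := by
      ext γ
      simp [coe_mem_padicLevel_iff, padicInt_dvd_iff_norm_le]
    rw [h2]
    refine (IsUltrametricDist.isOpen_closedBall _ (ne_of_gt ?_)).preimage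
      (continuous_toAdd.comp ψ.continuous)
    exact zpow_pos (Nat.cast_pos.2 (Fact.out (p := p.Prime)).pos) _
  have h3 := hΓ.isOpenMap_subtype_val _ h1
  convert h3 using 1
  ext g
  constructor
  · intro hg
    exact ⟨⟨g, padicLevel_le ψ a hg⟩, hg, rfl⟩
  · rintro ⟨γ, hγ, rfl⟩
    exact hγ

end Levels

section SemidirectProduct

variable {p : ℕ} [Fact p.Prime] {G : Type*} [Group G] [TopologicalSpace G]
  {H Γ : Subgroup G}
  (ψ : Γ ≃ₜ* Multiplicative ℤ_[p])

include ψ in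
theorem Subgroup.IsComplement'.isOpen_right [IsTopologicalGroup G] [T2Space G] [Finite H]
    (h : H.IsComplement' Γ) :
    IsOpen (Γ : Set G) := by
  have : CompactSpace (Multiplicative ℤ_[p]) := inferInstanceAs (CompactSpace ℤ_[p])
  have : CompactSpace Γ := ψ.symm.toHomeomorph.compactSpace
  have hc : IsClosed (Γ : Set G) := (isCompact_iff_compactSpace.2 this).isClosed
  have hi : Γ.FiniteIndex := ⟨by
    rw [h.index_eq_card]
    exact Nat.card_pos.ne'⟩
  exact Subgroup.isOpen_of_isClosed_of_finiteIndex Γ hc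

include ψ in
/-- A finite normal subgroup is contained in `H`, because `G/H ≅ Γ` is torsion-free. -/
theorem Subgroup.IsComplement'.le_left_of_finite [H.Normal] (h : H.IsComplement' Γ)
    (N : Subgroup G) [Finite N] : N ≤ H := by
  intro n hn
  obtain ⟨⟨x, γ⟩, hx⟩ := h.2 n
  simp only at hx
  have h1 : n ^ Nat.card N = 1 := by
    have := pow_card_eq_one' (x := (⟨n, hn⟩ : N))
    exact congrArg Subtype.val this
  have h2 : ((γ : G) : G ⧸ H) ^ Nat.card N = 1 := by
    have h3 : ((n : G) : G ⧸ H) = ((γ : G) : G ⧸ H) := by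
      rw [← hx, QuotientGroup.mk_mul, (QuotientGroup.eq_one_iff _).2 x.2, one_mul]
    rw [← h3, ← QuotientGroup.mk_pow, h1]; rfl
  rw [← QuotientGroup.mk_pow, QuotientGroup.eq_one_iff] at h2
  have h4 : (γ : G) ^ Nat.card N = 1 :=
    Subgroup.disjoint_def.1 h.disjoint h2 (Γ.pow_mem γ.2 _)
  have h5 := Subgroup.eq_one_of_pow_eq_one_of_padic ψ Nat.card_pos.ne' (Subtype.ext h4)
  rw [h5] at hx
  rw [← hx]
  simp

variable (hΓ : IsOpen (Γ : Set G))

/-- The level `Γ^(p^a)` as an open normal subgroup, when it is central. -/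
def padicLevelOpen (a : ℕ) (ha : padicLevel ψ a ≤ Subgroup.center G) : OpenNormalSubgroup G where
  toSubgroup := padicLevel ψ a
  isOpen' := isOpen_padicLevel ψ hΓ a
  isNormal' := ⟨fun n hn g => by
    have := Subgroup.mem_center_iff.1 (ha hn) g
    rw [this, mul_inv_cancel_right]
    exact hn⟩

end SemidirectProduct

/-! ### The finite group ring inside the Iwasawa algebra -/

namespace IwasawaAlgebra

section GroupRing

variable {p : ℕ} [Fact p.Prime] {G : Type*} [Group G] [TopologicalSpace G] (H : Subgroup G)

variable (p) in
/-- The canonical map `ℤ_p[H] → Λ(G)`. -/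
def ofGroupRing : MonoidAlgebra ℤ_[p] H →ₐ[ℤ_[p]] IwasawaAlgebra p G :=
  MonoidAlgebra.lift ℤ_[p] _ _ ((of p).comp H.subtype)

theorem ofGroupRing_single (h : H) (r : ℤ_[p]) :
    ofGroupRing p H (.single h r) = r • of p (h : G) := by
  rw [ofGroupRing, MonoidAlgebra.lift_single]; rfl

theorem coeff_smul (U : OpenNormalSubgroup G) (r : ℤ_[p]) (x : IwasawaAlgebra p G) (g : G) :
    coeff U (r • x) g = r * coeff U x g := by
  rw [coeff, map_smul]; rfl

theorem coeff_ofGroupRing [Fintype H] (U : OpenNormalSubgroup G)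
    (hU : ∀ h ∈ H, h ∈ U.toSubgroup → h = 1)
    (x : MonoidAlgebra ℤ_[p] H) (h : H) : coeff U (ofGroupRing p H x) h = x.coeff h := by
  classical
  conv_lhs => rw [← MonoidAlgebra.sum_single_coeff x]
  rw [map_sum, coeff_sum, Finset.sum_eq_single h]
  · rw [ofGroupRing_single, coeff_smul, coeff_of, if_pos (by simp), mul_one]
  · intro k _ hk
    rw [ofGroupRing_single, coeff_smul, coeff_of, if_neg, mul_zero]
    intro hmem
    exact hk (Subtype.ext (inv_mul_eq_one.1 (hU _ (H.mul_mem (H.inv_mem k.2) h.2) hmem)))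
  · simp

theorem dvd_of_dvd_ofGroupRing [Fintype H] (U : OpenNormalSubgroup G)
    (hU : ∀ h ∈ H, h ∈ U.toSubgroup → h = 1) {n : ℕ} {x : MonoidAlgebra ℤ_[p] H}
    (hx : (n : IwasawaAlgebra p G) ∣ ofGroupRing p H x) : (n : MonoidAlgebra ℤ_[p] H) ∣ x := by
  rw [dvd_iff_forall_coeff]
  intro h
  obtain ⟨y, hy⟩ := hx
  rw [← coeff_ofGroupRing H U hU x h, hy, ← nsmul_eq_mul, ← Nat.cast_smul_eq_nsmul ℤ_[p],
    coeff_smul]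
  exact dvd_mul_right _ _

theorem ofGroupRing_injective [Fintype H] (U : OpenNormalSubgroup G)
    (hU : ∀ h ∈ H, h ∈ U.toSubgroup → h = 1) : Function.Injective (ofGroupRing p H) := by
  intro x y hxy
  ext h
  rw [← coeff_ofGroupRing H U hU x h, ← coeff_ofGroupRing H U hU y h, hxy]

/-- Conjugation by `g ∈ G` on the group ring of a normal subgroup. -/
def conjGroupRing [H.Normal] (g : G) : MonoidAlgebra ℤ_[p] H ≃ₐ[ℤ_[p]] MonoidAlgebra ℤ_[p] H :=
  MonoidAlgebra.domCongr ℤ_[p] ℤ_[p] (MulAut.conjNormal g)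

omit [TopologicalSpace G] in
theorem conjGroupRing_single [H.Normal] (g : G) (h : H) (r : ℤ_[p]) :
    conjGroupRing H g (.single h r) = .single (MulAut.conjNormal g h) r := by
  simp [conjGroupRing]

theorem of_mul_ofGroupRing [H.Normal] (g : G) (x : MonoidAlgebra ℤ_[p] H) :
    of p g * ofGroupRing p H x = ofGroupRing p H (conjGroupRing H g x) * of p g := by
  induction x using MonoidAlgebra.induction_linear with
  | zero => simp
  | add a b ha hb => simp only [map_add, mul_add, add_mul, ha, hb]
  | single m r =>
    rw [conjGroupRing_single, ofGroupRing_single, ofGroupRing_single, mul_smul_comm, smul_mul_assoc,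
      ← map_mul, ← map_mul]
    simp

end GroupRing

section Nil

variable {p : ℕ} [Fact p.Prime] {G : Type*} [Group G] [TopologicalSpace G]
  {H Γ : Subgroup G} [H.Normal]
  (ψ : Γ ≃ₜ* Multiplicative ℤ_[p]) (hΓ : IsOpen (Γ : Set G)) (hHΓ : H.IsComplement' Γ)

include hHΓ in
/-- If `g ^ (p ^ n)` lies in a level `Γ^(p^(a+n))`, then `g` is the product of a `p`-element of
`H` and an element of the central level `Γ^(p^a)`. -/
theorem exists_mul_of_pow_mem_padicLevel {a n : ℕ} (ha : padicLevel ψ a ≤ Subgroup.center G) {g : G}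
    (hg : g ^ p ^ n ∈ padicLevel ψ (a + n)) :
    ∃ h : H, h ^ p ^ n = 1 ∧ (h : G)⁻¹ * g ∈ padicLevel ψ a := by
  obtain ⟨⟨h, γ⟩, hx⟩ := hHΓ.2 g
  simp only at hx
  obtain ⟨z, hz, hzg⟩ := (mem_padicLevel_add ψ).1 hg
  have h1 : ((γ : G) : G ⧸ H) ^ p ^ n = (z : G ⧸ H) ^ p ^ n := by
    have h3 : (g : G ⧸ H) = ((γ : G) : G ⧸ H) := by
      rw [← hx, QuotientGroup.mk_mul, (QuotientGroup.eq_one_iff _).2 h.2, one_mul]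
    rw [← h3, ← QuotientGroup.mk_pow, ← QuotientGroup.mk_pow, hzg]
  have hzΓ : z ∈ Γ := padicLevel_le ψ a hz
  have h2 : (γ : G)⁻¹ ^ p ^ n * z ^ p ^ n = 1 := by
    refine Subgroup.disjoint_def.1 hHΓ.disjoint ?_
      (Γ.mul_mem (Γ.pow_mem (Γ.inv_mem γ.2) _) (Γ.pow_mem hzΓ _))
    rw [← QuotientGroup.mk_pow, ← QuotientGroup.mk_pow, QuotientGroup.eq] at h1
    rwa [inv_pow]
  have h3 : γ = ⟨z, hzΓ⟩ := by
    rw [← inv_mul_eq_one]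
    refine Subgroup.eq_one_of_pow_eq_one_of_padic ψ
      (pow_ne_zero n (Fact.out (p := p.Prime)).ne_zero) ?_
    have hcomm : Commute γ⁻¹ (⟨z, hzΓ⟩ : Γ) := Subgroup.mul_comm_of_padic ψ _ _
    rw [hcomm.mul_pow]
    exact Subtype.ext h2
  have h4 : (h : G) * z = g := by rw [← hx, h3]
  refine ⟨h, ?_, ?_⟩
  · have hcomm : Commute (h : G) z := Subgroup.mem_center_iff.1 (ha hz) _
    have h5 : (h : G) ^ p ^ n * z ^ p ^ n = z ^ p ^ n := by rw [← hcomm.mul_pow, h4, hzg]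
    exact Subtype.ext (by simpa using h5)
  · rw [← h4, inv_mul_cancel_left]
    exact hz

variable [IsTopologicalGroup G] [CompactSpace G] [Fintype H]

include hΓ hHΓ in
open scoped Classical in
/-- If a power of `y` is divisible by `p`, then so is the sum of the coefficients of `y` at the
cosets of the `p`-elements of `H` modulo the central level `Γ^(p^a)`: for a large `n`, the elements
of these cosets are those whose `p ^ n`-th power lies in `Γ^(p^(a+n))`. -/
theorem dvd_sum_coeff_of_dvd_pow {y : IwasawaAlgebra p G} {m : ℕ}
    (h : (p : IwasawaAlgebra p G) ∣ y ^ m) {a : ℕ} (ha : padicLevel ψ a ≤ Subgroup.center G) :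
    (p : ℤ_[p]) ∣ ∑ h : H with ∃ k, h ^ p ^ k = 1, coeff (padicLevelOpen ψ hΓ a ha) y h := by
  set n := max m (Nat.card H) with hn
  have han : padicLevel ψ (a + n) ≤ padicLevel ψ a := padicLevel_antitone ψ (Nat.le_add_right a n)
  let V := padicLevelOpen ψ hΓ a ha
  let U := padicLevelOpen ψ hΓ (a + n) (han.trans ha)
  have hUV : U.toSubgroup ≤ V.toSubgroup := han
  have := Fintype.ofFinite (G ⧸ U.toSubgroup)
  have hHV : ∀ h ∈ H, h ∈ V.toSubgroup → h = 1 := fun h hh hV =>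
    Subgroup.disjoint_def.1 hHΓ.disjoint hh (padicLevel_le ψ a hV)
  have h1 : (p : MonoidAlgebra ℤ_[p] (G ⧸ U.toSubgroup)) ∣ (proj U y) ^ m := by
    obtain ⟨c, hc⟩ := h
    exact ⟨proj U c, by rw [← map_pow, hc, map_mul, map_natCast]⟩
  have h2 := _root_.dvd_sum_coeff_of_dvd_pow (n := n) h1
    ((le_max_left _ _).trans (Nat.lt_pow_self (Fact.out (p := p.Prime)).one_lt).le)
  have h3 : ∑ h : H with ∃ k, h ^ p ^ k = 1, coeff V y h =
      ∑ k : G ⧸ U.toSubgroup with k ^ p ^ n = 1, (proj U y).coeff k := by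
    simp only [coeff_eq_sum hUV]
    rw [← Finset.sum_biUnion]
    · refine Finset.sum_congr ?_ fun _ _ => rfl
      ext k
      induction k using QuotientGroup.induction_on with | H g =>
      have hg : quotientTransition hUV (g : G ⧸ U.toSubgroup) = (g : G ⧸ V.toSubgroup) := rfl
      simp only [Finset.mem_biUnion, Finset.mem_filter, Finset.mem_univ, true_and, hg]
      rw [← QuotientGroup.mk_pow, QuotientGroup.eq_one_iff]
      constructor
      · rintro ⟨h, hh, hhg⟩
        rw [← pow_card_eq_one_iff p (le_max_right m (Nat.card H))] at hh
        have hz : (h : G)⁻¹ * g ∈ padicLevel ψ a := QuotientGroup.eq.1 hhg.symm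
        refine (mem_padicLevel_add ψ).2 ⟨_, hz, ?_⟩
        have hcomm : Commute (h : G) ((h : G)⁻¹ * g) := Subgroup.mem_center_iff.1 (ha hz) _
        have h4 : g = h * ((h : G)⁻¹ * g) := (mul_inv_cancel_left _ _).symm
        conv_rhs => rw [h4, hcomm.mul_pow]
        have h5 : (h : G) ^ p ^ n = 1 := congrArg Subtype.val hh
        rw [h5, one_mul]
      · intro hg
        obtain ⟨h, hh, hhg⟩ := exists_mul_of_pow_mem_padicLevel ψ hHΓ ha hg
        exact ⟨h, ⟨n, hh⟩, (QuotientGroup.eq.2 hhg).symm⟩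
    · intro h _ h' _ hne
      rw [Function.onFun, Finset.disjoint_left]
      intro k hk hk'
      simp only [Finset.mem_filter, Finset.mem_univ, true_and] at hk hk'
      refine hne (Subtype.ext (inv_mul_eq_one.1 (hHV _ (H.mul_mem (H.inv_mem h.2) h'.2) ?_)))
      exact QuotientGroup.eq.1 (hk.symm.trans hk')
  rw [h3]
  convert h2

include hΓ hHΓ in
/-- A right ideal of `Λ(G)ε` that is nil modulo `p` is contained in `p Λ(G)`, provided the sum of
the `p`-elements of `H` is invertible in `𝔽_p[H]ε`. -/
theorem dvd_of_right_nil {ε w : MonoidAlgebra ℤ_[p] H}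
    (hcenter : ∃ a, padicLevel ψ a ≤ Subgroup.center G)
    (hw : (p : MonoidAlgebra ℤ_[p] H) ∣ pElementSum p ℤ_[p] H * w - ε)
    (J : Set (IwasawaAlgebra p G)) (hJε : ∀ x ∈ J, x * ofGroupRing p H ε = x)
    (hJ : ∀ x ∈ J, ∀ y, x * y ∈ J)
    (hm : ∃ m, ∀ x ∈ J, (p : IwasawaAlgebra p G) ∣ x ^ m) :
    ∀ x ∈ J, (p : IwasawaAlgebra p G) ∣ x := by
  classical
  obtain ⟨m, hm⟩ := hm
  obtain ⟨a₀, ha₀⟩ := hcenter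
  intro x hx
  have hσ : (p : IwasawaAlgebra p G) ∣ x * ofGroupRing p H (pElementSum p ℤ_[p] H) := by
    refine dvd_of_coeff (Fact.out (p := p.Prime)).ne_zero _ fun V => ?_
    obtain ⟨b, hb⟩ := exists_padicLevel_le ψ (V.toSubgroup.subgroupOf Γ)
      (V.isOpen.preimage continuous_subtype_val)
    have ha : padicLevel ψ (max a₀ b) ≤ Subgroup.center G :=
      (padicLevel_antitone ψ (le_max_left _ _)).trans ha₀
    refine ⟨padicLevelOpen ψ hΓ (max a₀ b) ha, ?_, fun g => ?_⟩
    · intro g hg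
      have hg' : g ∈ padicLevel ψ b := padicLevel_antitone ψ (le_max_right a₀ b) hg
      exact hb ⟨g, padicLevel_le ψ b hg'⟩ hg'
    · have h1 := dvd_sum_coeff_of_dvd_pow ψ hΓ hHΓ (hm _ (hJ x hx (of p g⁻¹))) ha
      rw [pElementSum, map_sum, Finset.mul_sum, coeff_sum]
      simp only [coeff_mul_of, inv_inv] at h1
      simp only [ofGroupRing_single, one_smul, coeff_mul_of]
      convert h1 using 1
      refine Finset.sum_nbij' (fun h => MulAut.conjNormal g h⁻¹)
        (fun h => (MulAut.conjNormal g⁻¹ h)⁻¹) ?_ ?_ ?_ ?_ ?_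
      · rintro h hh
        simp only [Finset.mem_filter, Finset.mem_univ, true_and] at hh ⊢
        obtain ⟨k, hk⟩ := hh
        exact ⟨k, by rw [← map_pow, inv_pow, hk, inv_one, map_one]⟩
      · rintro h hh
        simp only [Finset.mem_filter, Finset.mem_univ, true_and] at hh ⊢
        obtain ⟨k, hk⟩ := hh
        exact ⟨k, by rw [inv_pow, ← map_pow, hk, map_one, inv_one]⟩
      · intro h _
        apply Subtype.ext
        simp
      · intro h _
        apply Subtype.ext
        simp
      · intro h _
        congr 1
        simp [mul_assoc]
  set φ := ofGroupRing p H
  have h3 : x = x * φ (pElementSum p ℤ_[p] H) * φ w - x * φ (pElementSum p ℤ_[p] H * w - ε) := by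
    rw [map_sub, map_mul, mul_sub, hJε x hx, mul_assoc]; abel
  rw [h3]
  refine dvd_sub (hσ.mul_right _) ?_
  obtain ⟨c, hc⟩ := hw
  exact ⟨x * φ c, by rw [hc, map_mul, map_natCast, ← (Nat.cast_commute p x).left_comm]⟩

end Nil

end IwasawaAlgebra

/-! ### Compactness and division in the Iwasawa algebra -/

theorem PadicInt.eq_zero_of_forall_pow_dvd {p : ℕ} [Fact p.Prime] {z : ℤ_[p]}
    (h : ∀ n, (p : ℤ_[p]) ^ n ∣ z) : z = 0 := by
  by_contra hz
  obtain ⟨n, hn⟩ := FiniteMultiplicity.of_not_isUnit (a := (p : ℤ_[p]))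
    PadicInt.prime_p.not_isUnit hz
  exact hn (h _)

namespace IwasawaAlgebra

section Compact

variable {p : ℕ} [Fact p.Prime] {G : Type*} [Group G] [TopologicalSpace G]

/-- The whole group as an open normal subgroup. -/
def topOpen (G : Type*) [Group G] [TopologicalSpace G] : OpenNormalSubgroup G where
  toSubgroup := ⊤
  isOpen' := isOpen_univ
  isNormal' := inferInstance

theorem dvd_proj_of_le {U V : OpenNormalSubgroup G} (h : U.toSubgroup ≤ V.toSubgroup) {n : ℕ}
    {x : IwasawaAlgebra p G} (hx : (n : MonoidAlgebra ℤ_[p] (G ⧸ U.toSubgroup)) ∣ proj U x) :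
    (n : MonoidAlgebra ℤ_[p] (G ⧸ V.toSubgroup)) ∣ proj V x := by
  obtain ⟨c, hc⟩ := hx
  exact ⟨_, by rw [← proj_compat x h, hc, map_mul, map_natCast]⟩

variable [IsTopologicalGroup G] [CompactSpace G]

/-- By compactness of `Λ(G)`, the equation `b y = a` has a solution if it has an approximate
solution modulo every power of `p` in every group ring `ℤ_p[G/U]`. -/
theorem exists_mul_eq_of_forall_proj (b a : IwasawaAlgebra p G)
    (h : ∀ (U : OpenNormalSubgroup G) (n : ℕ), ∃ y,
      ((p ^ n : ℕ) : MonoidAlgebra ℤ_[p] (G ⧸ U.toSubgroup)) ∣ proj U (b * y - a)) :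
    ∃ y, b * y = a := by
  classical
  have hfin : ∀ U : OpenNormalSubgroup G, Fintype (G ⧸ U.toSubgroup) :=
    fun U => Fintype.ofFinite _
  let X := (U : OpenNormalSubgroup G) → (G ⧸ U.toSubgroup) → ℤ_[p]
  let Φ : IwasawaAlgebra p G → X := fun y U k => (proj U y).coeff k
  let F : OpenNormalSubgroup G × ℕ → Set X := fun i =>
    Φ '' {y | ((p ^ i.2 : ℕ) : MonoidAlgebra ℤ_[p] (G ⧸ i.1.toSubgroup)) ∣ proj i.1 (b * y - a)}
  have hΦ : Function.Injective Φ := fun y z hyz => ext fun U => by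
    ext k
    exact congrFun (congrFun hyz U) k
  have hrange : Set.range Φ = ⋂ (U : OpenNormalSubgroup G) (V : OpenNormalSubgroup G)
      (hUV : U.toSubgroup ≤ V.toSubgroup) (k' : G ⧸ V.toSubgroup),
      {c : X | ∑ k with quotientTransition hUV k = k', c U k = c V k'} := by
    ext c
    simp only [Set.mem_iInter, Set.mem_ofPred_eq, Set.mem_range]
    constructor
    · rintro ⟨y, rfl⟩ U V hUV k'
      rw [← MonoidAlgebra.coeff_mapDomain_eq_sum, proj_compat]
    · intro hc
      obtain ⟨y, hy⟩ := exists_proj_eq (p := p) (G := G)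
        (fun U => ∑ k, MonoidAlgebra.single k (c U k)) (fun U V hUV => by
          ext k'
          rw [MonoidAlgebra.coeff_mapDomain_eq_sum]
          simp only [MonoidAlgebra.coeff_sum, Finsupp.finsetSum_apply, MonoidAlgebra.coeff_single,
            Finsupp.single_apply, Finset.sum_ite_eq', Finset.mem_univ, if_true]
          exact hc U V hUV k')
      refine ⟨y, ?_⟩
      ext U k
      change (proj U y).coeff k = _
      rw [hy]
      simp [Finsupp.single_apply]
  have hmul : ∀ (U : OpenNormalSubgroup G) (y : IwasawaAlgebra p G) (k : G ⧸ U.toSubgroup),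
      (proj U (b * y - a)).coeff k =
        ∑ j, Φ y U j * (proj U b * .single j 1).coeff k - (proj U a).coeff k := by
    intro U y k
    rw [map_sub, map_mul, MonoidAlgebra.coeff_sub, Finsupp.sub_apply]
    congr 1
    conv_lhs => rw [← MonoidAlgebra.sum_single_coeff (proj U y)]
    rw [Finset.mul_sum, MonoidAlgebra.coeff_sum, Finsupp.finsetSum_apply]
    refine Finset.sum_congr rfl fun j _ => ?_
    have : MonoidAlgebra.single j ((proj U y).coeff j) =
        (proj U y).coeff j • MonoidAlgebra.single j (1 : ℤ_[p]) := by
      rw [MonoidAlgebra.smul_single, smul_eq_mul, mul_one]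
    rw [this, mul_smul_comm]
    rfl
  have hdvd : ∀ (i : OpenNormalSubgroup G × ℕ) (y : IwasawaAlgebra p G),
      ((p ^ i.2 : ℕ) : MonoidAlgebra ℤ_[p] (G ⧸ i.1.toSubgroup)) ∣ proj i.1 (b * y - a) ↔
        ∀ k, ((p : ℤ_[p]) ^ i.2) ∣
          ∑ j, Φ y i.1 j * (proj i.1 b * .single j 1).coeff k - (proj i.1 a).coeff k := by
    intro i y
    rw [dvd_iff_forall_coeff]
    simp only [hmul, Nat.cast_pow]
  have hclosed : ∀ i, IsClosed (F i) := by
    intro i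
    have h1 : F i = Set.range Φ ∩ ⋂ k, {c : X | ((p : ℤ_[p]) ^ i.2) ∣
        ∑ j, c i.1 j * (proj i.1 b * .single j 1).coeff k - (proj i.1 a).coeff k} := by
      ext c
      simp only [F, Set.mem_image, Set.mem_ofPred_eq, Set.mem_inter_iff, Set.mem_range,
        Set.mem_iInter]
      constructor
      · rintro ⟨y, hy, rfl⟩
        exact ⟨⟨y, rfl⟩, (hdvd i y).1 hy⟩
      · rintro ⟨⟨y, rfl⟩, hy⟩
        exact ⟨y, (hdvd i y).2 hy, rfl⟩
    rw [h1, hrange]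
    refine IsClosed.inter ?_ ?_
    · refine isClosed_iInter fun U => isClosed_iInter fun V => isClosed_iInter fun hUV =>
        isClosed_iInter fun k' => isClosed_eq (by fun_prop) (by fun_prop)
    · refine isClosed_iInter fun k => ?_
      simp only [padicInt_dvd_iff_norm_le]
      exact isClosed_le (by fun_prop) continuous_const
  have hmono : ∀ {U V : OpenNormalSubgroup G} {n m : ℕ}, U.toSubgroup ≤ V.toSubgroup → m ≤ n →
      F (U, n) ⊆ F (V, m) := by
    rintro U V n m hUV hmn _ ⟨y, hy, rfl⟩
    refine ⟨y, dvd_trans ?_ (dvd_proj_of_le hUV hy), rfl⟩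
    exact Nat.cast_dvd_cast (pow_dvd_pow p hmn)
  have : Nonempty (OpenNormalSubgroup G × ℕ) := ⟨(topOpen G, 0)⟩
  obtain ⟨c, hc⟩ := IsCompact.nonempty_iInter_of_directed_nonempty_isCompact_isClosed F
    (fun i j => ⟨(i.1 ⊓ j.1, max i.2 j.2), hmono inf_le_left (le_max_left _ _),
      hmono inf_le_right (le_max_right _ _)⟩)
    (fun i => by
      obtain ⟨y, hy⟩ := h i.1 i.2
      exact ⟨Φ y, y, hy, rfl⟩)
    (fun i => (hclosed i).isCompact) hclosed
  rw [Set.mem_iInter] at hc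
  obtain ⟨y, -, rfl⟩ := hc (topOpen G, 0)
  refine ⟨y, sub_eq_zero.1 (ext fun U => ?_)⟩
  ext k
  rw [map_zero]
  refine PadicInt.eq_zero_of_forall_pow_dvd fun n => ?_
  obtain ⟨z, hz, hzy⟩ := hc (U, n)
  rw [hΦ hzy] at hz
  have := (dvd_iff_forall_coeff _).1 hz k
  rwa [Nat.cast_pow] at this

end Compact

end IwasawaAlgebra

/-! ### The Iwasawa algebra of `ℤ_p` -/

/-- `ℤ_p` is completely integrally closed. -/
theorem PadicInt.dvd_of_forall_pow_dvd {p : ℕ} [Fact p.Prime] {a b f : ℤ_[p]} (hf : f ≠ 0)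
    (h : ∀ k, b ^ k ∣ f * a ^ k) : b ∣ a := by
  rcases eq_or_ne a 0 with rfl | ha
  · exact dvd_zero b
  rcases ValuationRing.dvd_total b a with hba | ⟨s, rfl⟩
  · exact hba
  have hs : IsUnit s := by
    by_contra hs
    obtain ⟨n, hn⟩ := FiniteMultiplicity.of_not_isUnit hs hf
    refine hn ((mul_dvd_mul_iff_right (pow_ne_zero (n + 1) ha)).1 ?_)
    rw [← mul_pow, mul_comm s a]
    exact h (n + 1)
  exact (associated_mul_unit_left a s hs).dvd

namespace IwasawaAlgebra

section Augmentation

variable {p : ℕ} [Fact p.Prime] {G : Type*} [Group G] [TopologicalSpace G]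

variable (p G) in
/-- The augmentation `Λ(G) → ℤ_p`. -/
def augmentation : IwasawaAlgebra p G →ₐ[ℤ_[p]] ℤ_[p] :=
  (MonoidAlgebra.lift ℤ_[p] ℤ_[p] _ 1).comp (proj (topOpen G))

@[simp]
theorem augmentation_of (g : G) : augmentation p G (of p g) = 1 := by
  simp [augmentation, proj_of]

theorem augmentation_eq_sum (U : OpenNormalSubgroup G) [Fintype (G ⧸ U.toSubgroup)]
    (x : IwasawaAlgebra p G) : augmentation p G x = ∑ k, (proj U x).coeff k := by
  have h1 : (MonoidAlgebra.lift ℤ_[p] ℤ_[p] _ 1 :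
        MonoidAlgebra ℤ_[p] (G ⧸ (topOpen G).toSubgroup) →ₐ[ℤ_[p]] ℤ_[p]).comp
      (MonoidAlgebra.mapDomainAlgHom ℤ_[p] ℤ_[p]
        (quotientTransition (U := U) (V := topOpen G) le_top)) =
      MonoidAlgebra.lift ℤ_[p] ℤ_[p] _ 1 := by
    ext k
    simp
  rw [augmentation, AlgHom.comp_apply, ← proj_compat x (U := U) (V := topOpen G) le_top,
    ← AlgHom.comp_apply, h1]
  conv_lhs => rw [← MonoidAlgebra.sum_single_coeff (proj U x)]
  rw [map_sum]
  simp

end Augmentation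

section OneVariable

variable {p : ℕ} [Fact p.Prime] {C : Type*} [Group C] [TopologicalSpace C]
  (ψ : C ≃ₜ* Multiplicative ℤ_[p])

/-- The topological generator of `C` that corresponds to `1 ∈ ℤ_p`. -/
def generator : C := ψ.symm (Multiplicative.ofAdd 1)

theorem toAdd_generator_pow (k : ℕ) : (ψ (generator ψ ^ k)).toAdd = (k : ℤ_[p]) := by
  rw [map_pow, toAdd_pow, generator, ContinuousMulEquiv.apply_symm_apply, toAdd_ofAdd,
    nsmul_eq_mul, mul_one]

/-- The open subgroup of `C` that corresponds to `p ^ m ℤ_p`. -/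
def powLevel (m : ℕ) : OpenNormalSubgroup C where
  carrier := {c | (p : ℤ_[p]) ^ m ∣ (ψ c).toAdd}
  mul_mem' {a b} ha hb := by
    change _ ∣ (ψ (a * b)).toAdd
    rw [map_mul, toAdd_mul]
    exact dvd_add ha hb
  one_mem' := by simp
  inv_mem' {a} ha := by
    change _ ∣ (ψ a⁻¹).toAdd
    rw [map_inv, toAdd_inv, dvd_neg]
    exact ha
  isOpen' := by
    have h2 : {c : C | (p : ℤ_[p]) ^ m ∣ (ψ c).toAdd} =
        (fun γ => (ψ γ).toAdd) ⁻¹' Metric.closedBall 0 ((p : ℝ) ^ (-(m : ℤ))) := by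
      ext γ
      simp [padicInt_dvd_iff_norm_le]
    change IsOpen {c : C | (p : ℤ_[p]) ^ m ∣ (ψ c).toAdd}
    rw [h2]
    refine (IsUltrametricDist.isOpen_closedBall _ (ne_of_gt ?_)).preimage
      (continuous_toAdd.comp ψ.continuous)
    exact zpow_pos (Nat.cast_pos.2 (Fact.out (p := p.Prime)).pos) _
  isNormal' := ⟨fun n hn g => by
    change _ ∣ (ψ (g * n * g⁻¹)).toAdd
    have h : ψ (g * n * g⁻¹) = ψ n := by
      rw [map_mul, map_mul, map_inv, mul_inv_cancel_comm]
    rw [h]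
    exact hn⟩

theorem mem_powLevel {m : ℕ} {c : C} :
    c ∈ (powLevel ψ m).toSubgroup ↔ (p : ℤ_[p]) ^ m ∣ (ψ c).toAdd := Iff.rfl

theorem exists_powLevel_le (V : OpenNormalSubgroup C) :
    ∃ m, (powLevel ψ m).toSubgroup ≤ V.toSubgroup := by
  have h1 : IsOpen ((fun z : ℤ_[p] => ψ.symm (Multiplicative.ofAdd z)) ⁻¹' (V : Set C)) :=
    V.isOpen.preimage (ψ.symm.continuous.comp continuous_ofAdd)
  obtain ⟨ε, hε, hball⟩ := Metric.isOpen_iff.1 h1 0 (by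
    change ψ.symm (Multiplicative.ofAdd 0) ∈ V
    rw [ofAdd_zero, map_one]
    exact one_mem V)
  obtain ⟨a, ha⟩ := PadicInt.exists_pow_neg_lt p hε
  refine ⟨a, fun γ hγ => ?_⟩
  rw [mem_powLevel, padicInt_dvd_iff_norm_le] at hγ
  have := hball (show (ψ γ).toAdd ∈ Metric.ball 0 ε by
    rw [Metric.mem_ball, dist_zero_right]
    exact hγ.trans_lt ha)
  simp only [Set.mem_preimage, ofAdd_toAdd, ContinuousMulEquiv.symm_apply_apply] at this
  exact this

theorem exists_mk_generator_pow_eq (U : OpenNormalSubgroup C) (k : C ⧸ U.toSubgroup) :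
    ∃ n : ℕ, ((generator ψ ^ n : C) : C ⧸ U.toSubgroup) = k := by
  induction k using QuotientGroup.induction_on with | H c =>
  obtain ⟨m, hm⟩ := exists_powLevel_le ψ U
  refine ⟨(ψ c).toAdd.appr m, (QuotientGroup.eq.2 (hm ?_)).symm⟩
  rw [mem_powLevel, map_mul, toAdd_mul, toAdd_generator_pow, map_inv, toAdd_inv, neg_add_eq_sub,
    dvd_sub_comm]
  exact Ideal.mem_span_singleton.1 (PadicInt.appr_spec m _)

theorem pow_dvd_card_quotient_powLevel (m : ℕ) :
    (p : ℤ_[p]) ^ m ∣ (Nat.card (C ⧸ (powLevel ψ m).toSubgroup) : ℤ_[p]) := by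
  rw [← toAdd_generator_pow ψ (Nat.card _), ← mem_powLevel, ← QuotientGroup.eq_one_iff,
    QuotientGroup.mk_pow]
  exact pow_card_eq_one'

/-- The variable `T = γ - 1` of the Iwasawa algebra of `ℤ_p`. -/
def variableT : IwasawaAlgebra p C := of p (generator ψ) - 1

theorem augmentation_variableT : augmentation p C (variableT ψ) = 0 := by
  simp [variableT]

variable [IsMulCommutative C]

/-- The variable is topologically nilpotent: `T ^ p ^ m ≡ γ ^ p ^ m - 1` modulo `p`. -/
theorem exists_dvd_proj_variableT_pow (U : OpenNormalSubgroup C) (n : ℕ) :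
    ∃ N, ∀ k, N ≤ k → ((p ^ n : ℕ) : MonoidAlgebra ℤ_[p] (C ⧸ U.toSubgroup)) ∣
      proj U (variableT ψ ^ k) := by
  obtain ⟨m, hm⟩ := exists_powLevel_le ψ U
  have h1 : (p : MonoidAlgebra ℤ_[p] (C ⧸ U.toSubgroup)) ∣ proj U (variableT ψ ^ p ^ m) := by
    obtain ⟨r, hr⟩ := exists_add_pow_prime_pow_eq (Fact.out (p := p.Prime)) (variableT ψ) 1 m
    have h2 : variableT ψ ^ p ^ m = of p (generator ψ ^ p ^ m) - 1 - p * (variableT ψ * r) := by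
      have h3 : variableT ψ + 1 = of p (generator ψ) := sub_add_cancel _ _
      rw [map_pow, ← h3, hr]
      simp only [one_pow, mul_one]
      ring
    have h4 : proj U (of p (generator ψ ^ p ^ m)) = 1 := by
      rw [proj_of, QuotientGroup.mk'_apply, (QuotientGroup.eq_one_iff _).2, map_one]
      apply hm
      rw [mem_powLevel, toAdd_generator_pow, Nat.cast_pow]
    rw [h2, map_sub, map_sub, h4, map_one, sub_self, zero_sub, map_mul, map_natCast, dvd_neg]
    exact dvd_mul_right _ _
  refine ⟨p ^ m * n, fun k hk => ?_⟩
  obtain ⟨c, hc⟩ := h1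
  obtain ⟨j, rfl⟩ := Nat.exists_eq_add_of_le hk
  rw [pow_add, map_mul, pow_mul, map_pow, hc, (Nat.cast_commute p c).mul_pow, Nat.cast_pow,
    mul_assoc]
  exact dvd_mul_right _ _

theorem eq_zero_of_forall_variableT_pow_dvd {x : IwasawaAlgebra p C}
    (hx : ∀ k, variableT ψ ^ k ∣ x) : x = 0 := by
  refine ext fun U => ?_
  ext k
  rw [map_zero]
  refine PadicInt.eq_zero_of_forall_pow_dvd fun n => ?_
  obtain ⟨N, hN⟩ := exists_dvd_proj_variableT_pow ψ U n
  obtain ⟨y, rfl⟩ := hx N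
  obtain ⟨c, hc⟩ := hN N le_rfl
  rw [map_mul, hc, mul_assoc, MonoidAlgebra.natCast_mul_coeff, Nat.cast_pow]
  exact dvd_mul_right _ _

section
variable [IsTopologicalGroup C] [CompactSpace C]

/-- If `T x = 0`, then the coefficients of `x` at each level are constant; the augmentation of `x`
is then divisible by the orders of all finite quotients. -/
theorem eq_zero_of_variableT_mul {x : IwasawaAlgebra p C} (hx : variableT ψ * x = 0) : x = 0 := by
  rw [variableT, sub_mul, one_mul, sub_eq_zero] at hx
  have hpow : ∀ n : ℕ, of p (generator ψ ^ n) * x = x := by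
    intro n
    induction n with
    | zero => simp
    | succ n ih => rw [pow_succ, map_mul, mul_assoc, hx, ih]
  have hconst : ∀ (U : OpenNormalSubgroup C) (c : C), coeff U x c = coeff U x 1 := by
    intro U c
    obtain ⟨n, hn⟩ := exists_mk_generator_pow_eq ψ U (c : C ⧸ U.toSubgroup)
    rw [coeff, ← hn]
    change coeff U x _ = _
    conv_lhs => rw [← hpow n, coeff_of_mul, inv_mul_cancel]
  have hsum : ∀ U : OpenNormalSubgroup C,
      augmentation p C x = Nat.card (C ⧸ U.toSubgroup) * coeff U x 1 := by
    intro U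
    have := Fintype.ofFinite (C ⧸ U.toSubgroup)
    rw [augmentation_eq_sum U, Nat.card_eq_fintype_card, ← nsmul_eq_mul, ← Finset.card_univ,
      ← Finset.sum_const]
    refine Finset.sum_congr rfl fun k _ => ?_
    induction k using QuotientGroup.induction_on with | H c => exact hconst U c
  have haug : augmentation p C x = 0 := by
    refine PadicInt.eq_zero_of_forall_pow_dvd fun m => ?_
    rw [hsum (powLevel ψ m)]
    exact (pow_dvd_card_quotient_powLevel ψ m).mul_right _
  refine ext_coeff fun U c => ?_
  have h0 := hsum U
  rw [haug, eq_comm, mul_eq_zero, Nat.cast_eq_zero] at h0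
  rw [hconst, h0.resolve_left Nat.card_pos.ne']
  simp [coeff]

/-- The kernel of the augmentation is generated by `T`: this holds at every finite level, where the
quotient group is cyclic. -/
theorem exists_variableT_mul_eq {x : IwasawaAlgebra p C} (hx : augmentation p C x = 0) :
    ∃ y, variableT ψ * y = x := by
  refine exists_mul_eq_of_forall_proj _ _ fun U n => ?_
  have := Fintype.ofFinite (C ⧸ U.toSubgroup)
  choose e he using exists_mk_generator_pow_eq ψ U
  have hT : ∀ n : ℕ, variableT ψ ∣ of p (generator ψ ^ n) - 1 := by
    intro n
    rw [map_pow]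
    exact sub_one_dvd_pow_sub_one _ n
  choose z hz using hT
  refine ⟨∑ k, (proj U x).coeff k • z (e k), ?_⟩
  convert dvd_zero _
  rw [map_sub, sub_eq_zero, Finset.mul_sum]
  simp only [mul_smul_comm, ← hz]
  rw [map_sum]
  simp only [map_smul, map_sub, proj_of, QuotientGroup.mk'_apply, he, map_one, smul_sub,
    Finset.sum_sub_distrib, ← Finset.sum_smul]
  rw [← augmentation_eq_sum U, hx, zero_smul, sub_zero]
  conv_rhs => rw [← MonoidAlgebra.sum_single_coeff (proj U x)]
  simp

theorem augmentation_eq_zero_iff {x : IwasawaAlgebra p C} :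
    augmentation p C x = 0 ↔ variableT ψ ∣ x := by
  constructor
  · intro h
    obtain ⟨y, hy⟩ := exists_variableT_mul_eq ψ h
    exact ⟨y, hy.symm⟩
  · rintro ⟨y, rfl⟩
    rw [map_mul, augmentation_variableT, zero_mul]

theorem exists_eq_variableT_pow_mul {x : IwasawaAlgebra p C} (hx : x ≠ 0) :
    ∃ n u, x = variableT ψ ^ n * u ∧ augmentation p C u ≠ 0 := by
  classical
  have h : ∃ k, ¬ variableT ψ ^ k ∣ x := by
    by_contra! h
    exact hx (eq_zero_of_forall_variableT_pow_dvd ψ h)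
  have h1 : Nat.find h ≠ 0 := by
    intro h0
    have := Nat.find_spec h
    rw [h0, pow_zero] at this
    exact this (one_dvd _)
  obtain ⟨n, hn⟩ := Nat.exists_eq_succ_of_ne_zero h1
  obtain ⟨u, hu⟩ := not_not.1 (Nat.find_min h (m := n) (by omega))
  refine ⟨n, u, hu, fun h0 => Nat.find_spec h ?_⟩
  rw [augmentation_eq_zero_iff ψ] at h0
  obtain ⟨v, rfl⟩ := h0
  rw [hn]
  exact ⟨v, by rw [hu, Nat.succ_eq_add_one, pow_succ, mul_assoc]⟩

include ψ in
theorem isDomain_of_padic : IsDomain (IwasawaAlgebra p C) := by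
  have : Nontrivial (IwasawaAlgebra p C) := ⟨0, 1, fun h => by
    have := congrArg (augmentation p C) h
    rw [map_zero, map_one] at this
    exact zero_ne_one this⟩
  have hT : ∀ (n : ℕ) (x : IwasawaAlgebra p C), variableT ψ ^ n * x = 0 → x = 0 := by
    intro n
    induction n with
    | zero => intro x hx; simpa using hx
    | succ n ih =>
      intro x hx
      rw [pow_succ, mul_assoc] at hx
      exact eq_zero_of_variableT_mul ψ (ih _ hx)
  have : NoZeroDivisors (IwasawaAlgebra p C) := ⟨fun {a b} hab => by
    by_contra! h
    obtain ⟨n, u, rfl, hu⟩ := exists_eq_variableT_pow_mul ψ h.1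
    obtain ⟨m, v, rfl, hv⟩ := exists_eq_variableT_pow_mul ψ h.2
    have h1 : variableT ψ ^ (n + m) * (u * v) = 0 := by rw [← hab]; ring
    have h2 := congrArg (augmentation p C) (hT _ _ h1)
    rw [map_mul, map_zero, mul_eq_zero] at h2
    exact h2.elim hu hv⟩
  exact NoZeroDivisors.to_isDomain _

theorem prime_variableT : Prime (variableT ψ) := by
  have := isDomain_of_padic ψ
  refine ⟨fun h => ?_, fun h => ?_, fun a b h => ?_⟩
  · exact one_ne_zero (eq_zero_of_variableT_mul ψ (x := 1) (by rw [h, zero_mul]))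
  · have := h.map (augmentation p C)
    rw [augmentation_variableT] at this
    exact not_isUnit_zero this
  · rw [← augmentation_eq_zero_iff] at h ⊢
    rw [← augmentation_eq_zero_iff]
    rwa [map_mul, mul_eq_zero] at h

/-- Successive approximation of the quotient `a / b` modulo powers of `T`, for an almost integral
fraction `a / b` with `T ∤ b`. -/
theorem exists_eq_mul_add_of_forall_pow_dvd {a b f : IwasawaAlgebra p C}
    (hb : augmentation p C b ≠ 0) (hf : augmentation p C f ≠ 0) (h : ∀ k, b ^ k ∣ f * a ^ k)
    (n : ℕ) : ∃ q a', a = b * q + variableT ψ ^ n * a' ∧ ∀ k, b ^ k ∣ f * a' ^ k := by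
  have := isDomain_of_padic ψ
  induction n with
  | zero => exact ⟨0, a, by simp, h⟩
  | succ n ih =>
    obtain ⟨q, a', rfl, ha'⟩ := ih
    have h1 : augmentation p C b ∣ augmentation p C a' := by
      refine PadicInt.dvd_of_forall_pow_dvd hf fun k => ?_
      rw [← map_pow, ← map_pow, ← map_mul]
      exact map_dvd _ (ha' k)
    obtain ⟨c, hc⟩ := h1
    have h2 : augmentation p C (a' - b * algebraMap _ _ c) = 0 := by
      rw [map_sub, map_mul, AlgHom.commutes, hc]
      exact sub_self _
    rw [augmentation_eq_zero_iff ψ] at h2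
    obtain ⟨a₁, ha₁⟩ := h2
    refine ⟨q + variableT ψ ^ n * algebraMap _ _ c, a₁, ?_, fun k => ?_⟩
    · rw [sub_eq_iff_eq_add] at ha₁
      rw [ha₁]; ring
    · have h3 : b ^ k ∣ f * (variableT ψ * a₁) ^ k := by
        rw [← ha₁, sub_eq_add_neg, add_pow, Finset.mul_sum]
        refine Finset.dvd_sum fun i hi => ?_
        have hik : i ≤ k := Nat.lt_succ_iff.1 (Finset.mem_range.1 hi)
        have h4 : f * (a' ^ i * (-(b * algebraMap _ _ c)) ^ (k - i) *
            (k.choose i : IwasawaAlgebra p C)) =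
            (f * a' ^ i) * b ^ (k - i) * ((-algebraMap _ _ c) ^ (k - i) * k.choose i) := by
          rw [← mul_neg, mul_pow]; ring
        rw [h4]
        refine Dvd.dvd.mul_right ?_ _
        conv_lhs => rw [← Nat.add_sub_cancel' hik, pow_add]
        exact mul_dvd_mul (ha' i) dvd_rfl
      obtain ⟨d, hd⟩ := h3
      have h5 : variableT ψ ^ k ∣ d := by
        refine (prime_variableT ψ).pow_dvd_of_dvd_mul_left k (a := b ^ k) ?_
          ⟨f * a₁ ^ k, by rw [← hd]; ring⟩
        rw [← augmentation_eq_zero_iff, map_pow]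
        exact pow_ne_zero k hb
      obtain ⟨e, rfl⟩ := h5
      refine ⟨e, mul_left_cancel₀ (pow_ne_zero k (prime_variableT ψ).ne_zero) ?_⟩
      calc _ = f * (variableT ψ * a₁) ^ k := by ring
        _ = _ := by rw [hd]; ring

include ψ in
theorem dvd_of_forall_pow_dvd_of_augmentation {a b f : IwasawaAlgebra p C}
    (hb : augmentation p C b ≠ 0) (hf : augmentation p C f ≠ 0) (h : ∀ k, b ^ k ∣ f * a ^ k) :
    b ∣ a := by
  suffices ∃ y, b * y = a by
    obtain ⟨y, hy⟩ := this
    exact ⟨y, hy.symm⟩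
  refine exists_mul_eq_of_forall_proj _ _ fun U n => ?_
  obtain ⟨N, hN⟩ := exists_dvd_proj_variableT_pow ψ U n
  obtain ⟨q, a', ha, -⟩ := exists_eq_mul_add_of_forall_pow_dvd ψ hb hf h N
  refine ⟨q, ?_⟩
  have h1 : b * q - a = variableT ψ ^ N * (-a') := by rw [ha]; ring
  rw [h1, map_mul]
  exact (hN N le_rfl).mul_right _

include ψ in
/-- The Iwasawa algebra of `ℤ_p` is completely integrally closed. -/
theorem dvd_of_forall_pow_dvd {a b f : IwasawaAlgebra p C}
    (hb : b ≠ 0) (hf : f ≠ 0) (h : ∀ k, b ^ k ∣ f * a ^ k) : b ∣ a := by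
  have := isDomain_of_padic ψ
  have hT := prime_variableT ψ
  rcases eq_or_ne a 0 with rfl | ha
  · exact dvd_zero _
  obtain ⟨i, b, rfl, hb'⟩ := exists_eq_variableT_pow_mul ψ hb
  obtain ⟨j, f, rfl, hf'⟩ := exists_eq_variableT_pow_mul ψ hf
  obtain ⟨l, a, rfl, ha'⟩ := exists_eq_variableT_pow_mul ψ ha
  have hil : i ≤ l := by
    have h1 : variableT ψ ^ (i * (j + 1)) ∣ f * a ^ (j + 1) * variableT ψ ^ (j + l * (j + 1)) := by
      refine dvd_trans ⟨b ^ (j + 1), ?_⟩ ((h (j + 1)).trans (dvd_of_eq ?_)) <;> ring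
    have h2 := hT.pow_dvd_of_dvd_mul_left _ (by
      rw [← augmentation_eq_zero_iff, map_mul, map_pow]
      exact mul_ne_zero hf' (pow_ne_zero _ ha')) h1
    rw [pow_dvd_pow_iff hT.ne_zero hT.not_isUnit] at h2
    by_contra! hli
    have : (l + 1) * (j + 1) ≤ i * (j + 1) := Nat.mul_le_mul_right _ hli
    nlinarith
  obtain ⟨m, rfl⟩ := Nat.exists_eq_add_of_le hil
  rw [pow_add, mul_assoc]
  refine mul_dvd_mul_left _ (dvd_of_forall_pow_dvd_of_augmentation ψ hb' hf' fun k => ?_)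
  obtain ⟨c, hc⟩ := h k
  have h3 : variableT ψ ^ j * (f * (variableT ψ ^ m * a) ^ k) = b ^ k * c := by
    refine mul_left_cancel₀ (pow_ne_zero (i * k) hT.ne_zero) ?_
    calc _ = variableT ψ ^ j * f * (variableT ψ ^ (i + m) * a) ^ k := by ring
      _ = _ := by rw [hc]; ring
  have h4 : variableT ψ ^ j ∣ c := by
    refine hT.pow_dvd_of_dvd_mul_left j (a := b ^ k) ?_ ⟨_, h3.symm⟩
    rw [← augmentation_eq_zero_iff, map_pow]
    exact pow_ne_zero k hb'
  obtain ⟨e, rfl⟩ := h4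
  refine ⟨e, mul_left_cancel₀ (pow_ne_zero j hT.ne_zero) ?_⟩
  rw [h3]; ring

include ψ in
theorem isIntegrallyClosed_of_padic : IsIntegrallyClosed (IwasawaAlgebra p C) := by
  have := isDomain_of_padic ψ
  rw [isIntegrallyClosed_iff (FractionRing (IwasawaAlgebra p C))]
  intro x hx
  obtain ⟨f, hf, hfx⟩ := hx.isAlmostIntegral
  obtain ⟨a, b, hb, rfl⟩ := IsFractionRing.div_surjective (A := IwasawaAlgebra p C) x
  have hb0 := nonZeroDivisors.ne_zero hb
  have hinj := IsFractionRing.injective (IwasawaAlgebra p C) (FractionRing (IwasawaAlgebra p C))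
  have hb1 : algebraMap _ (FractionRing (IwasawaAlgebra p C)) b ≠ 0 := by
    rwa [Ne, map_eq_zero_iff _ hinj]
  obtain ⟨c, rfl⟩ := dvd_of_forall_pow_dvd ψ hb0 (nonZeroDivisors.ne_zero hf) (a := a) fun k => by
    obtain ⟨c, hc⟩ := hfx k
    refine ⟨c, hinj ?_⟩
    rw [map_mul, map_mul, map_pow, map_pow, show algebraMap _ (FractionRing _) c = _ from hc,
      Algebra.smul_def, div_pow]
    field_simp
  exact ⟨c, by rw [map_mul]; field_simp⟩

end

end OneVariable

end IwasawaAlgebra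

/-! ### Open subgroups of `ℤ_p` -/

/-- An open subgroup of a group isomorphic to `ℤ_p` is isomorphic to `ℤ_p`. -/
theorem nonempty_continuousMulEquiv_padicInt_of_isOpen {p : ℕ} [Fact p.Prime] {G : Type*} [Group G]
    [TopologicalSpace G] [T2Space G] {Γ Γ₀ : Subgroup G} (ψ : Γ ≃ₜ* Multiplicative ℤ_[p])
    (h : Γ₀ ≤ Γ) (ho : IsOpen ((Γ₀.subgroupOf Γ : Subgroup Γ) : Set Γ)) :
    Nonempty (Γ₀ ≃ₜ* Multiplicative ℤ_[p]) := by
  obtain ⟨a, ha⟩ := exists_padicLevel_le ψ _ ho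
  have hmem : ∀ γ : Γ, (p : ℤ_[p]) ^ a ∣ (ψ γ).toAdd → (γ : G) ∈ Γ₀ := fun γ hγ =>
    ha γ ((coe_mem_padicLevel_iff ψ γ).2 hγ)
  -- The image of `Γ₀` in `ℤ_p` is an ideal, because `ℕ` is dense in `ℤ_p`.
  let I : Ideal ℤ_[p] :=
    { carrier := {z | (ψ.symm (Multiplicative.ofAdd z) : G) ∈ Γ₀}
      add_mem' := by
        intro x y hx hy
        simp only [Set.mem_ofPred_eq, ofAdd_add, map_mul, Subgroup.coe_mul] at hx hy ⊢
        exact Γ₀.mul_mem hx hy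
      zero_mem' := by simp
      smul_mem' := by
        intro c x hx
        obtain ⟨d, hd⟩ := Ideal.mem_span_singleton.1 (PadicInt.appr_spec a c)
        have h1 : c • x = (c.appr a) • x + (p : ℤ_[p]) ^ a * (d * x) := by
          rw [smul_eq_mul, nsmul_eq_mul, ← mul_assoc, ← hd]; ring
        change (ψ.symm (Multiplicative.ofAdd (c • x)) : G) ∈ Γ₀
        rw [h1, ofAdd_add, map_mul, ofAdd_nsmul, map_pow, Subgroup.coe_mul, Subgroup.coe_pow]
        refine Γ₀.mul_mem (Γ₀.pow_mem hx _) (hmem _ ?_)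
        simp }
  have hI : ∀ z, z ∈ I ↔ (ψ.symm (Multiplicative.ofAdd z) : G) ∈ Γ₀ := fun z => Iff.rfl
  have hpI : (p : ℤ_[p]) ^ a ∈ I := hmem _ (by simp)
  have hp0 : ∀ n, (p : ℤ_[p]) ^ n ≠ 0 := fun n => pow_ne_zero n PadicInt.prime_p.ne_zero
  have hbot : I ≠ ⊥ := fun hb => hp0 a (by rwa [hb, Ideal.mem_bot] at hpI)
  obtain ⟨n, hn⟩ := PadicInt.ideal_eq_span_pow_p hbot
  have hI' : ∀ z, (p : ℤ_[p]) ^ n ∣ z ↔ (ψ.symm (Multiplicative.ofAdd z) : G) ∈ Γ₀ := fun z => by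
    rw [← hI, hn, Ideal.mem_span_singleton]
  let f : Multiplicative ℤ_[p] →* Γ₀ :=
    { toFun := fun z => ⟨ψ.symm (Multiplicative.ofAdd ((p : ℤ_[p]) ^ n * z.toAdd)),
        (hI' _).1 (dvd_mul_right _ _)⟩
      map_one' := by simp
      map_mul' := fun x y => by
        apply Subtype.ext
        simp [mul_add, ofAdd_add] }
  have hf : Function.Bijective f := by
    constructor
    · intro x y hxy
      have h2 : (p : ℤ_[p]) ^ n * x.toAdd = (p : ℤ_[p]) ^ n * y.toAdd :=
        Multiplicative.ofAdd.injective (ψ.symm.injective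
          (Subtype.ext (show ((ψ.symm _ : Γ) : G) = ((ψ.symm _ : Γ) : G) from
            congrArg (Subtype.val : Γ₀ → G) hxy)))
      exact Multiplicative.toAdd.injective (mul_left_cancel₀ (hp0 n) h2)
    · intro x
      obtain ⟨c, hc⟩ := (hI' (ψ ⟨x, h x.2⟩).toAdd).2 (by simp)
      refine ⟨Multiplicative.ofAdd c, Subtype.ext ?_⟩
      change (ψ.symm (Multiplicative.ofAdd ((p : ℤ_[p]) ^ n * c)) : G) = x
      rw [← hc]
      simp
  have hcont : Continuous f := by
    refine Continuous.subtype_mk (continuous_subtype_val.comp (ψ.symm.continuous.comp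
      (continuous_ofAdd.comp (continuous_const.mul continuous_toAdd)))) _
  have : CompactSpace (Multiplicative ℤ_[p]) := inferInstanceAs (CompactSpace ℤ_[p])
  let e := MulEquiv.ofBijective f hf
  let e' := Continuous.homeoOfEquivCompactToT2 (f := e.toEquiv) hcont
  exact ⟨(⟨e, e'.continuous_toFun, e'.continuous_invFun⟩ :
    Multiplicative ℤ_[p] ≃ₜ* Γ₀).symm⟩

/-! ### Integrality and traces -/

open Polynomial in
theorem aeval_scaleRoots_smul {R A : Type*} [CommRing R] [Ring A] [Algebra R A] (P : R[X]) (r : R)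
    (x : A) : aeval (r • x) (P.scaleRoots r) = r ^ P.natDegree • aeval x P := by
  rw [aeval_eq_sum_range, aeval_eq_sum_range, natDegree_scaleRoots, Finset.smul_sum]
  refine Finset.sum_congr rfl fun i hi => ?_
  rw [coeff_scaleRoots, _root_.smul_pow, smul_smul, smul_smul, mul_assoc, ← pow_add,
    Nat.sub_add_cancel (Nat.lt_succ_iff.1 (Finset.mem_range.1 hi)), mul_comm]

/-- If `M / r` is integral over the integrally closed domain `R`, then `r` divides the trace of
the matrix `M`, because the eigenvalues of `M / r` are integral. -/
theorem Matrix.dvd_trace_of_aeval_scaleRoots {R n : Type*} [CommRing R] [IsDomain R]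
    [IsIntegrallyClosed R] [Fintype n] [DecidableEq n] (M : Matrix n n R) {r : R} (hr : r ≠ 0)
    {P : Polynomial R} (hP : P.Monic) (h : Polynomial.aeval M (P.scaleRoots r) = 0) :
    r ∣ M.trace := by
  let F := FractionRing R
  let K := AlgebraicClosure F
  have hinj : Function.Injective (algebraMap R K) := by
    rw [IsScalarTower.algebraMap_eq R F K]
    exact (algebraMap F K).injective.comp (IsFractionRing.injective R F)
  have hrK : algebraMap R K r ≠ 0 := by rwa [Ne, map_eq_zero_iff _ hinj]
  set N : Matrix n n K := (algebraMap R K).mapMatrix M with hN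
  have hroot : ∀ μ ∈ N.charpoly.roots, IsIntegral R (μ / algebraMap R K r) := by
    intro μ hμ
    have h1 : μ ∈ spectrum K N := by
      rw [Matrix.mem_spectrum_iff_isRoot_charpoly]
      exact (Polynomial.mem_roots'.1 hμ).2
    have h2 : Polynomial.aeval N ((P.scaleRoots r).map (algebraMap R K)) = 0 := by
      rw [Polynomial.aeval_map_algebraMap]
      have := congrArg ((Algebra.ofId R K).mapMatrix (m := n)) h
      rw [← Polynomial.aeval_algHom_apply, map_zero] at this
      exact this
    have h3 := spectrum.subset_polynomial_aeval N ((P.scaleRoots r).map (algebraMap R K))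
      ⟨μ, h1, rfl⟩
    rw [h2] at h3
    have hne : Nontrivial (Matrix n n K) := by
      by_contra hne
      rw [not_nontrivial_iff_subsingleton] at hne
      rw [spectrum.of_subsingleton] at h1
      exact h1
    rw [spectrum.zero_eq, Set.mem_singleton_iff] at h3
    refine ⟨P, hP, ?_⟩
    have h4 : Polynomial.aeval (r • (μ / algebraMap R K r)) (P.scaleRoots r) = 0 := by
      rw [Algebra.smul_def, mul_div_cancel₀ _ hrK]
      simpa [Polynomial.eval_map_algebraMap] using h3
    rw [aeval_scaleRoots_smul, Algebra.smul_def, map_pow] at h4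
    exact (mul_eq_zero.1 h4).resolve_left (pow_ne_zero _ hrK)
  have htr : IsIntegral R (algebraMap R K M.trace / algebraMap R K r) := by
    have h1 : algebraMap R K M.trace = N.trace := by
      simp [hN, Matrix.trace]
    rw [h1, Matrix.trace_eq_sum_roots_charpoly, div_eq_mul_inv, ← Multiset.map_id' N.charpoly.roots,
      ← Multiset.sum_map_mul_right]
    refine IsIntegral.multiset_sum fun x hx => ?_
    obtain ⟨μ, hμ, rfl⟩ := Multiset.mem_map.1 hx
    rw [← div_eq_mul_inv]
    exact hroot μ hμ
  have h5 : IsIntegral R (algebraMap R F M.trace / algebraMap R F r) := by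
    rw [← isIntegral_algebraMap_iff (algebraMap F K).injective, map_div₀,
      ← IsScalarTower.algebraMap_apply, ← IsScalarTower.algebraMap_apply]
    exact htr
  obtain ⟨y, hy⟩ := IsIntegrallyClosed.isIntegral_iff.1 h5
  have hrF : algebraMap R F r ≠ 0 := by rwa [Ne, map_eq_zero_iff _ (IsFractionRing.injective R F)]
  refine ⟨y, IsFractionRing.injective R F ?_⟩
  rw [map_mul, hy, mul_div_cancel₀ _ hrF]

/-- Every element of an order is integral. -/
theorem IsOrderIn.exists_monic_aeval_eq_zero {R A : Type*} [CommRing R] [Ring A] [Algebra R A]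
    {f : A} {O : Submodule R A} (hO : IsOrderIn R f O) {x : A} (hx : x ∈ O) :
    ∃ P : Polynomial R, P.Monic ∧ Polynomial.aeval x P = 0 := by
  have : Module.Finite R O := Module.Finite.iff_fg.2 hO.fg
  let L : Module.End R O := (LinearMap.mulLeft R x).restrict (p := O) (q := O)
    fun y hy => hO.mul_mem x hx y hy
  have hL : ∀ (Q : Polynomial R) (v : O),
      ((Polynomial.aeval L Q v : O) : A) = Polynomial.aeval x Q * v := by
    intro Q v
    induction Q using Polynomial.induction_on' with
    | add P Q hP hQ => simp [hP, hQ, add_mul]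
    | monomial n r =>
      rw [Polynomial.aeval_monomial, Polynomial.aeval_monomial, ← Algebra.smul_def,
        ← Algebra.smul_def, smul_mul_assoc, LinearMap.smul_apply, Submodule.coe_smul]
      congr 1
      induction n with
      | zero => simp
      | succ n ih =>
        rw [pow_succ', pow_succ', Module.End.mul_apply, mul_assoc, ← ih]
        rfl
  obtain ⟨P, hP, hPL⟩ := LinearMap.exists_monic_and_aeval_eq_zero R L
  refine ⟨P * Polynomial.X, hP.mul Polynomial.monic_X, ?_⟩
  have := hL P ⟨x, hx⟩
  rw [hPL] at this
  rw [map_mul, Polynomial.aeval_X, ← this]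
  rfl

/-! ### The Iwasawa algebra as an algebra over the Iwasawa algebra of a central open subgroup -/

section FiniteLevel

variable {R K L : Type*} [CommRing R] [Group K] [Group L] (ι : K →* L)
  (hι : Function.Injective ι)

/-- The restriction of the coefficients of an element of `R[L]` to a subgroup `K` of `L`. -/
def MonoidAlgebra.restrictCoeff : MonoidAlgebra R L →ₗ[R] MonoidAlgebra R K where
  toFun y := .ofCoeff (Finsupp.comapDomain ι y.coeff hι.injOn)
  map_add' x y := by ext k; simp
  map_smul' r x := by ext k; simp

theorem MonoidAlgebra.coeff_restrictCoeff (y : MonoidAlgebra R L) (k : K) :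
    (MonoidAlgebra.restrictCoeff ι hι y).coeff k = y.coeff (ι k) := rfl

theorem MonoidAlgebra.restrictCoeff_mapDomain_mul (a : MonoidAlgebra R K) (y : MonoidAlgebra R L) :
    MonoidAlgebra.restrictCoeff ι hι (MonoidAlgebra.mapDomainAlgHom R R ι a * y) =
      a * MonoidAlgebra.restrictCoeff ι hι y := by
  induction a using MonoidAlgebra.induction_linear with
  | zero => simp
  | add a b ha hb => rw [map_add, add_mul, map_add, ha, hb, add_mul]
  | single m r =>
    ext k
    rw [MonoidAlgebra.coeff_restrictCoeff, MonoidAlgebra.mapDomainAlgHom_apply,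
      MonoidAlgebra.mapDomain_single, MonoidAlgebra.coeff_single_mul_apply,
      MonoidAlgebra.coeff_single_mul_apply, MonoidAlgebra.coeff_restrictCoeff, map_mul ι, map_inv ι]

end FiniteLevel

namespace IwasawaAlgebra

section Trace

variable {p : ℕ} [Fact p.Prime] {G : Type*} [Group G] [TopologicalSpace G]
  {G₀ : Subgroup G} [hG₀ : Fact (G₀ ≤ Subgroup.center G)]
  (ho : IsOpen (G₀ : Set G))

/-- An open subgroup of a central open subgroup, as an open normal subgroup of the whole group. -/
def mapOpenNormal (ho : IsOpen (G₀ : Set G)) (W : OpenNormalSubgroup G₀) :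
    OpenNormalSubgroup G where
  toSubgroup := W.toSubgroup.map G₀.subtype
  isOpen' := ho.isOpenMap_subtype_val _ W.isOpen
  isNormal' := ⟨by
    rintro _ ⟨w, hw, rfl⟩ g
    have := Subgroup.mem_center_iff.1 (hG₀.1 w.2) g
    refine ⟨w, hw, ?_⟩
    change (w : G) = g * w * g⁻¹
    rw [this, mul_inv_cancel_right]⟩

theorem mem_mapOpenNormal {W : OpenNormalSubgroup G₀} {z : G₀} :
    (z : G) ∈ (mapOpenNormal ho W).toSubgroup ↔ z ∈ W.toSubgroup := by
  constructor
  · rintro ⟨w, hw, hwz⟩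
    rwa [← Subtype.ext (show (w : G) = z from hwz)]
  · exact fun hz => ⟨z, hz, rfl⟩

theorem mapOpenNormal_le (W : OpenNormalSubgroup G₀) : (mapOpenNormal ho W).toSubgroup ≤ G₀ := by
  rintro _ ⟨w, -, rfl⟩
  exact w.2

/-- The homomorphism `G₀/W → G/W`. -/
def levelInclusion (W : OpenNormalSubgroup G₀) :
    G₀ ⧸ W.toSubgroup →* G ⧸ (mapOpenNormal ho W).toSubgroup :=
  QuotientGroup.map _ _ G₀.subtype fun _ hz => (mem_mapOpenNormal ho).2 hz

theorem levelInclusion_mk (W : OpenNormalSubgroup G₀) (z : G₀) :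
    levelInclusion ho W (z : G₀ ⧸ W.toSubgroup) = ((z : G) : G ⧸ (mapOpenNormal ho W).toSubgroup) :=
  rfl

theorem levelInclusion_injective (W : OpenNormalSubgroup G₀) :
    Function.Injective (levelInclusion ho W) := by
  intro a b hab
  induction a using QuotientGroup.induction_on with | H a =>
  induction b using QuotientGroup.induction_on with | H b =>
  rw [levelInclusion_mk, levelInclusion_mk, QuotientGroup.eq] at hab
  exact QuotientGroup.eq.2 ((mem_mapOpenNormal ho).1 hab)

theorem proj_algebraMap (W : OpenNormalSubgroup G₀) (s : IwasawaAlgebra p G₀) :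
    proj (mapOpenNormal ho W) (algebraMap _ (IwasawaAlgebra p G) s) =
      MonoidAlgebra.mapDomainAlgHom ℤ_[p] ℤ_[p] (levelInclusion ho W) (proj W s) := by
  have hle : W.toSubgroup ≤ (comapOpenNormal (inclusionHom G₀) (mapOpenNormal ho W)).toSubgroup :=
    fun z hz => (mem_mapOpenNormal ho).2 hz
  change proj (mapOpenNormal ho W) (map (inclusionHom G₀) s) = _
  rw [proj_map, ← proj_compat s hle, ← AlgHom.comp_apply, ← MonoidAlgebra.mapDomainAlgHom_comp]
  have h : (quotientMap (inclusionHom G₀) (mapOpenNormal ho W)).comp (quotientTransition hle) =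
      levelInclusion ho W := QuotientGroup.monoidHom_ext _ rfl
  rw [h]

variable [IsTopologicalGroup G] [CompactSpace G]

theorem exists_restrict (x : IwasawaAlgebra p G) :
    ∃ y : IwasawaAlgebra p G₀, ∀ W, proj W y = MonoidAlgebra.restrictCoeff (levelInclusion ho W)
      (levelInclusion_injective ho W) (proj (mapOpenNormal ho W) x) := by
  classical
  refine exists_proj_eq _ fun U V h => ?_
  have hUV : (mapOpenNormal ho U).toSubgroup ≤ (mapOpenNormal ho V).toSubgroup :=
    Subgroup.map_mono h
  have hcG : CompactSpace G₀ := isCompact_iff_compactSpace.1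
    (G₀.isClosed_of_isOpen ho).isCompact
  have := Fintype.ofFinite (G₀ ⧸ U.toSubgroup)
  have := Fintype.ofFinite (G ⧸ (mapOpenNormal ho U).toSubgroup)
  ext k
  rw [MonoidAlgebra.coeff_mapDomain_eq_sum, MonoidAlgebra.coeff_restrictCoeff, ← proj_compat x hUV,
    MonoidAlgebra.coeff_mapDomain_eq_sum]
  refine Finset.sum_bij (fun j _ => levelInclusion ho U j) ?_ ?_ ?_ ?_
  · intro j hj
    simp only [Finset.mem_filter, Finset.mem_univ, true_and] at hj ⊢
    rw [← hj]
    induction j using QuotientGroup.induction_on with | H z => rfl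
  · intro a _ b _ hab
    exact levelInclusion_injective ho U hab
  · intro j hj
    simp only [Finset.mem_filter, Finset.mem_univ, true_and] at hj
    induction j using QuotientGroup.induction_on with | H g =>
    induction k using QuotientGroup.induction_on with | H z =>
    have h1 : g⁻¹ * z ∈ (mapOpenNormal ho V).toSubgroup := QuotientGroup.eq.1 hj
    have h2 : g ∈ G₀ := by
      have := G₀.mul_mem z.2 (G₀.inv_mem (mapOpenNormal_le ho V h1))
      simpa using this
    refine ⟨((⟨g, h2⟩ : G₀) : G₀ ⧸ U.toSubgroup), ?_, rfl⟩
    simp only [Finset.mem_filter, Finset.mem_univ, true_and]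
    exact QuotientGroup.eq.2 ((mem_mapOpenNormal ho).1 h1)
  · intro j _
    rfl

/-- The restriction `Λ(G) → Λ(G₀)` of the coefficients to a central open subgroup `G₀`. -/
def restrict : IwasawaAlgebra p G →ₗ[IwasawaAlgebra p G₀] IwasawaAlgebra p G₀ where
  toFun x := (exists_restrict ho x).choose
  map_add' x y := by
    refine ext fun W => ?_
    rw [map_add, (exists_restrict ho _).choose_spec, (exists_restrict ho _).choose_spec,
      (exists_restrict ho _).choose_spec, map_add, map_add]
  map_smul' s x := by
    refine ext fun W => ?_
    rw [RingHom.id_apply, smul_eq_mul, map_mul, (exists_restrict ho _).choose_spec,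
      (exists_restrict ho _).choose_spec, Algebra.smul_def, map_mul, proj_algebraMap,
      MonoidAlgebra.restrictCoeff_mapDomain_mul]

theorem proj_restrict (x : IwasawaAlgebra p G) (W : OpenNormalSubgroup G₀) :
    proj W (restrict ho x) = MonoidAlgebra.restrictCoeff (levelInclusion ho W)
      (levelInclusion_injective ho W) (proj (mapOpenNormal ho W) x) :=
  (exists_restrict ho x).choose_spec W

theorem coeff_restrict (x : IwasawaAlgebra p G) (W : OpenNormalSubgroup G₀) (z : G₀) :
    coeff W (restrict ho x) z = coeff (mapOpenNormal ho W) x z := by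
  rw [coeff, proj_restrict, MonoidAlgebra.coeff_restrictCoeff]
  rfl

/-- Restriction to a central subgroup is a trace form. -/
theorem restrict_mul_comm (x y : IwasawaAlgebra p G) :
    restrict ho (x * y) = restrict ho (y * x) := by
  refine ext_coeff fun W z => ?_
  rw [coeff_restrict, coeff_restrict]
  set U := mapOpenNormal ho W
  have hz : ∀ x : IwasawaAlgebra p G, coeff U x z = (proj U (x * of p (z : G)⁻¹)).coeff 1 := by
    intro x
    change _ = coeff U _ 1
    rw [coeff_mul_of]
    simp
  have hcomm : y * of p (z : G)⁻¹ = of p (z : G)⁻¹ * y := by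
    have h1 : of p (z : G)⁻¹ = algebraMap (IwasawaAlgebra p G₀) (IwasawaAlgebra p G) (of p z⁻¹) :=
      (map_of (inclusionHom G₀) z⁻¹).symm
    rw [h1]
    exact (Algebra.commutes _ _).symm
  rw [hz, hz, mul_assoc, map_mul, MonoidAlgebra.coeff_one_mul_comm, ← map_mul, hcomm, mul_assoc,
    map_mul, MonoidAlgebra.coeff_one_mul_comm, ← map_mul]

omit [IsTopologicalGroup G] [CompactSpace G] in
open scoped Classical in
theorem coeff_algebraMap (W : OpenNormalSubgroup G₀) (s : IwasawaAlgebra p G₀) (g : G) :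
    coeff (mapOpenNormal ho W) (algebraMap _ (IwasawaAlgebra p G) s) g =
      if h : g ∈ G₀ then coeff W s ⟨g, h⟩ else 0 := by
  rw [coeff, proj_algebraMap, MonoidAlgebra.mapDomainAlgHom_apply, MonoidAlgebra.coeff_mapDomain]
  split_ifs with h
  · exact Finsupp.mapDomain_apply (levelInclusion_injective ho W) _
      ((⟨g, h⟩ : G₀) : G₀ ⧸ W.toSubgroup)
  · refine Finsupp.mapDomain_of_notMem_range _ _ ?_
    rintro ⟨j, hj⟩
    refine h ?_
    induction j using QuotientGroup.induction_on with | H z =>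
    have h1 : (z : G)⁻¹ * g ∈ (mapOpenNormal ho W).toSubgroup := QuotientGroup.eq.1 hj
    simpa using G₀.mul_mem z.2 (mapOpenNormal_le ho W h1)

/-- `Λ(G)` is generated over `Λ(G₀)` by coset representatives. -/
theorem sum_restrict_smul_of [Fintype (G ⧸ G₀)] (x : IwasawaAlgebra p G) :
    ∑ i : G ⧸ G₀, restrict ho (of p i.out⁻¹ * x) • of p i.out = x := by
  classical
  refine ext fun V => ?_
  let W := comapOpenNormal (inclusionHom G₀) V
  have hWV : (mapOpenNormal ho W).toSubgroup ≤ V.toSubgroup := by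
    rintro _ ⟨w, hw, rfl⟩
    exact hw
  rw [← proj_compat _ hWV, ← proj_compat x hWV]
  congr 1
  ext k
  induction k using QuotientGroup.induction_on with | H g =>
  change coeff _ _ g = coeff _ _ g
  rw [coeff_sum]
  have hmem : ∀ i : G ⧸ G₀, g * i.out⁻¹ ∈ G₀ ↔ i = (g : G ⧸ G₀) := by
    intro i
    have h1 : g * i.out⁻¹ ∈ G₀ ↔ i.out⁻¹ * g ∈ G₀ := by
      constructor
      · intro h
        have h2 := Subgroup.mem_center_iff.1 (hG₀.1 h) i.out⁻¹
        have h3 : i.out⁻¹ * g = g * i.out⁻¹ := by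
          have h4 : i.out⁻¹ * (g * i.out⁻¹) * i.out = g * i.out⁻¹ * i.out⁻¹ * i.out := by rw [h2]
          simpa [mul_assoc] using h4
        rwa [h3]
      · intro h
        have h2 := Subgroup.mem_center_iff.1 (hG₀.1 h) i.out
        have h3 : g * i.out⁻¹ = i.out⁻¹ * g := by
          have h4 : i.out * (i.out⁻¹ * g) * i.out⁻¹ = i.out⁻¹ * g * i.out * i.out⁻¹ := by rw [h2]
          simpa [mul_assoc] using h4
        rwa [h3]
    rw [h1, ← QuotientGroup.eq, QuotientGroup.out_eq']
  simp only [Algebra.smul_def, coeff_mul_of, coeff_algebraMap, hmem]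
  rw [Finset.sum_eq_single (g : G ⧸ G₀)]
  · rw [dif_pos rfl, coeff_restrict, coeff_of_mul, inv_inv]
    have h1 := (hmem (g : G ⧸ G₀)).2 rfl
    have h2 := Subgroup.mem_center_iff.1 (hG₀.1 h1) (g : G ⧸ G₀).out
    congr 1
    change (g : G ⧸ G₀).out * (g * ((g : G ⧸ G₀).out)⁻¹) = g
    rw [h2, inv_mul_cancel_right]
  · intro i _ hi
    rw [dif_neg hi]
  · simp

include ho in
theorem finite_of_isOpen : Module.Finite (IwasawaAlgebra p G₀) (IwasawaAlgebra p G) := by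
  classical
  have : Finite (G ⧸ G₀) := Subgroup.quotient_finite_of_isOpen G₀ ho
  have := Fintype.ofFinite (G ⧸ G₀)
  refine ⟨⟨Finset.univ.image fun i : G ⧸ G₀ => of p i.out, ?_⟩⟩
  rw [eq_top_iff]
  intro x _
  rw [← sum_restrict_smul_of ho x]
  refine Submodule.sum_mem _ fun i _ => Submodule.smul_mem _ _ (Submodule.subset_span ?_)
  simp

theorem sum_restrict_mul_restrict [Fintype (G ⧸ G₀)] (a b : IwasawaAlgebra p G) :
    ∑ k : G ⧸ G₀, restrict ho (a * of p k.out) * restrict ho (of p k.out⁻¹ * b) =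
      restrict ho (a * b) := by
  conv_rhs => rw [← sum_restrict_smul_of ho b, Finset.mul_sum, map_sum]
  refine Finset.sum_congr rfl fun k _ => ?_
  rw [mul_smul_comm, map_smul, smul_eq_mul, mul_comm]

theorem restrict_of_mul_of [DecidableEq (G ⧸ G₀)] (i j : G ⧸ G₀) :
    restrict ho (of p i.out⁻¹ * of p j.out) = if i = j then 1 else 0 := by
  classical
  refine ext_coeff fun W z => ?_
  rw [coeff_restrict, ← map_mul, coeff_of]
  by_cases hij : i = j
  · subst hij
    rw [if_pos rfl, inv_mul_cancel, inv_one, one_mul, ← map_one (of p), coeff_of, inv_one, one_mul]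
    simp only [mem_mapOpenNormal]
  · rw [if_neg hij, if_neg]
    · simp [coeff]
    · intro h
      refine hij ?_
      rw [← QuotientGroup.out_eq' i, ← QuotientGroup.out_eq' j, QuotientGroup.eq]
      have := G₀.mul_mem z.2 (G₀.inv_mem (mapOpenNormal_le ho W h))
      simpa using this

/-- The matrix of the left multiplication by an element of `Λ(G)`, with respect to the basis of
`Λ(G)` over `Λ(G₀)` given by coset representatives. -/
def mulMatrix : IwasawaAlgebra p G →ₗ[IwasawaAlgebra p G₀]
    Matrix (G ⧸ G₀) (G ⧸ G₀) (IwasawaAlgebra p G₀) where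
  toFun y := Matrix.of fun i j => restrict ho (of p i.out⁻¹ * (y * of p j.out))
  map_add' x y := by
    ext i j
    simp [mul_add, add_mul]
  map_smul' s x := by
    ext i j
    simp

theorem mulMatrix_apply (y : IwasawaAlgebra p G) (i j : G ⧸ G₀) :
    mulMatrix ho y i j = restrict ho (of p i.out⁻¹ * (y * of p j.out)) := rfl

/-- The left regular representation of `Λ(G)` by matrices over `Λ(G₀)`. -/
def mulMatrixHom [Fintype (G ⧸ G₀)] [DecidableEq (G ⧸ G₀)] :
    IwasawaAlgebra p G →ₐ[IwasawaAlgebra p G₀]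
      Matrix (G ⧸ G₀) (G ⧸ G₀) (IwasawaAlgebra p G₀) :=
  AlgHom.ofLinearMap (mulMatrix ho)
    (by
      refine Matrix.ext fun i j => ?_
      rw [mulMatrix_apply, one_mul, restrict_of_mul_of, Matrix.one_apply])
    (by
      intro x y
      refine Matrix.ext fun i j => ?_
      rw [Matrix.mul_apply]
      simp only [mulMatrix_apply]
      simp only [← mul_assoc]
      simp only [mul_assoc _ y]
      rw [sum_restrict_mul_restrict])

theorem trace_mulMatrixHom [Fintype (G ⧸ G₀)] [DecidableEq (G ⧸ G₀)] (y : IwasawaAlgebra p G) :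
    (mulMatrixHom ho y).trace = (Nat.card (G ⧸ G₀) : IwasawaAlgebra p G₀) * restrict ho y := by
  rw [Matrix.trace, Nat.card_eq_fintype_card, ← nsmul_eq_mul, ← Finset.card_univ,
    ← Finset.sum_const]
  refine Finset.sum_congr rfl fun i _ => ?_
  change restrict ho (of p i.out⁻¹ * (y * of p i.out)) = _
  rw [restrict_mul_comm, mul_assoc, ← map_mul, mul_inv_cancel, map_one, mul_one]

theorem eq_zero_of_restrict_eq_zero {x : IwasawaAlgebra p G}
    (h : ∀ g, restrict ho (of p g * x) = 0) : x = 0 := by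
  have : Finite (G ⧸ G₀) := Subgroup.quotient_finite_of_isOpen G₀ ho
  have := Fintype.ofFinite (G ⧸ G₀)
  rw [← sum_restrict_smul_of ho x]
  exact Finset.sum_eq_zero fun i _ => by rw [h, zero_smul]

include ho in
theorem smul_right_injective_of_mem_nonZeroDivisors {s : IwasawaAlgebra p G₀}
    (hs : s ∈ nonZeroDivisors (IwasawaAlgebra p G₀)) {x : IwasawaAlgebra p G} (h : s • x = 0) :
    x = 0 := by
  refine eq_zero_of_restrict_eq_zero ho fun g => ?_
  have h1 : s * restrict ho (of p g * x) = 0 := by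
    rw [← smul_eq_mul, ← map_smul, ← mul_smul_comm, h, mul_zero, map_zero]
  exact (mul_left_mem_nonZeroDivisors_eq_zero_iff hs).1 h1

end Trace

end IwasawaAlgebra

/-! ### The total ring of fractions of the Iwasawa algebra -/

section TotalFractions

variable {R A : Type*} [CommRing R] [Ring A] [Algebra R A]

theorem toTotalFractions_injective : Function.Injective (toTotalFractions A R) :=
  OreLocalization.numeratorHom_inj fun _ hs => hs.2.1

theorem isUnit_toTotalFractions {c : A} (hc : c ∈ centralRegular A) :
    IsUnit (toTotalFractions A R c) :=
  OreLocalization.numerator_isUnit ⟨c, hc⟩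

/-- If the `R`-algebra `A` is finite, then every element of its total ring of
fractions has a denominator in `R`. -/
theorem exists_toTotalFractions_eq_smul [IsDomain R] [Module.Finite R A] (x : TotalFractions A) :
    ∃ r ∈ nonZeroDivisors R, ∃ a, toTotalFractions A R a = r • x := by
  induction x using OreLocalization.ind with | c a s =>
  obtain ⟨P, hP, hPs⟩ := IsIntegral.of_finite R (s : A)
  rw [← Polynomial.aeval_def] at hPs
  obtain ⟨Q, hPQ, hQ⟩ := Polynomial.exists_eq_pow_rootMultiplicity_mul_and_not_dvd P hP.ne_zero 0
  rw [map_zero, sub_zero] at hPQ hQ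
  rw [Polynomial.X_dvd_iff] at hQ
  -- The constant coefficient of `Q` is a multiple of `s`.
  have hQs : Polynomial.aeval (s : A) Q = 0 := by
    rw [hPQ, map_mul, map_pow, Polynomial.aeval_X] at hPs
    have hs : (s : A) ^ P.rootMultiplicity 0 ∈ nonZeroDivisors A :=
      pow_mem (S := nonZeroDivisors A) s.2.2 _
    exact hs.1 _ hPs
  have hconst : algebraMap R A (Q.coeff 0) = -Polynomial.aeval (s : A) Q.divX * s := by
    rw [← Polynomial.divX_mul_X_add Q, map_add, map_mul, Polynomial.aeval_X,
      Polynomial.aeval_C] at hQs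
    rw [neg_mul]
    exact eq_neg_of_add_eq_zero_right hQs
  refine ⟨Q.coeff 0, mem_nonZeroDivisors_of_ne_zero hQ, -Polynomial.aeval (s : A) Q.divX * a, ?_⟩
  rw [Algebra.smul_def, ← AlgHom.commutes (toTotalFractions A R), hconst]
  exact OreLocalization.mul_cancel'.symm

end TotalFractions

namespace IwasawaAlgebra

section Orders

variable {p : ℕ} [Fact p.Prime] {G : Type*} [Group G] [TopologicalSpace G]
  [IsTopologicalGroup G] [CompactSpace G] {G₀ : Subgroup G} [hG₀ : Fact (G₀ ≤ Subgroup.center G)]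
  (ho : IsOpen (G₀ : Set G))

include ho in
theorem algebraMap_mem_centralRegular {s : IwasawaAlgebra p G₀}
    (hs : s ∈ nonZeroDivisors (IwasawaAlgebra p G₀)) :
    algebraMap _ (IwasawaAlgebra p G) s ∈ centralRegular (IwasawaAlgebra p G) := by
  refine ⟨Submonoid.mem_center_iff.2 fun x => (Algebra.commutes s x).symm, ?_, ?_⟩
  · intro x hx
    rw [← Algebra.smul_def] at hx
    exact smul_right_injective_of_mem_nonZeroDivisors ho hs hx
  · intro x hx
    rw [← Algebra.commutes, ← Algebra.smul_def] at hx
    exact smul_right_injective_of_mem_nonZeroDivisors ho hs hx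

omit [IsTopologicalGroup G] [CompactSpace G] in
theorem isUnit_natCast_totalFractions {n : ℕ} (hn : n ≠ 0) :
    IsUnit (n : TotalFractions (IwasawaAlgebra p G)) := by
  have := isUnit_toTotalFractions (R := ℤ_[p]) (natCast_mem_centralRegular (p := p) (G := G) hn)
  rwa [map_natCast] at this

include ho in
theorem eq_zero_of_smul_eq_zero {s : IwasawaAlgebra p G₀}
    (hs : s ∈ nonZeroDivisors (IwasawaAlgebra p G₀)) {x : TotalFractions (IwasawaAlgebra p G)}
    (hx : s • x = 0) : x = 0 := by
  have h1 := isUnit_toTotalFractions (R := IwasawaAlgebra p G₀)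
    (algebraMap_mem_centralRegular ho hs)
  rw [AlgHom.commutes] at h1
  rw [Algebra.smul_def] at hx
  exact h1.mul_right_eq_zero.1 hx

variable [IsDomain (IwasawaAlgebra p G₀)]

include ho in
theorem isOrderIn_cornerOf_totalFractions {ε : IwasawaAlgebra p G} (hc : ∀ x, Commute ε x)
    (hid : ε * ε = ε) :
    IsOrderIn (IwasawaAlgebra p G₀)
      (toTotalFractions (IwasawaAlgebra p G) (IwasawaAlgebra p G₀) ε)
      (cornerOf (IwasawaAlgebra p G₀)
        (toTotalFractions (IwasawaAlgebra p G) (IwasawaAlgebra p G₀)).range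
        (toTotalFractions (IwasawaAlgebra p G) (IwasawaAlgebra p G₀) ε)) := by
  have := finite_of_isOpen (p := p) ho
  exact isOrderIn_cornerOf _ hc hid exists_toTotalFractions_eq_smul

variable [IsIntegrallyClosed (IwasawaAlgebra p G₀)]

include ho in
/-- Multiplication by the index of `G₀` maps every order containing `Λ(G)ε` into `Λ(G)ε`: the
coefficients of an element are, up to this index, traces of integral elements. -/
theorem card_mul_mem_cornerOf {ε : IwasawaAlgebra p G} (hc : ∀ x, Commute ε x)
    (hid : ε * ε = ε) {O : Submodule (IwasawaAlgebra p G₀) (TotalFractions (IwasawaAlgebra p G))}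
    (hO : IsOrderIn (IwasawaAlgebra p G₀)
      (toTotalFractions (IwasawaAlgebra p G) (IwasawaAlgebra p G₀) ε) O)
    (hle : cornerOf (IwasawaAlgebra p G₀)
        (toTotalFractions (IwasawaAlgebra p G) (IwasawaAlgebra p G₀)).range
        (toTotalFractions (IwasawaAlgebra p G) (IwasawaAlgebra p G₀) ε) ≤ O)
    {x : TotalFractions (IwasawaAlgebra p G)} (hx : x ∈ O) :
    ∃ a, a * ε = a ∧ toTotalFractions (IwasawaAlgebra p G) (IwasawaAlgebra p G₀) a =
      (Nat.card (G ⧸ G₀) : TotalFractions (IwasawaAlgebra p G)) * x := by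
  classical
  have hfin : Finite (G ⧸ G₀) := Subgroup.quotient_finite_of_isOpen G₀ ho
  have := Fintype.ofFinite (G ⧸ G₀)
  set n := Nat.card (G ⧸ G₀)
  set φ := toTotalFractions (IwasawaAlgebra p G) (IwasawaAlgebra p G₀) with hφ
  have hφi : Function.Injective φ := toTotalFractions_injective
  obtain ⟨f, hf, hfO⟩ := (isOrderIn_cornerOf_totalFractions ho hc hid).exists_smul_mem hO
  obtain ⟨y, hy, hyx⟩ := (mem_cornerOf_range hid).1 (hfO x hx)
  have hdvd : ∀ g, f ∣ (n : IwasawaAlgebra p G₀) * restrict ho (y * of p g) := by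
    intro g
    have hxg : x * φ (of p g) ∈ O := by
      have h1 : x * φ (of p g) = x * φ (of p g * ε) := by
        rw [← (hc _).eq, map_mul, ← mul_assoc, (hO.le_corner x hx).2]
      rw [h1]
      refine hO.mul_mem _ hx _ (hle ((mem_cornerOf_range hid).2 ⟨of p g * ε, ?_, rfl⟩))
      rw [mul_assoc, hid]
    obtain ⟨P, hP, hPx⟩ := hO.exists_monic_aeval_eq_zero hxg
    have h2 : Polynomial.aeval (y * of p g) (P.scaleRoots f) = 0 := by
      apply hφi
      rw [← Polynomial.aeval_algHom_apply, map_mul, hyx, smul_mul_assoc, aeval_scaleRoots_smul, hPx,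
        smul_zero, map_zero]
    have h3 : Polynomial.aeval (mulMatrixHom ho (y * of p g)) (P.scaleRoots f) = 0 := by
      rw [Polynomial.aeval_algHom_apply, h2, map_zero]
    rw [← trace_mulMatrixHom]
    exact Matrix.dvd_trace_of_aeval_scaleRoots _ (nonZeroDivisors.ne_zero hf) hP h3
  -- The coefficients of `y` are divisible by `f` after multiplication by the index, so the index
  -- multiplies `x = y / f` into `Λ(G)`.
  choose s hs using hdvd
  have hz : (n : IwasawaAlgebra p G) * y = f • ∑ i : G ⧸ G₀, s i.out⁻¹ • of p i.out := by
    conv_lhs => rw [← sum_restrict_smul_of ho y]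
    rw [Finset.mul_sum, Finset.smul_sum]
    refine Finset.sum_congr rfl fun i _ => ?_
    rw [smul_smul, ← hs, restrict_mul_comm, mul_smul, ← nsmul_eq_mul, Nat.cast_smul_eq_nsmul]
  set z : IwasawaAlgebra p G := ∑ i : G ⧸ G₀, s i.out⁻¹ • of p i.out
  have hzx : φ z = n * x := by
    refine sub_eq_zero.1 (eq_zero_of_smul_eq_zero ho hf ?_)
    rw [smul_sub, ← map_smul, ← hz, map_mul, map_natCast, hyx, mul_smul_comm, sub_self]
  refine ⟨z, hφi ?_, hzx⟩
  rw [map_mul, hzx, mul_assoc, (hO.le_corner x hx).2]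

include ho in
theorem exists_pow_mul_mem_cornerOf {ε : IwasawaAlgebra p G} (hc : ∀ x, Commute ε x)
    (hid : ε * ε = ε) {O : Submodule (IwasawaAlgebra p G₀) (TotalFractions (IwasawaAlgebra p G))}
    (hO : IsOrderIn (IwasawaAlgebra p G₀)
      (toTotalFractions (IwasawaAlgebra p G) (IwasawaAlgebra p G₀) ε) O)
    (hle : cornerOf (IwasawaAlgebra p G₀)
        (toTotalFractions (IwasawaAlgebra p G) (IwasawaAlgebra p G₀)).range
        (toTotalFractions (IwasawaAlgebra p G) (IwasawaAlgebra p G₀) ε) ≤ O) :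
    ∃ k : ℕ, ∀ x ∈ O, (p : TotalFractions (IwasawaAlgebra p G)) ^ k * x ∈
      cornerOf (IwasawaAlgebra p G₀)
        (toTotalFractions (IwasawaAlgebra p G) (IwasawaAlgebra p G₀)).range
        (toTotalFractions (IwasawaAlgebra p G) (IwasawaAlgebra p G₀) ε) := by
  have hfin : Finite (G ⧸ G₀) := Subgroup.quotient_finite_of_isOpen G₀ ho
  have hn0 : (Nat.card (G ⧸ G₀) : ℤ_[p]) ≠ 0 := Nat.cast_ne_zero.2 Nat.card_pos.ne'
  set n := Nat.card (G ⧸ G₀) with hn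
  refine ⟨(n : ℤ_[p]).valuation, fun x hx => ?_⟩
  obtain ⟨a, ha, hax⟩ := card_mul_mem_cornerOf ho hc hid hO hle hx
  set u : ℤ_[p] := ((PadicInt.unitCoeff hn0)⁻¹ : ℤ_[p]ˣ).1 with hu
  have hun : (p : ℤ_[p]) ^ (n : ℤ_[p]).valuation = u * n := by
    conv_rhs => rw [PadicInt.unitCoeff_spec hn0]
    rw [hu, Units.inv_mul_cancel_left]
  refine (mem_cornerOf_range hid).2 ⟨u • a, by rw [smul_mul_assoc, ha], ?_⟩
  set φ := toTotalFractions (IwasawaAlgebra p G) (IwasawaAlgebra p G₀) with hφ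
  have h1 : φ (algebraMap ℤ_[p] _ u) * (n : TotalFractions (IwasawaAlgebra p G)) =
      (p : TotalFractions (IwasawaAlgebra p G)) ^ (n : ℤ_[p]).valuation := by
    have := congrArg (fun r => φ (algebraMap ℤ_[p] (IwasawaAlgebra p G) r)) hun
    simpa using this.symm
  rw [Algebra.smul_def, map_mul, hax, ← mul_assoc, h1]

end Orders

end IwasawaAlgebra

/-! ### Descent of maximality from the Iwasawa algebra to the group ring -/

namespace IwasawaAlgebra

section Conjugation

variable {p : ℕ} [Fact p.Prime] {G : Type*} [Group G] {H : Subgroup G} [H.Normal]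

theorem conjGroupRing_conjGroupRing_inv (g : G) (x : MonoidAlgebra ℤ_[p] H) :
    conjGroupRing H g (conjGroupRing H g⁻¹ x) = x := by
  induction x using MonoidAlgebra.induction_linear with
  | zero => simp
  | add a b ha hb => rw [map_add, map_add, ha, hb]
  | single m r =>
    rw [conjGroupRing_single, conjGroupRing_single]
    congr 1
    exact Subtype.ext (by simp)

theorem redModP_conjGroupRing (g : G) (x : MonoidAlgebra ℤ_[p] H) :
    redModP p H (conjGroupRing H g x) =
      MonoidAlgebra.domCongr (ZMod p) (ZMod p) (MulAut.conjNormal g) (redModP p H x) := by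
  induction x using MonoidAlgebra.induction_linear with
  | zero => simp
  | add a b ha hb => rw [map_add, map_add, map_add, map_add, ha, hb]
  | single m r =>
    rw [conjGroupRing_single]
    simp [redModP]

theorem conjGroupRing_mem_radicalLattice {ε : MonoidAlgebra ℤ_[p] H}
    (hε : ∀ g, conjGroupRing H g ε = ε) (g : G) {x : MonoidAlgebra ℤ_[p] H}
    (hx : x ∈ radicalLattice ε) : conjGroupRing H g x ∈ radicalLattice ε := by
  refine ⟨?_, ?_⟩
  · conv_lhs => rw [← hε g]
    rw [← map_mul, hx.1]
  · rw [redModP_conjGroupRing]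
    let f : MonoidAlgebra (ZMod p) H →+* MonoidAlgebra (ZMod p) H :=
      (MonoidAlgebra.domCongr (ZMod p) (ZMod p) (MulAut.conjNormal (H := H) g)).toRingEquiv
    have : RingHomSurjective f := ⟨(MonoidAlgebra.domCongr (ZMod p) (ZMod p)
      (MulAut.conjNormal (H := H) g)).surjective⟩
    exact Ring.le_comap_jacobson f hx.2

theorem conjGroupRing_mem_rightOrder {ε : MonoidAlgebra ℤ_[p] H}
    (hε : ∀ g, conjGroupRing H g ε = ε) (g : G) {b : MonoidAlgebra ℤ_[p] H}
    (hb : b ∈ rightOrder ε) : conjGroupRing H g b ∈ rightOrder ε := by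
  refine ⟨?_, fun x hx => ?_⟩
  · conv_lhs => rw [← hε g]
    rw [← map_mul, hb.1]
  · obtain ⟨y, hy, h⟩ := hb.2 _ (conjGroupRing_mem_radicalLattice hε g⁻¹ hx)
    refine ⟨_, conjGroupRing_mem_radicalLattice hε g hy, ?_⟩
    have := congrArg (conjGroupRing H g) h
    rwa [map_mul, map_mul, conjGroupRing_conjGroupRing_inv, map_natCast] at this

end Conjugation

section Descent

variable {p : ℕ} [Fact p.Prime] {G : Type*} [Group G] [TopologicalSpace G]
  [IsTopologicalGroup G] [CompactSpace G] {G₀ : Subgroup G} [hG₀ : Fact (G₀ ≤ Subgroup.center G)]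
  (ho : IsOpen (G₀ : Set G)) {H : Subgroup G} [H.Normal]

include ho in
theorem commute_ofGroupRing {ε : MonoidAlgebra ℤ_[p] H} (hε : ∀ g : G, conjGroupRing H g ε = ε)
    (x : IwasawaAlgebra p G) : Commute (ofGroupRing p H ε) x := by
  have : Finite (G ⧸ G₀) := Subgroup.quotient_finite_of_isOpen G₀ ho
  have := Fintype.ofFinite (G ⧸ G₀)
  rw [← sum_restrict_smul_of ho x]
  refine Commute.sum_right _ _ _ fun i _ => Commute.smul_right ?_ _
  have h := of_mul_ofGroupRing (p := p) H i.out ε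
  rw [hε] at h
  exact h.symm

variable [Fintype H]

include ho in
/-- If `Λ(G)ε` is a maximal order, then `ℤ_p[H]ε` is the right order of its radical lattice: that
right order is stable under conjugation, so it generates an order that contains `Λ(G)ε`. -/
theorem dvd_of_mem_rightOrder_of_isMaximalOrderIn {ε : MonoidAlgebra ℤ_[p] H}
    (hε : ∀ g : G, conjGroupRing H g ε = ε) (hcH : ∀ x, Commute ε x) (hid : ε * ε = ε)
    (U : OpenNormalSubgroup G) (hU : ∀ h ∈ H, h ∈ U.toSubgroup → h = 1)
    (hmax : IsMaximalOrderIn (IwasawaAlgebra p G₀)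
      (toTotalFractions (IwasawaAlgebra p G) (IwasawaAlgebra p G₀) (ofGroupRing p H ε))
      (cornerOf (IwasawaAlgebra p G₀)
        (toTotalFractions (IwasawaAlgebra p G) (IwasawaAlgebra p G₀)).range
        (toTotalFractions (IwasawaAlgebra p G) (IwasawaAlgebra p G₀) (ofGroupRing p H ε)))) :
    ∀ b ∈ rightOrder ε, (p : MonoidAlgebra ℤ_[p] H) ∣ b := by
  classical
  have hfin : Finite (G ⧸ G₀) := Subgroup.quotient_finite_of_isOpen G₀ ho
  have := Fintype.ofFinite (G ⧸ G₀)
  set φ := ofGroupRing p H with hφ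
  have hid' : φ ε * φ ε = φ ε := by rw [← map_mul, hid]
  let M : Submodule (IwasawaAlgebra p G₀) (IwasawaAlgebra p G) :=
    Submodule.span _ {y | ∃ b ∈ rightOrder ε, ∃ g, φ b * of p g = y}
  have hmem : ∀ b ∈ rightOrder ε, ∀ g, φ b * of p g ∈ M := fun b hb g =>
    Submodule.subset_span ⟨b, hb, g, rfl⟩
  -- `M` is generated by the products of generators of the right order with coset representatives.
  have hfg : M.FG := by
    obtain ⟨s, hs⟩ := IsNoetherian.noetherian (rightOrder ε)
    refine ⟨(s ×ˢ Finset.univ).image fun q : _ × (G ⧸ G₀) => φ q.1 * of p q.2.out,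
      le_antisymm (Submodule.span_le.2 ?_) (Submodule.span_le.2 ?_)⟩
    · intro y hy
      obtain ⟨⟨b, i⟩, hq, rfl⟩ := Finset.mem_image.1 hy
      refine hmem b ?_ _
      rw [← hs]
      exact Submodule.subset_span (Finset.mem_product.1 hq).1
    · rintro _ ⟨b, hb, g, rfl⟩
      set i : G ⧸ G₀ := (g : G ⧸ G₀) with hi
      have hz : i.out⁻¹ * g ∈ G₀ := by rw [← QuotientGroup.eq, QuotientGroup.out_eq', hi]
      have hg : of p g = algebraMap (IwasawaAlgebra p G₀) (IwasawaAlgebra p G)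
          (of p ⟨i.out⁻¹ * g, hz⟩) * of p i.out := by
        have h1 : algebraMap (IwasawaAlgebra p G₀) (IwasawaAlgebra p G)
            (of p ⟨i.out⁻¹ * g, hz⟩) = of p (i.out⁻¹ * g) := map_of (inclusionHom G₀) _
        rw [h1, ← map_mul, ← Subgroup.mem_center_iff.1 (hG₀.1 hz), mul_inv_cancel_left]
      rw [hg, ← Algebra.smul_def, mul_smul_comm]
      refine Submodule.smul_mem _ _ ?_
      rw [← hs] at hb
      induction hb using Submodule.span_induction with
      | mem b hb =>
        exact Submodule.subset_span (Finset.mem_image.2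
          ⟨(b, i), Finset.mem_product.2 ⟨hb, Finset.mem_univ _⟩, rfl⟩)
      | zero => rw [map_zero, zero_mul]; exact zero_mem _
      | add x y _ _ hx hy => rw [map_add, add_mul]; exact add_mem hx hy
      | smul r x _ hx =>
        have h1 : φ (r • x) * of p i.out =
            algebraMap ℤ_[p] (IwasawaAlgebra p G₀) r • (φ x * of p i.out) := by
          rw [map_smul, Algebra.smul_def, Algebra.smul_def, mul_assoc]
          congr 1
          exact ((map (inclusionHom G₀)).commutes r).symm
        rw [h1]
        exact Submodule.smul_mem _ _ hx
  have key := dvd_of_isMaximalOrderIn (toTotalFractions (IwasawaAlgebra p G) (IwasawaAlgebra p G₀))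
    toTotalFractions_injective (commute_ofGroupRing ho hε) hid' p
    (isUnit_natCast_totalFractions (Fact.out (p := p.Prime)).ne_zero) hmax M hfg ?_ ?_ ?_
  · intro b hb
    refine dvd_of_dvd_ofGroupRing H U hU (key _ ?_)
    simpa using hmem b hb 1
  · intro x hx
    induction hx using Submodule.span_induction with
    | mem x hx =>
      obtain ⟨b, hb, g, rfl⟩ := hx
      rw [mul_assoc, ← (commute_ofGroupRing ho hε (of p g)).eq, ← mul_assoc, ← map_mul,
        ← (hcH b).eq, hb.1]
    | zero => rw [zero_mul]
    | add x y _ _ hx hy => rw [add_mul, hx, hy]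
    | smul r x _ hx => rw [smul_mul_assoc, hx]
  · intro x hx
    rw [← hx, ← sum_restrict_smul_of ho x, Finset.sum_mul, Finset.mul_sum]
    refine sum_mem fun i _ => ?_
    rw [smul_mul_assoc, mul_smul_comm]
    refine Submodule.smul_mem _ _ ?_
    rw [← (commute_ofGroupRing ho hε _).eq, ← mul_assoc]
    have h1 := hmem _ (natCast_mul_mem_rightOrder hid) i.out
    rwa [map_mul, map_natCast] at h1
  · intro x hx y hy
    induction hx, hy using Submodule.span_induction₂ with
    | mem_mem x y hx hy =>
      obtain ⟨b, hb, g, rfl⟩ := hx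
      obtain ⟨c, hc, g', rfl⟩ := hy
      obtain ⟨z, hz, hbz⟩ := rightOrder_mul hid hb (conjGroupRing_mem_rightOrder hε g hc)
      refine ⟨φ z * of p (g * g'), hmem z hz _, ?_⟩
      have h1 := of_mul_ofGroupRing (p := p) H g c
      rw [mul_assoc, ← mul_assoc (of p g), h1, ← mul_assoc, ← mul_assoc, ← map_mul, hbz, map_mul,
        map_natCast, map_mul, mul_assoc, mul_assoc]
    | zero_left y _ => exact ⟨0, zero_mem _, by simp⟩
    | zero_right x _ => exact ⟨0, zero_mem _, by simp⟩
    | add_left x y z _ _ _ h1 h2 =>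
      obtain ⟨a, ha, h1⟩ := h1
      obtain ⟨b, hb, h2⟩ := h2
      exact ⟨a + b, add_mem ha hb, by rw [add_mul, h1, h2, mul_add]⟩
    | add_right x y z _ _ _ h1 h2 =>
      obtain ⟨a, ha, h1⟩ := h1
      obtain ⟨b, hb, h2⟩ := h2
      exact ⟨a + b, add_mem ha hb, by rw [mul_add, h1, h2, mul_add]⟩
    | smul_left r x y _ _ h =>
      obtain ⟨a, ha, h⟩ := h
      exact ⟨r • a, Submodule.smul_mem _ _ ha, by rw [smul_mul_assoc, h, mul_smul_comm]⟩
    | smul_right r x y _ _ h =>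
      obtain ⟨a, ha, h⟩ := h
      exact ⟨r • a, Submodule.smul_mem _ _ ha, by rw [mul_smul_comm, h, mul_smul_comm]⟩

end Descent

end IwasawaAlgebra

/-! ### Trace idempotents -/

section FiniteGroup

variable {p : ℕ} [Fact p.Prime] {H : Type*} [Group H]

variable (p) in
/-- The sum of the elements of a finite subgroup, in the group ring. -/
def subgroupSum (N : Subgroup H) [Fintype N] : MonoidAlgebra ℤ_[p] H :=
  ∑ σ : N, .single (σ : H) 1

theorem single_mul_subgroupSum (N : Subgroup H) [Fintype N] (τ : N) :
    MonoidAlgebra.single (τ : H) 1 * subgroupSum p N = subgroupSum p N := by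
  rw [subgroupSum, Finset.mul_sum]
  refine Fintype.sum_equiv (Equiv.mulLeft τ) _ _ fun σ => ?_
  rw [MonoidAlgebra.single_mul_single, mul_one]
  rfl

theorem subgroupSum_mul_self (N : Subgroup H) [Fintype N] :
    subgroupSum p N * subgroupSum p N = (Nat.card N : ℤ_[p]) • subgroupSum p N := by
  conv_lhs => rw [subgroupSum, Finset.sum_mul]
  rw [← subgroupSum]
  simp only [single_mul_subgroupSum]
  rw [Finset.sum_const, Finset.card_univ, Nat.card_eq_fintype_card, Nat.cast_smul_eq_nsmul]

theorem natCast_mul_groupRingTraceIdempotent (N : Subgroup H) [Fintype N] :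
    (Nat.card N : MonoidAlgebra ℚ_[p] H) * groupRingTraceIdempotent p N =
      padicInclusion p H (subgroupSum p N) := by
  have hn : (Nat.card N : ℚ_[p]) ≠ 0 := Nat.cast_ne_zero.2 Nat.card_pos.ne'
  rw [groupRingTraceIdempotent, ← nsmul_eq_mul, ← Nat.cast_smul_eq_nsmul ℚ_[p], smul_smul,
    mul_inv_cancel₀ hn, one_smul, subgroupSum, map_sum]
  refine Finset.sum_congr (Finset.ext fun _ => by simp) fun σ _ => ?_
  simp

theorem coeff_one_subgroupSum (N : Subgroup H) [Fintype N] :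
    (subgroupSum p N).coeff 1 = 1 := by
  classical
  rw [subgroupSum, MonoidAlgebra.coeff_sum, Finsupp.finsetSum_apply, Finset.sum_eq_single 1]
  · simp
  · intro σ _ hσ
    rw [MonoidAlgebra.coeff_single, Finsupp.single_apply, if_neg]
    simpa using hσ
  · simp

/-- The idempotent `e_N` has coefficients in `ℤ_p` only if `|N|` is a unit. -/
theorem isUnit_card_of_groupRingTraceIdempotent_mem [Fintype H] (N : Subgroup H) [Fintype N]
    (h : groupRingTraceIdempotent p N ∈ padicGroupRing p H) : IsUnit (Nat.card N : ℤ_[p]) := by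
  obtain ⟨x, hx⟩ := h
  have h1 : (Nat.card N : MonoidAlgebra ℤ_[p] H) * x = subgroupSum p N := by
    apply padicInclusion_injective
    rw [← natCast_mul_groupRingTraceIdempotent, ← hx, map_mul, map_natCast]
    rfl
  have h2 := congrArg (fun y : MonoidAlgebra ℤ_[p] H => y.coeff 1) h1
  simp only [MonoidAlgebra.natCast_mul_coeff, coeff_one_subgroupSum] at h2
  exact IsUnit.of_mul_eq_one _ h2

theorem padicInclusion_smul_subgroupSum [Fintype H] (N : Subgroup H) [Fintype N] {u : ℤ_[p]}
    (hu : u * Nat.card N = 1) :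
    padicInclusion p H (u • subgroupSum p N) = groupRingTraceIdempotent p N := by
  have h := natCast_isUnit_padicAlgebra (p := p) (A := MonoidAlgebra ℚ_[p] H)
    (n := Nat.card N) Nat.card_pos.ne'
  apply h.mul_left_cancel
  rw [natCast_mul_groupRingTraceIdempotent, ← map_natCast (padicInclusion p H), ← map_mul,
    mul_smul_comm, ← nsmul_eq_mul, ← Nat.cast_smul_eq_nsmul ℤ_[p], smul_smul, hu, one_smul]

end FiniteGroup

namespace IwasawaAlgebra

variable {p : ℕ} [Fact p.Prime] {G : Type*} [Group G] [TopologicalSpace G]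

section Idempotent

variable {H N : Subgroup G} (hNH : N ≤ H) [Fintype (N.subgroupOf H)]

omit [TopologicalSpace G] in
theorem conjGroupRing_subgroupSum [H.Normal] [N.Normal] (g : G) :
    conjGroupRing H g (subgroupSum p (N.subgroupOf H)) = subgroupSum p (N.subgroupOf H) := by
  have hmem : ∀ (g : G) (σ : N.subgroupOf H), MulAut.conjNormal g (σ : H) ∈ N.subgroupOf H := by
    intro g σ
    rw [Subgroup.mem_subgroupOf, MulAut.conjNormal_apply]
    exact ‹N.Normal›.conj_mem _ σ.2 g
  rw [subgroupSum, map_sum]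
  refine Fintype.sum_equiv ⟨fun σ => ⟨_, hmem g σ⟩, fun σ => ⟨_, hmem g⁻¹ σ⟩, fun σ => ?_,
    fun σ => ?_⟩ _ _ fun σ => ?_
  · exact Subtype.ext (Subtype.ext (by simp))
  · exact Subtype.ext (Subtype.ext (by simp))
  · rw [conjGroupRing_single]
    rfl

variable [Finite N] {R : Type*} [CommRing R] [Algebra R (IwasawaAlgebra p G)]

include hNH in
theorem natCast_mul_traceIdempotent :
    (Nat.card N : TotalFractions (IwasawaAlgebra p G)) * traceIdempotent p N =
      toTotalFractions (IwasawaAlgebra p G) R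
        (ofGroupRing p H (subgroupSum p (N.subgroupOf H))) := by
  let _ := Fintype.ofFinite N
  have h1 : ofGroupRing p H (subgroupSum p (N.subgroupOf H)) = ∑ σ : N, of p (σ : G) := by
    rw [subgroupSum, map_sum]
    refine Fintype.sum_equiv (Subgroup.subgroupOfEquivOfLe hNH).toEquiv _ _ fun σ => ?_
    rw [ofGroupRing_single, one_smul]
    rfl
  rw [h1, ← map_natCast (toTotalFractions (IwasawaAlgebra p G) R)]
  exact OreLocalization.mul_cancel (s := (⟨(Nat.card N : IwasawaAlgebra p G),
    natCast_mem_centralRegular Nat.card_pos.ne'⟩ : centralRegular (IwasawaAlgebra p G)))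

include hNH in
theorem toTotalFractions_smul_subgroupSum {u : ℤ_[p]} (hu : u * Nat.card N = 1) :
    toTotalFractions (IwasawaAlgebra p G) R
      (ofGroupRing p H (u • subgroupSum p (N.subgroupOf H))) = traceIdempotent p N := by
  have h := isUnit_natCast_totalFractions (p := p) (G := G) (n := Nat.card N) Nat.card_pos.ne'
  apply h.mul_left_cancel
  rw [natCast_mul_traceIdempotent hNH (R := R), ← map_natCast (toTotalFractions _ R), ← map_mul,
    ← map_natCast (ofGroupRing p H), ← map_mul, mul_smul_comm, ← nsmul_eq_mul,
    ← Nat.cast_smul_eq_nsmul ℤ_[p], smul_smul, hu, one_smul]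

include hNH in
theorem isUnit_card_of_traceIdempotent_mem [Fintype H] (U : OpenNormalSubgroup G)
    (hU : ∀ h ∈ H, h ∈ U.toSubgroup → h = 1)
    (h : traceIdempotent p N ∈ (toTotalFractions (IwasawaAlgebra p G) R).range) :
    IsUnit (Nat.card N : ℤ_[p]) := by
  obtain ⟨x, hx⟩ := h
  have h1 : (Nat.card N : ℤ_[p]) • x = ofGroupRing p H (subgroupSum p (N.subgroupOf H)) := by
    apply toTotalFractions_injective (R := R)
    rw [← natCast_mul_traceIdempotent hNH, ← hx, Nat.cast_smul_eq_nsmul, map_nsmul, nsmul_eq_mul]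
    rfl
  have h2 := congrArg (fun y => coeff U y ((1 : H) : G)) h1
  simp only [coeff_ofGroupRing H U hU, coeff_one_subgroupSum, coeff_smul] at h2
  exact IsUnit.of_mul_eq_one _ h2

end Idempotent

end IwasawaAlgebra

end

theorem theorem3p10 (p : ℕ) [Fact p.Prime] (hp : Odd p)
    {𝒢 : Type*} [Group 𝒢] [TopologicalSpace 𝒢] [IsTopologicalGroup 𝒢]
    [CompactSpace 𝒢] [T2Space 𝒢] [TotallyDisconnectedSpace 𝒢]
    (H Γ : Subgroup 𝒢) [H.Normal] [Finite H]
    (hΓ : Nonempty (Γ ≃ₜ* Multiplicative ℤ_[p]))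
    (hHΓ : H.IsComplement' Γ)
    (N : Subgroup 𝒢) [N.Normal] [Finite N] :
    N ≤ H ∧ (N.subgroupOf H).Normal ∧
      ∀ (Γ₀ : Subgroup 𝒢) [Fact (Γ₀ ≤ Subgroup.center 𝒢)],
        Γ₀ ≤ Γ → IsOpen ((Γ₀.subgroupOf Γ : Subgroup Γ) : Set Γ) →
          (IwasawaAlgebra.IsHybrid p Γ₀ N ↔ GroupRingIsHybrid p (N.subgroupOf H)) := by
  obtain ⟨ψ⟩ := hΓ
  have hNH : N ≤ H := hHΓ.le_left_of_finite ψ N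
  refine ⟨hNH, inferInstance, fun Γ₀ hΓ₀ hle hopen => ?_⟩
  have := Fintype.ofFinite H
  have := Fintype.ofFinite (N.subgroupOf H)
  have hΓo : IsOpen (Γ : Set 𝒢) := hHΓ.isOpen_right ψ
  have ho : IsOpen (Γ₀ : Set 𝒢) := by
    have h1 := hΓo.isOpenMap_subtype_val _ hopen
    convert h1 using 1
    ext g
    exact ⟨fun hg => ⟨⟨g, hle hg⟩, hg, rfl⟩, by rintro ⟨γ, hγ, rfl⟩; exact hγ⟩
  obtain ⟨ψ₀⟩ := nonempty_continuousMulEquiv_padicInt_of_isOpen ψ hle hopen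
  have hcΓ₀ : CompactSpace Γ₀ := isCompact_iff_compactSpace.1 (Γ₀.isClosed_of_isOpen ho).isCompact
  have hdom : IsDomain (IwasawaAlgebra p Γ₀) := IwasawaAlgebra.isDomain_of_padic ψ₀
  have hint : IsIntegrallyClosed (IwasawaAlgebra p Γ₀) :=
    IwasawaAlgebra.isIntegrallyClosed_of_padic ψ₀
  obtain ⟨a, ha⟩ := exists_padicLevel_le ψ _ hopen
  have hcenter : padicLevel ψ a ≤ Subgroup.center 𝒢 := fun g hg =>
    hΓ₀.1 (ha ⟨g, padicLevel_le ψ a hg⟩ hg)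
  let U := padicLevelOpen ψ hΓo a hcenter
  have hU : ∀ h ∈ H, h ∈ U.toSubgroup → h = 1 := fun h hh hhU =>
    Subgroup.disjoint_def.1 hHΓ.disjoint hh (padicLevel_le ψ a hhU)
  have hcard : Nat.card (N.subgroupOf H) = Nat.card N :=
    Nat.card_congr (Subgroup.subgroupOfEquivOfLe hNH).toEquiv
  have hinj := IwasawaAlgebra.ofGroupRing_injective (p := p) H U hU
  -- Both conditions force `|N|` to be a unit in `ℤ_p`.
  suffices h : IsUnit (Nat.card N : ℤ_[p]) →
      (IwasawaAlgebra.IsHybrid p Γ₀ N ↔ GroupRingIsHybrid p (N.subgroupOf H)) by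
    refine ⟨fun h1 => ?_, fun h1 => ?_⟩
    · exact (h (IwasawaAlgebra.isUnit_card_of_traceIdempotent_mem hNH U hU h1.1)).1 h1
    · have h2 := isUnit_card_of_groupRingTraceIdempotent_mem _ h1.1
      rw [hcard] at h2
      exact (h h2).2 h1
  rintro ⟨n, hn⟩
  -- `e` is the common preimage of both trace idempotents in `ℤ_p[H]`.
  have hu : ((n⁻¹ : ℤ_[p]ˣ) : ℤ_[p]) * Nat.card N = 1 := by rw [← hn, Units.inv_mul]
  set u : ℤ_[p] := ((n⁻¹ : ℤ_[p]ˣ) : ℤ_[p])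
  set e : MonoidAlgebra ℤ_[p] H := u • subgroupSum p (N.subgroupOf H) with he
  have he1 : padicInclusion p H e = groupRingTraceIdempotent p (N.subgroupOf H) :=
    padicInclusion_smul_subgroupSum _ (by rw [hcard, hu])
  have he2 := IwasawaAlgebra.toTotalFractions_smul_subgroupSum hNH (R := IwasawaAlgebra p Γ₀) hu
  have hid : (1 - e) * (1 - e) = 1 - e := by
    have : e * e = e := by
      rw [he, smul_mul_smul_comm, subgroupSum_mul_self, hcard, smul_smul, mul_assoc, hu, mul_one]
    rw [sub_mul, mul_sub, mul_sub, this]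
    simp
  have hconj : ∀ g : 𝒢, IwasawaAlgebra.conjGroupRing H g (1 - e) = 1 - e := fun g => by
    rw [map_sub, map_one, he, map_smul, IwasawaAlgebra.conjGroupRing_subgroupSum]
  have hcΛ := IwasawaAlgebra.commute_ofGroupRing (p := p) ho hconj
  have hc : ∀ x, Commute (1 - e) x := fun x => hinj (by
    rw [map_mul, map_mul]
    exact (hcΛ _).eq)
  have hidΛ : IwasawaAlgebra.ofGroupRing p H (1 - e) * IwasawaAlgebra.ofGroupRing p H (1 - e) =
      IwasawaAlgebra.ofGroupRing p H (1 - e) := by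
    rw [← map_mul, hid]
  have hΛ : 1 - IwasawaAlgebra.traceIdempotent p N =
      toTotalFractions (IwasawaAlgebra p 𝒢) (IwasawaAlgebra p Γ₀)
        (IwasawaAlgebra.ofGroupRing p H (1 - e)) := by
    rw [map_sub, map_sub, map_one, map_one, he2]
  have hA : 1 - groupRingTraceIdempotent p (N.subgroupOf H) = padicInclusion p H (1 - e) := by
    rw [map_sub, map_one, he1]
  rw [IwasawaAlgebra.IsHybrid, GroupRingIsHybrid, hΛ, hA, and_iff_right ⟨_, he2⟩,
    and_iff_right ⟨_, he1⟩]
  constructor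
  · intro hmax
    obtain ⟨w, hw⟩ := exists_dvd_pElementSum_mul_sub hc hid
      (IwasawaAlgebra.dvd_of_mem_rightOrder_of_isMaximalOrderIn ho hconj hc hid U hU hmax)
    exact isMaximalOrderIn_padicGroupRing hc hid hw
  · intro hmax
    obtain ⟨w, hw⟩ := exists_dvd_pElementSum_mul_sub hc hid
      (dvd_of_mem_rightOrder_of_isMaximalOrderIn hc hid hmax)
    refine isMaximalOrderIn_of_nil _ toTotalFractions_injective hcΛ hidΛ p (fun x hx => ?_)
      (IwasawaAlgebra.isOrderIn_cornerOf_totalFractions ho hcΛ hidΛ)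
      (fun O hO hle => IwasawaAlgebra.exists_pow_mul_mem_cornerOf ho hcΛ hidΛ hO hle)
      (IwasawaAlgebra.dvd_of_right_nil ψ hΓo hHΓ ⟨a, hcenter⟩ hw)
    exact (IwasawaAlgebra.isUnit_natCast_totalFractions (p := p) (G := 𝒢)
      (Fact.out (p := p.Prime)).ne_zero).mul_right_eq_zero.1 hx
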